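/- Let $m\ge 1$ and let $(M^{4m},g)$ be a quaternionic Kähler manifold with Levi-Civita connection $\nabla$: there is a rank 3 subbundle $Q\subset \mathrm{End}\,TM$ of skew-adjoint endomorphisms, preserved by $\nabla$ and locally spanned by smooth $I,J,K$ with $I^2=J^2=-1$, $IJ=K=-JI$ (i.e. the holonomy is in $Sp(m)\cdot Sp(1)$). Let $X$ be a Killing vector field on $M$ (for instance, the generator of a circle action) with a moment section, that is, a smooth section $\boldsymbol\mu$ of $Q$ such that, for every such local basis $I_1,I_2,I_3$ of $Q$ and $\omega_i=g(I_i\,\cdot,\cdot)$ (identified with $I_i$), $$\nabla\boldsymbol\mu=\sum_{i=1}^3 i_X\omega_i\otimes\omega_i .$$ Let $M_0=\{\boldsymbol\mu\neq 0\}$, let $\mu_1=|\boldsymbol\mu|>0$ be the function on $M_0$ with $\boldsymbol\mu^2=-\mu_1^2$, and let $I_{\boldsymbol\mu}=\boldsymbol\mu/\mu_1$ be the almost complex structure on $M_0$ determined by $\boldsymbol\mu$. Let $SU^*(2m)$ be the group of complex $2m\times 2m$ matrices of determinant $1$ commuting with the antilinear map $j(z,w)=(\bar w,-\bar z)$ of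 $\mathbf C^m\oplus\mathbf C^m$, and $U^*(2m)=SU^*(2m)\cdot U(1)$. Then $M_0$ is open, and there is a unique torsion-free affine connection $\tilde\nabla$ on $M_0$ that preserves $Q$ (so that it defines the same quaternionic structure as $\nabla$) and the complex structure $I_{\boldsymbol\mu}$. Its holonomy at each $x\in M_0$ lies in $U^*(2m)$, for an identification $T_xM\cong\mathbf C^{2m}$ taking $I_{\boldsymbol\mu}$ to $i$ and $Q_x$ to the span of $i,j,ij$. It is given, with $\alpha=-\tfrac12 d\log\mu_1$ and any quaternionic basis $I,J,K$ of $Q$, by $$\tilde\nabla_ZY=\nabla_ZY+\alpha(Z)Y+\alpha(Y)Z-\alpha(IY)IZ-\alpha(IZ)IY-\alpha(JY)JZ-\alpha(JZ)JY-\alpha(KY)KZ-\alpha(KZ)KY .$$ In particular $I_{\boldsymbol\mu}$ is integrable (its Nijenhuis tensor vanishes). Moreover, if $m=1$, $g$ is Einstein and its Weyl tensor is anti-self-dual (where $Q$ is the bundle of self-dual 2-forms), then $\tilde\nabla$ is the Levi-Civita connection of $\mu_1^{-2}g$, and this metric, which is Kähler for $I_{\boldsymbol\mu}$, has zero scalar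 curvature. -/

import Mathlib

open Bundle Set Matrix VectorField
open scoped Manifold ContDiff Topology

noncomputable section

namespace QK

/-! ### Fields, connections and tensors on an `n`-manifold -/

/-- Vector fields (no regularity imposed). -/
abbrev VField (n : ℕ) (M : Type*) [TopologicalSpace M]
    [ChartedSpace (EuclideanSpace ℝ (Fin n)) M] : Type _ :=
  ∀ x : M, TangentSpace (𝓡 n) x

/-- Sections of `End TM` (no regularity imposed). -/
abbrev EndField (n : ℕ) (M : Type*) [TopologicalSpace M]
    [ChartedSpace (EuclideanSpace ℝ (Fin n)) M] : Type _ :=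
  ∀ x : M, TangentSpace (𝓡 n) x →L[ℝ] TangentSpace (𝓡 n) x

/-- Underlying operators of affine connections: `D Y x z` is `(D_z Y)(x)`. -/
abbrev ConnOp (n : ℕ) (M : Type*) [TopologicalSpace M]
    [ChartedSpace (EuclideanSpace ℝ (Fin n)) M] : Type _ :=
  VField n M → EndField n M

section General

variable {n : ℕ} {M : Type*} [TopologicalSpace M] [ChartedSpace (EuclideanSpace ℝ (Fin n)) M]

/-- The vector field `Y` is smooth on `U`. -/
def SmoothVOn [IsManifold (𝓡 n) ∞ M] (Y : VField n M) (U : Set M) : Prop :=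
  ContMDiffOn (𝓡 n) ((𝓡 n).prod 𝓘(ℝ, EuclideanSpace ℝ (Fin n))) ∞
    (fun x ↦ TotalSpace.mk' (EuclideanSpace ℝ (Fin n)) x (Y x)) U

/-- The section `A` of `End TM` is smooth on `U`. -/
def SmoothEndOn [IsManifold (𝓡 n) ∞ M] (A : EndField n M) (U : Set M) : Prop :=
  ContMDiffOn (𝓡 n)
    ((𝓡 n).prod 𝓘(ℝ, EuclideanSpace ℝ (Fin n) →L[ℝ] EuclideanSpace ℝ (Fin n))) ∞
    (fun x ↦ TotalSpace.mk' (EuclideanSpace ℝ (Fin n) →L[ℝ] EuclideanSpace ℝ (Fin n))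
      (E := fun x : M ↦ TangentSpace (𝓡 n) x →L[ℝ] TangentSpace (𝓡 n) x) x (A x)) U

/-- The vector field `Y` is differentiable at `x`. -/
def DiffVAt [IsManifold (𝓡 n) ∞ M] (Y : VField n M) (x : M) : Prop :=
  MDifferentiableAt (𝓡 n) ((𝓡 n).prod 𝓘(ℝ, EuclideanSpace ℝ (Fin n)))
    (fun y ↦ TotalSpace.mk' (EuclideanSpace ℝ (Fin n)) y (Y y)) x

/-- `D` is a smooth affine connection on the open set `U`. (Only the values of `D Y` at points of
`U`, for `Y` differentiable there, are meaningful; they depend only on the germ of `Y`.) -/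
structure IsAffineConnectionOn [IsManifold (𝓡 n) ∞ M] (D : ConnOp n M) (U : Set M) : Prop where
  isCov : IsCovariantDerivativeOn (EuclideanSpace ℝ (Fin n)) D U
  smooth : ContMDiffCovariantDerivativeOn (EuclideanSpace ℝ (Fin n)) ∞ D U

/-- `D_Y Z - D_Z Y = [Y, Z]` on `U`. -/
def IsTorsionFreeOn [IsManifold (𝓡 n) ∞ M] (D : ConnOp n M) (U : Set M) : Prop :=
  ∀ x ∈ U, ∀ Y Z : VField n M, DiffVAt Y x → DiffVAt Z x →
    D Z x (Y x) - D Y x (Z x) = mlieBracket (𝓡 n) Y Z x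

/-- `B = (D_z A)(x)` for the connection induced by `D` on `End TM`:
`D_z (A Y) = (D_z A) Y + A (D_z Y)`. -/
def IsEndDeriv [IsManifold (𝓡 n) ∞ M] (D : ConnOp n M) (A : EndField n M) (x : M) (z : TangentSpace (𝓡 n) x)
    (B : TangentSpace (𝓡 n) x →L[ℝ] TangentSpace (𝓡 n) x) : Prop :=
  ∀ Y : VField n M, DiffVAt Y x → D (fun y ↦ A y (Y y)) x z = B (Y x) + A x (D Y x z)

/-- `D A = 0` on `U`. -/
def IsParallelEndOn [IsManifold (𝓡 n) ∞ M] (D : ConnOp n M) (A : EndField n M) (U : Set M) : Prop :=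
  ∀ x ∈ U, ∀ z, IsEndDeriv D A x z 0

/-- `R(Y, Z) W = D_Y D_Z W - D_Z D_Y W - D_{[Y, Z]} W`. -/
def curvature (D : ConnOp n M) (Y Z W : VField n M) : VField n M := fun x ↦
  D (fun y ↦ D W y (Z y)) x (Y x) - D (fun y ↦ D W y (Y y)) x (Z x)
    - D W x (mlieBracket (𝓡 n) Y Z x)

/-! ### Quaternionic structures -/

/-- `I² = J² = -1`, `IJ = K = -JI`. -/
def IsQuaternionicTriple {x : M}
    (I J K : TangentSpace (𝓡 n) x →L[ℝ] TangentSpace (𝓡 n) x) : Prop :=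
  (∀ v, I (I v) = -v) ∧ (∀ v, J (J v) = -v) ∧ (∀ v, I (J v) = K v) ∧ (∀ v, J (I v) = -K v)

/-- `Q ⊂ End TM` is an almost quaternionic structure: near each point it is spanned by a smooth
quaternionic triple. -/
def IsAlmostQuaternionic [IsManifold (𝓡 n) ∞ M]
    (Q : ∀ x : M, Submodule ℝ (TangentSpace (𝓡 n) x →L[ℝ] TangentSpace (𝓡 n) x)) : Prop :=
  ∀ x₀ : M, ∃ U : Set M, IsOpen U ∧ x₀ ∈ U ∧ ∃ I J K : EndField n M,
    SmoothEndOn I U ∧ SmoothEndOn J U ∧ SmoothEndOn K U ∧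
      ∀ x ∈ U, IsQuaternionicTriple (I x) (J x) (K x) ∧
        Q x = Submodule.span ℝ {I x, J x, K x}

/-- `D` preserves the subbundle `Q` over `U`: covariant derivatives of smooth local sections of `Q`
are in `Q`. For a torsion-free `D` this says that `Q` is the quaternionic structure of `D`. -/
def PreservesOn [IsManifold (𝓡 n) ∞ M] (D : ConnOp n M)
    (Q : ∀ x : M, Submodule ℝ (TangentSpace (𝓡 n) x →L[ℝ] TangentSpace (𝓡 n) x))
    (U : Set M) : Prop :=
  ∀ x ∈ U, ∀ A : EndField n M, (∃ N ∈ 𝓝 x, SmoothEndOn A N ∧ ∀ y ∈ N, A y ∈ Q y) →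
    ∀ z, ∃ B ∈ Q x, IsEndDeriv D A x z B

/-- The Nijenhuis tensor of `I` vanishes on `U`. -/
def IsIntegrableOn [IsManifold (𝓡 n) ∞ M] (I : EndField n M) (U : Set M) : Prop :=
  ∀ Y Z : VField n M, SmoothVOn Y U → SmoothVOn Z U → ∀ x ∈ U,
    mlieBracket (𝓡 n) (fun y ↦ I y (Y y)) (fun y ↦ I y (Z y)) x
      - I x (mlieBracket (𝓡 n) (fun y ↦ I y (Y y)) Z x)
      - I x (mlieBracket (𝓡 n) Y (fun y ↦ I y (Z y)) x)
      - mlieBracket (𝓡 n) Y Z x = 0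

/-! ### Parallel transport and holonomy -/

/-- The vector field `V` along `γ : [0,1] → M` is parallel for `D`. At the time `t`, in the local
trivialization of `TM` around `γ t`, the covariant derivative of `V` along `γ` is the derivative
of the components of `V` plus `D_{γ'(t)}` of the local field with the constant components of
`V t`. -/
def IsParallelAlong [IsManifold (𝓡 n) ∞ M] (D : ConnOp n M) (γ : ℝ → M)
    (V : ∀ t : ℝ, TangentSpace (𝓡 n) (γ t)) : Prop :=
  ∀ t ∈ Icc (0 : ℝ) 1, ∃ w : EuclideanSpace ℝ (Fin n),
    HasDerivWithinAt
      (fun s ↦ (trivializationAt (EuclideanSpace ℝ (Fin n))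
        (TangentSpace (𝓡 n) : M → Type _) (γ t) ⟨γ s, V s⟩).2) w (Icc 0 1) t ∧
    (trivializationAt (EuclideanSpace ℝ (Fin n))
        (TangentSpace (𝓡 n) : M → Type _) (γ t)).symm (γ t) w
      + D (FiberBundle.extend (EuclideanSpace ℝ (Fin n)) (V t)) (γ t)
          (mfderivWithin 𝓘(ℝ, ℝ) (𝓡 n) γ (Icc 0 1) t (1 : ℝ)) = 0

/-- `P` is the `D`-parallel transport from `x` to `y` along some piecewise smooth path in `U`. -/
inductive IsTransport [IsManifold (𝓡 n) ∞ M] (D : ConnOp n M) (U : Set M) (x : M) :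
    ∀ y : M, (TangentSpace (𝓡 n) x →L[ℝ] TangentSpace (𝓡 n) y) → Prop
  | refl : x ∈ U → IsTransport D U x x (ContinuousLinearMap.id ℝ _)
  | step (γ : ℝ → M) (hγ : ContMDiffOn 𝓘(ℝ, ℝ) (𝓡 n) ∞ γ (Icc 0 1))
      (hU : ∀ t ∈ Icc (0 : ℝ) 1, γ t ∈ U)
      (R : TangentSpace (𝓡 n) x →L[ℝ] TangentSpace (𝓡 n) (γ 0))
      (hR : IsTransport D U x (γ 0) R)
      (P : TangentSpace (𝓡 n) (γ 0) →L[ℝ] TangentSpace (𝓡 n) (γ 1))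
      (hP : ∀ v, ∃ V : ∀ t : ℝ, TangentSpace (𝓡 n) (γ t),
        IsParallelAlong D γ V ∧ V 0 = v ∧ V 1 = P v) :
      IsTransport D U x (γ 1) (P.comp R)

/-- The holonomy group at `x` of the connection `D` on `U`. -/
def holonomy [IsManifold (𝓡 n) ∞ M] (D : ConnOp n M) (U : Set M) (x : M) :
    Set (TangentSpace (𝓡 n) x →L[ℝ] TangentSpace (𝓡 n) x) :=
  {P | IsTransport D U x x P}

end General

/-! ### The group `U*(2m)` -/

/-- The antilinear map `(z, w) ↦ (w̄, -z̄)` of `ℂ^{2m}`. -/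
def jMap (m : ℕ) (v : Fin m ⊕ Fin m → ℂ) : Fin m ⊕ Fin m → ℂ :=
  Sum.elim (fun i ↦ star (v (Sum.inr i))) (fun i ↦ -star (v (Sum.inl i)))

/-- `SU*(2m)`: determinant one and commuting with `jMap`. -/
def SUStar (m : ℕ) : Set (Matrix (Fin m ⊕ Fin m) (Fin m ⊕ Fin m) ℂ) :=
  {A | A.det = 1 ∧ ∀ v, A *ᵥ jMap m v = jMap m (A *ᵥ v)}

/-- `U*(2m) = SU*(2m) · U(1)`. -/
def UStar (m : ℕ) : Set (Matrix (Fin m ⊕ Fin m) (Fin m ⊕ Fin m) ℂ) :=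
  {g | ∃ θ : ℝ, ∃ A ∈ SUStar m, g = Complex.exp (θ * Complex.I) • A}

/-- The holonomy group at `x` of the connection `D` on `U` lies in `U*(2m)`, for an identification
`T_xM ≅ ℂ^{2m}` under which `I x` is multiplication by `i` and `Q x` is spanned by `i`, the
antilinear map `j` and `ij`. -/
def HolonomyInUStar {m : ℕ} {M : Type*} [TopologicalSpace M]
    [ChartedSpace (EuclideanSpace ℝ (Fin (4 * m))) M] [IsManifold (𝓡 (4 * m)) ∞ M]
    (D : ConnOp (4 * m) M) (U : Set M)
    (Q : ∀ x : M, Submodule ℝ (TangentSpace (𝓡 (4 * m)) x →L[ℝ] TangentSpace (𝓡 (4 * m)) x))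
    (I : EndField (4 * m) M) (x : M) : Prop :=
  ∃ φ : TangentSpace (𝓡 (4 * m)) x ≃ₗ[ℝ] (Fin m ⊕ Fin m → ℂ),
    (∀ v, φ (I x v) = Complex.I • φ v) ∧
    (∀ B : TangentSpace (𝓡 (4 * m)) x →L[ℝ] TangentSpace (𝓡 (4 * m)) x,
      B ∈ Q x ↔ ∃ a b c : ℝ, ∀ v, φ (B v) =
        a • (Complex.I • φ v) + b • jMap m (φ v) + c • (Complex.I • jMap m (φ v))) ∧
    ∀ P ∈ holonomy D U x, ∃ g ∈ UStar m, ∀ v, φ (P v) = g *ᵥ φ v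

/-! ### Quaternionic Kähler manifolds, Killing fields, moment sections -/

section Riemannian

variable {n : ℕ} {M : Type*} [TopologicalSpace M] [ChartedSpace (EuclideanSpace ℝ (Fin n)) M]
  [IsManifold (𝓡 n) ∞ M] [RiemannianBundle (fun x : M ↦ TangentSpace (𝓡 n) x)]

/-- `D` is the Levi-Civita connection. -/
structure IsLeviCivita (D : ConnOp n M) : Prop where
  conn : IsAffineConnectionOn D univ
  torsionFree : IsTorsionFreeOn D univ
  metric : ∀ (x : M) (Y Z : VField n M), DiffVAt Y x → DiffVAt Z x → ∀ v : TangentSpace (𝓡 n) x,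
    mvfderiv (𝓡 n) (fun y ↦ inner ℝ (Y y) (Z y)) x v =
      (inner ℝ (D Y x v) (Z x) + inner ℝ (Y x) (D Z x v) : ℝ)

/-- `Q` makes the Riemannian manifold with Levi-Civita connection `D` quaternionic Kähler, i.e.
reduces the holonomy to `Sp(m)·Sp(1)`: it is an almost quaternionic structure consisting of
skew-adjoint endomorphisms which is preserved by `D`. -/
structure IsQuaternionicKahler (D : ConnOp n M)
    (Q : ∀ x : M, Submodule ℝ (TangentSpace (𝓡 n) x →L[ℝ] TangentSpace (𝓡 n) x)) : Prop where
  almostQuaternionic : IsAlmostQuaternionic Q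
  skew : ∀ x, ∀ A ∈ Q x, ∀ v w, (inner ℝ (A v) w : ℝ) = -inner ℝ v (A w)
  parallel : PreservesOn D Q univ

/-- `X` is a smooth vector field with `L_X g = 0`. -/
structure IsKilling (X : VField n M) : Prop where
  smooth : SmoothVOn X univ
  killing : ∀ (x : M) (Y Z : VField n M), DiffVAt Y x → DiffVAt Z x →
    mvfderiv (𝓡 n) (fun y ↦ inner ℝ (Y y) (Z y)) x (X x) =
      (inner ℝ (mlieBracket (𝓡 n) X Y x) (Z x) + inner ℝ (Y x) (mlieBracket (𝓡 n) X Z x) : ℝ)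

/-- `μ` is a moment section for `X`: a smooth section of `Q` with `D μ = ∑ i_X ω_i ⊗ ω_i`, where
`ω_i = g(I_i ·, ·)` for a quaternionic triple `I_1, I_2, I_3` in `Q`. The 2-forms `ω_i` are
identified with the endomorphisms `I_i`, and the right-hand side does not depend on the triple. -/
structure IsMomentSection (D : ConnOp n M)
    (Q : ∀ x : M, Submodule ℝ (TangentSpace (𝓡 n) x →L[ℝ] TangentSpace (𝓡 n) x))
    (X : VField n M) (μ : EndField n M) : Prop where
  smooth : SmoothEndOn μ univ
  mem : ∀ x, μ x ∈ Q x
  deriv_eq : ∀ x, ∀ I ∈ Q x, ∀ J ∈ Q x, ∀ K ∈ Q x, IsQuaternionicTriple I J K → ∀ z,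
    IsEndDeriv D μ x z ((inner ℝ (I (X x)) z : ℝ) • I + (inner ℝ (J (X x)) z : ℝ) • J
      + (inner ℝ (K (X x)) z : ℝ) • K)

/-- The Levi-Civita connection `D` of a Riemannian 4-manifold is Einstein, with Einstein constant
`c`, and its Weyl tensor `W(Y,Z)V = R(Y,Z)V - (c/3)(g(Z,V)Y - g(Y,V)Z)` vanishes on the bundle `Q`
of self-dual 2-forms, i.e. is anti-self-dual. -/
def IsASDEinstein (D : ConnOp n M)
    (Q : ∀ x : M, Submodule ℝ (TangentSpace (𝓡 n) x →L[ℝ] TangentSpace (𝓡 n) x)) : Prop :=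
  ∃ c : ℝ, ∀ (x : M) (e : Fin n → VField n M), (∀ i, SmoothVOn (e i) univ) →
    Orthonormal ℝ (fun i ↦ e i x) →
    (∀ Y Z : VField n M, SmoothVOn Y univ → SmoothVOn Z univ →
      ∑ i, (inner ℝ (curvature D (e i) Y Z x) (e i x) : ℝ) = c * inner ℝ (Y x) (Z x)) ∧
    (∀ (A : EndField n M) (V : VField n M), SmoothEndOn A univ → (∀ y, A y ∈ Q y) →
      SmoothVOn V univ →
      ∑ i, (curvature D (e i) (fun y ↦ A y (e i y)) V x
        - (c / 3) • ((inner ℝ (A x (e i x)) (V x) : ℝ) • e i x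
            - (inner ℝ (e i x) (V x) : ℝ) • A x (e i x))) = 0)

/-- On `U`, the connection `D` is compatible with the conformal metric `f⁻² g`, and
the trace with respect to `g` (equivalently, to `f⁻² g`) of its Ricci tensor vanishes. For a
torsion-free `D` this says that `D` is the Levi-Civita connection of `f⁻² g` and that this metric
has zero scalar curvature. -/
def IsScalarFlatFor (D : ConnOp n M) (f : M → ℝ) (U : Set M) : Prop :=
  (∀ x ∈ U, ∀ Y Z : VField n M, DiffVAt Y x → DiffVAt Z x → ∀ v : TangentSpace (𝓡 n) x,
    mvfderiv (𝓡 n) (fun y ↦ (f y ^ 2)⁻¹ * (inner ℝ (Y y) (Z y) : ℝ)) x v =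
      (f x ^ 2)⁻¹ * (inner ℝ (D Y x v) (Z x) + inner ℝ (Y x) (D Z x v) : ℝ)) ∧
  ∀ x ∈ U, ∀ e : Fin n → VField n M, (∀ i, SmoothVOn (e i) U) →
    Orthonormal ℝ (fun i ↦ e i x) →
    ∑ i, ∑ j, (inner ℝ (curvature D (e j) (e i) (e i) x) (e j x) : ℝ) = 0

end Riemannian

/-! ### Objects determined by the moment section -/

section Moment

variable {n : ℕ} {M : Type*} [TopologicalSpace M] [ChartedSpace (EuclideanSpace ℝ (Fin n)) M]

/-- `M₀`, the complement of the zero set of `μ`. -/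
def nonzeroSet (μ : EndField n M) : Set M := {x | μ x ≠ 0}

/-- The function `μ₁ = |μ| = (μ₁² + μ₂² + μ₃²)^{1/2}`, characterized by `μ ∘ μ = -μ₁² id`. -/
def momentNorm (μ : EndField n M) (x : M) : ℝ :=
  √(-(LinearMap.trace ℝ (TangentSpace (𝓡 n) x) ((μ x).comp (μ x)).toLinearMap) / n)

/-- The almost complex structure `I = μ / μ₁` determined by `μ` on `M₀`. -/
def momentStructure (μ : EndField n M) : EndField n M := fun x ↦ (momentNorm μ x)⁻¹ • μ x

/-- The 1-form `α = -½ d log μ₁`. -/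
def momentForm (μ : EndField n M) (x : M) (v : TangentSpace (𝓡 n) x) : ℝ :=
  -(1 / 2) * mvfderiv (𝓡 n) (fun y ↦ Real.log (momentNorm μ y)) x v

/-- `∇_Z Y + α(Z)Y + α(Y)Z - ∑_i (α(I_i Y) I_i Z + α(I_i Z) I_i Y)`, where `DY = ∇_Z Y`. -/
def modified {x : M} (α : TangentSpace (𝓡 n) x → ℝ)
    (I J K : TangentSpace (𝓡 n) x →L[ℝ] TangentSpace (𝓡 n) x)
    (DY Y Z : TangentSpace (𝓡 n) x) : TangentSpace (𝓡 n) x :=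
  DY + α Z • Y + α Y • Z - α (I Y) • I Z - α (I Z) • I Y
    - α (J Y) • J Z - α (J Z) • J Y - α (K Y) • K Z - α (K Z) • K Y

end Moment

end QK

end

set_option linter.unusedSimpArgs false
set_option linter.unusedSectionVars false

noncomputable section

/-! Everything rests on one tensor. For a 1-form α let S(Y,Z) be α(Z)Y + α(Y)Z − Σ (α(I_iY) I_iZ +
α(I_iZ) I_iY), which is `oneForm`. It is symmetric, depends only on α and Q (`oneForm_invariant`),
and for fixed Z the operator Y ↦ S(Y,Z) normalizes Q (`oneForm_comb`). So ∇ + S is torsion-free and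
preserves Q for every α. Adding S changes the derivative of I along Z by 2α(JZ)K − 2α(KZ)J.

The moment equation gives d|μ|² = 2g(μX,·) and, in a triple I, J, K with I = I_μ, ∇_Z I =
|μ|⁻¹(g(JX,Z)J + g(KX,Z)K); the component of ∇μ along I only changes |μ|. For α = −½ d log|μ| the
two contributions cancel (`isParallelEndOn_modConn`). Integrability follows, since the connection is
torsion-free.

Uniqueness is algebra: the difference of two such connections is a symmetric tensor whose operators
commute with I and normalize Q, and such a tensor is zero (`eq_zero_of_symm`).

For the holonomy, parallel transport commutes with I_μ and normalizes Q. The trace of S(·,Z) is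
(n+4)α(Z), which is exact, so transport also preserves the volume form up to a power of |μ|; around
a loop its determinant squares to 1. Each of these facts is proved by showing that a real function
of time, built from Gram matrices of a parallel frame, has derivative zero. A map with these three
properties becomes, after multiplication by a phase, complex linear and commuting with j. Its
determinant is then nonnegative (`exists_det_eq_of_commute`), hence 1.

In dimension four S is the difference tensor of the conformal change to |μ|⁻²g. The conformal
formula for the scalar curvature involves the divergence of −grad log|μ|, hence the trace of μ∘∇X.
Contracting the curvature of μ with J ∈ Q evaluates this trace through the Einstein constant
(`trace_moment_nabla`), and all terms cancel. -/

namespace QK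

/-! ### Quaternionic triples on a Euclidean vector space -/

section Algebra

variable {V : Type*} [NormedAddCommGroup V] [InnerProductSpace ℝ V]

/-- `I² = J² = -1`, `IJ = K = -JI`. -/
def QTriple (I J K : V →L[ℝ] V) : Prop :=
  (∀ v, I (I v) = -v) ∧ (∀ v, J (J v) = -v) ∧ (∀ v, I (J v) = K v) ∧ (∀ v, J (I v) = -K v)

namespace QTriple

variable {I J K : V →L[ℝ] V} (h : QTriple I J K)
include h

lemma I_I (v : V) : I (I v) = -v := h.1 v
lemma J_J (v : V) : J (J v) = -v := h.2.1 v
lemma I_J (v : V) : I (J v) = K v := h.2.2.1 v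
lemma J_I (v : V) : J (I v) = -K v := h.2.2.2 v
lemma I_K (v : V) : I (K v) = -J v := by rw [← h.I_J, h.I_I]
lemma K_I (v : V) : K (I v) = J v := by rw [← h.I_J, h.J_I, map_neg, h.I_K, neg_neg]
lemma J_K (v : V) : J (K v) = I v := by
  rw [← h.I_J, h.J_I, ← h.I_J, h.J_J, map_neg, neg_neg]
lemma K_J (v : V) : K (J v) = -I v := by rw [← h.I_J, h.J_J, map_neg]
lemma K_K (v : V) : K (K v) = -v := by rw [← h.I_J (K v), h.J_K, h.I_I]

/-- The multiplication table of a quaternionic triple. -/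
lemma table : (∀ v, I (I v) = -v) ∧ (∀ v, J (J v) = -v) ∧ (∀ v, K (K v) = -v) ∧
    (∀ v, I (J v) = K v) ∧ (∀ v, J (I v) = -K v) ∧ (∀ v, I (K v) = -J v) ∧
    (∀ v, K (I v) = J v) ∧ (∀ v, J (K v) = I v) ∧ (∀ v, K (J v) = -I v) :=
  ⟨h.I_I, h.J_J, h.K_K, h.I_J, h.J_I, h.I_K, h.K_I, h.J_K, h.K_J⟩

/-- Multiplying the relation by the conjugate quaternion d − aI − bJ − cK leaves (d² + a² + b² +
c²)u = 0. -/
lemma coeff_eq_zero {u : V} (hu : u ≠ 0) {d a b c : ℝ}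
    (he : d • u + a • I u + b • J u + c • K u = 0) : d = 0 ∧ a = 0 ∧ b = 0 ∧ c = 0 := by
  obtain ⟨h1, h2, h3, h4, h5, h6, h7, h8, h9⟩ := h.table
  have key : (d ^ 2 + a ^ 2 + b ^ 2 + c ^ 2) • u = 0 := by
    have e0 := congrArg (fun w ↦ d • w) he
    have e1 := congrArg (fun w ↦ a • I w) he
    have e2 := congrArg (fun w ↦ b • J w) he
    have e3 := congrArg (fun w ↦ c • K w) he
    simp only [map_add, map_smul, h1, h2, h3, h4, h5, h6, h7, h8, h9, map_zero, smul_zero]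
      at e0 e1 e2 e3
    linear_combination (norm := module) e0 - e1 - e2 - e3
  have := (smul_eq_zero.1 key).resolve_right hu
  refine ⟨?_, ?_, ?_, ?_⟩ <;> nlinarith [sq_nonneg d, sq_nonneg a, sq_nonneg b, sq_nonneg c]

lemma coeff_eq_zero' {u : V} (hu : u ≠ 0) {a b c : ℝ}
    (he : a • I u + b • J u + c • K u = 0) : a = 0 ∧ b = 0 ∧ c = 0 :=
  (h.coeff_eq_zero hu (d := 0) (by simpa using he)).2

omit h in
lemma mem_span_iff {B : V →L[ℝ] V} :
    B ∈ Submodule.span ℝ {I, J, K} ↔ ∃ a b c : ℝ, B = a • I + b • J + c • K := by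
  rw [Submodule.mem_span_triple]
  exact ⟨fun ⟨a, b, c, e⟩ ↦ ⟨a, b, c, e.symm⟩, fun ⟨a, b, c, e⟩ ↦ ⟨a, b, c, e.symm⟩⟩

lemma comb_comb (a b c : ℝ) (v : V) :
    (a • I + b • J + c • K) ((a • I + b • J + c • K) v) = -((a ^ 2 + b ^ 2 + c ^ 2) • v) := by
  obtain ⟨h1, h2, h3, h4, h5, h6, h7, h8, h9⟩ := h.table
  simp only [_root_.add_apply, _root_.smul_apply, map_add, map_smul,
    h1, h2, h3, h4, h5, h6, h7, h8, h9]
  module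

/-- Two quaternionic triples with the same span differ by an orthogonal matrix. -/
lemma exists_orthogonal [Nontrivial V] {I' J' K' : V →L[ℝ] V} (h' : QTriple I' J' K')
    (hI : I' ∈ Submodule.span ℝ {I, J, K}) (hJ : J' ∈ Submodule.span ℝ {I, J, K})
    (hK : K' ∈ Submodule.span ℝ {I, J, K}) :
    ∃ a : Matrix (Fin 3) (Fin 3) ℝ, aᵀ * a = 1 ∧
      I' = a 0 0 • I + a 0 1 • J + a 0 2 • K ∧ J' = a 1 0 • I + a 1 1 • J + a 1 2 • K ∧
      K' = a 2 0 • I + a 2 1 • J + a 2 2 • K := by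
  obtain ⟨a1, a2, a3, rfl⟩ := mem_span_iff.1 hI
  obtain ⟨b1, b2, b3, rfl⟩ := mem_span_iff.1 hJ
  obtain ⟨c1, c2, c3, rfl⟩ := mem_span_iff.1 hK
  refine ⟨!![a1, a2, a3; b1, b2, b3; c1, c2, c3], ?_, by simp, by simp, by simp⟩
  obtain ⟨u, hu⟩ := exists_ne (0 : V)
  obtain ⟨h1, h2, h3, h4, h5, h6, h7, h8, h9⟩ := h.table
  obtain ⟨t1, t2, t3, t4, t5, t6, t7, t8, t9⟩ := h'.table
  have sq : ∀ {x : ℝ}, x • u = 0 → x = 0 := fun e ↦ (smul_eq_zero.1 e).resolve_right hu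
  -- Squares and anticommutators of the primed triple are −1 times the squared lengths, respectively
  -- −2 times the inner products, of the coefficient rows. Hence the rows are orthonormal.
  have r11 := t1 u
  have r22 := t2 u
  have r33 := t3 u
  have r12 := congrArg₂ (· + ·) (t4 u) (t5 u)
  have r13 := congrArg₂ (· + ·) (t6 u) (t7 u)
  have r23 := congrArg₂ (· + ·) (t8 u) (t9 u)
  simp only [_root_.add_apply, _root_.smul_apply, map_add, map_smul,
    h1, h2, h3, h4, h5, h6, h7, h8, h9] at r11 r22 r33 r12 r13 r23
  have q11 : a1 ^ 2 + a2 ^ 2 + a3 ^ 2 - 1 = 0 := sq (by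
    linear_combination (norm := module) (-1 : ℝ) • r11)
  have q22 : b1 ^ 2 + b2 ^ 2 + b3 ^ 2 - 1 = 0 := sq (by
    linear_combination (norm := module) (-1 : ℝ) • r22)
  have q33 : c1 ^ 2 + c2 ^ 2 + c3 ^ 2 - 1 = 0 := sq (by
    linear_combination (norm := module) (-1 : ℝ) • r33)
  have q12 : a1 * b1 + a2 * b2 + a3 * b3 = 0 := sq (by
    linear_combination (norm := module) (-1 / 2 : ℝ) • r12)
  have q13 : a1 * c1 + a2 * c2 + a3 * c3 = 0 := sq (by
    linear_combination (norm := module) (-1 / 2 : ℝ) • r13)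
  have q23 : b1 * c1 + b2 * c2 + b3 * c3 = 0 := sq (by
    linear_combination (norm := module) (-1 / 2 : ℝ) • r23)
  -- Orthonormal rows say a aᵀ = 1; for a square matrix this is equivalent to aᵀ a = 1.
  rw [mul_eq_one_comm]
  ext i j
  fin_cases i <;> fin_cases j <;>
    simp [Matrix.mul_apply, Fin.sum_univ_three] <;> linarith

/-- `∑ I_i ⊗ I_i` does not depend on the quaternionic triple. -/
lemma sum_invariant [Nontrivial V] {I' J' K' : V →L[ℝ] V} (h' : QTriple I' J' K')
    (hI : I' ∈ Submodule.span ℝ {I, J, K}) (hJ : J' ∈ Submodule.span ℝ {I, J, K})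
    (hK : K' ∈ Submodule.span ℝ {I, J, K}) {W : Type*} [AddCommGroup W] [Module ℝ W]
    (L : (V →L[ℝ] V) →ₗ[ℝ] ℝ) (R : (V →L[ℝ] V) →ₗ[ℝ] W) :
    L I' • R I' + L J' • R J' + L K' • R K' = L I • R I + L J • R J + L K • R K := by
  obtain ⟨a, ha, rfl, rfl, rfl⟩ := h.exists_orthogonal h' hI hJ hK
  have q : ∀ i j, (aᵀ * a) i j = (1 : Matrix (Fin 3) (Fin 3) ℝ) i j := by simp [ha]
  simp only [Matrix.mul_apply, Fin.sum_univ_three, Matrix.transpose_apply] at q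
  have q00 := q 0 0
  have q11 := q 1 1
  have q22 := q 2 2
  have q01 := q 0 1
  have q02 := q 0 2
  have q12 := q 1 2
  simp at q00 q11 q22 q01 q02 q12
  simp only [map_add, map_smul, smul_eq_mul]
  linear_combination (norm := module) q00 • (L I • R I) + q11 • (L J • R J) + q22 • (L K • R K)
    + q01 • (L I • R J + L J • R I) + q02 • (L I • R K + L K • R I)
    + q12 • (L J • R K + L K • R J)

/-- The orthogonal change of triple is inverted by its transpose, so the old triple is a combination
of the new one. This makes any quaternionic triple of elements of Q a basis of Q. -/
lemma span_eq [Nontrivial V] {I' J' K' : V →L[ℝ] V} (h' : QTriple I' J' K')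
    (hI : I' ∈ Submodule.span ℝ {I, J, K}) (hJ : J' ∈ Submodule.span ℝ {I, J, K})
    (hK : K' ∈ Submodule.span ℝ {I, J, K}) :
    Submodule.span ℝ {I, J, K} = Submodule.span ℝ {I', J', K'} := by
  obtain ⟨a, ha, e1, e2, e3⟩ := h.exists_orthogonal h' hI hJ hK
  have q : ∀ i j, (aᵀ * a) i j = (1 : Matrix (Fin 3) (Fin 3) ℝ) i j := by simp [ha]
  simp only [Matrix.mul_apply, Fin.sum_univ_three, Matrix.transpose_apply] at q
  have q00 := q 0 0
  have q11 := q 1 1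
  have q22 := q 2 2
  have q01 := q 0 1
  have q02 := q 0 2
  have q12 := q 1 2
  simp at q00 q11 q22 q01 q02 q12
  apply le_antisymm
  · rw [Submodule.span_le]
    rintro x (rfl | rfl | rfl)
    · refine mem_span_iff.2 ⟨a 0 0, a 1 0, a 2 0, ?_⟩
      rw [e1, e2, e3]
      linear_combination (norm := module) -q00 • x - q01 • J - q02 • K
    · refine mem_span_iff.2 ⟨a 0 1, a 1 1, a 2 1, ?_⟩
      rw [e1, e2, e3]
      linear_combination (norm := module) -q11 • x - q01 • I - q12 • K
    · refine mem_span_iff.2 ⟨a 0 2, a 1 2, a 2 2, ?_⟩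
      rw [e1, e2, e3]
      linear_combination (norm := module) -q22 • x - q02 • I - q12 • J
  · rw [Submodule.span_le]
    rintro x (rfl | rfl | rfl) <;> assumption

/-- A unit element of the span of a quaternionic triple is part of a quaternionic triple. -/
lemma exists_adapted {a b c : ℝ} (hn : a ^ 2 + b ^ 2 + c ^ 2 = 1) :
    ∃ J' ∈ Submodule.span ℝ {I, J, K}, ∃ K' ∈ Submodule.span ℝ {I, J, K},
      QTriple (a • I + b • J + c • K) J' K' := by
  obtain ⟨h1, h2, h3, h4, h5, h6, h7, h8, h9⟩ := h.table
  -- A unit vector orthogonal to (a,b,c): a quarter turn of (a,b) in the first two coordinates,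
  -- unless both vanish. The third element of the triple will have the cross product as its
  -- coefficients.
  obtain ⟨x, y, z, hx, ho⟩ : ∃ x y z : ℝ, x ^ 2 + y ^ 2 + z ^ 2 = 1 ∧
      a * x + b * y + c * z = 0 := by
    rcases eq_or_ne (a ^ 2 + b ^ 2) 0 with h0 | h0
    · refine ⟨1, 0, 0, by norm_num, ?_⟩
      have : a = 0 := by nlinarith [sq_nonneg a, sq_nonneg b]
      simp [this]
    · have hp : 0 < a ^ 2 + b ^ 2 := lt_of_le_of_ne (by positivity) h0.symm
      have hs : √(a ^ 2 + b ^ 2) ≠ 0 := (Real.sqrt_pos.2 hp).ne'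
      refine ⟨-b / √(a ^ 2 + b ^ 2), a / √(a ^ 2 + b ^ 2), 0, ?_, ?_⟩
      · rw [div_pow, div_pow, Real.sq_sqrt hp.le]
        field_simp
        ring
      · field_simp
        ring
  refine ⟨x • I + y • J + z • K, mem_span_iff.2 ⟨_, _, _, rfl⟩,
    (b * z - c * y) • I + (c * x - a * z) • J + (a * y - b * x) • K,
    mem_span_iff.2 ⟨_, _, _, rfl⟩, ?_, ?_, ?_, ?_⟩ <;> intro v
  · rw [h.comb_comb, hn, one_smul]
  · rw [h.comb_comb, hx, one_smul]
  all_goals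
    simp only [_root_.add_apply, _root_.smul_apply, map_add, map_smul,
      h1, h2, h3, h4, h5, h6, h7, h8, h9]
    linear_combination (norm := module) -ho • v

/-- The derivatives of a quaternionic triple which stay in its span leave `∑ I_i ⊗ I_i` fixed. -/
lemma sum_derivative [Nontrivial V] {A B C : V →L[ℝ] V}
    (hA : A ∈ Submodule.span ℝ {I, J, K}) (hB : B ∈ Submodule.span ℝ {I, J, K})
    (hII : ∀ v, A (I v) + I (A v) = 0) (hJJ : ∀ v, B (J v) + J (B v) = 0)
    (hIJ : ∀ v, C v = A (J v) + I (B v)) (hJI : ∀ v, -C v = B (I v) + J (A v))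
    {W : Type*} [AddCommGroup W] [Module ℝ W]
    (L : (V →L[ℝ] V) →ₗ[ℝ] ℝ) (R : (V →L[ℝ] V) →ₗ[ℝ] W) :
    L A • R I + L I • R A + (L B • R J + L J • R B) + (L C • R K + L K • R C) = 0 := by
  obtain ⟨a1, a2, a3, rfl⟩ := mem_span_iff.1 hA
  obtain ⟨b1, b2, b3, rfl⟩ := mem_span_iff.1 hB
  obtain ⟨u, hu⟩ := exists_ne (0 : V)
  obtain ⟨h1, h2, h3, h4, h5, h6, h7, h8, h9⟩ := h.table
  have sq : ∀ {x : ℝ}, x • u = 0 → x = 0 := fun e ↦ (smul_eq_zero.1 e).resolve_right hu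
  simp only [_root_.add_apply, _root_.smul_apply, map_add, map_smul,
    h1, h2, h3, h4, h5, h6, h7, h8, h9] at hII hJJ hIJ hJI
  -- The differentiated relations force the matrix of (A, B, C) in terms of (I, J, K) to be
  -- skew-symmetric, an element of so(3), and it therefore annihilates the symmetric tensor ∑ I_i ⊗
  -- I_i.
  have q1 : a1 = 0 := sq (by linear_combination (norm := module) (-1 / 2 : ℝ) • hII u)
  have q2 : b2 = 0 := sq (by linear_combination (norm := module) (-1 / 2 : ℝ) • hJJ u)
  have q3 : a2 + b1 = 0 := sq (by
    linear_combination (norm := module) (1 / 2 : ℝ) • hIJ u + (1 / 2 : ℝ) • hJI u)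
  obtain rfl : b1 = -a2 := by linarith
  subst q1 q2
  have hC : C = -(a3 • I) - b3 • J := by
    ext v
    simp only [_root_.sub_apply, _root_.neg_apply,
      _root_.smul_apply, hIJ v]
    module
  rw [hC]
  simp only [map_add, map_sub, map_neg, map_smul, smul_eq_mul]
  module

/-- A symmetric bilinear map whose operators commute with `I` and normalize the span of a
quaternionic triple vanishes. -/
lemma eq_zero_of_symm {Δ : V →L[ℝ] V →L[ℝ] V} (hs : ∀ Y Z, Δ Y Z = Δ Z Y)
    (hI : ∀ Y Z, Δ (I Y) Z = I (Δ Y Z))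
    (hJ : ∀ Z, ∃ B ∈ Submodule.span ℝ {I, J, K}, ∀ Y, Δ (J Y) Z = B Y + J (Δ Y Z)) : Δ = 0 := by
  obtain ⟨h1, h2, h3, h4, h5, h6, h7, h8, h9⟩ := h.table
  -- Compatibility with J² = −1 removes the J component of B, and compatibility with IJ = −JI
  -- removes its I component. Only a multiple t(Z) of K remains.
  have key : ∀ Z, ∃ t : ℝ, ∀ Y, Δ (J Y) Z = t • K Y + J (Δ Y Z) := by
    intro Z
    obtain ⟨B, hB, hBY⟩ := hJ Z
    obtain ⟨a, b, c, rfl⟩ := mem_span_iff.1 hB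
    refine ⟨c, fun Y ↦ ?_⟩
    have e1 : b • Y = 0 := by
      have := hBY (J Y)
      rw [hBY Y, h2, map_neg, _root_.neg_apply] at this
      simp only [_root_.add_apply, _root_.smul_apply, map_add, map_smul,
        h1, h2, h3, h4, h5, h6, h7, h8, h9] at this
      linear_combination (norm := module) (1 / 2 : ℝ) • this
    have e2 : a • Y = 0 := by
      have p := hI (J Y) Z
      rw [hBY Y, h4, ← neg_neg (K Y), ← h5, map_neg, _root_.neg_apply, hBY (I Y),
        hI Y] at p
      simp only [_root_.add_apply, _root_.smul_apply, map_add, map_smul,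
        h1, h2, h3, h4, h5, h6, h7, h8, h9] at p
      linear_combination (norm := module) (1 / 2 : ℝ) • p
    have e1' := congrArg J e1
    have e2' := congrArg I e2
    simp only [map_smul, map_zero] at e1' e2'
    rw [hBY Y]
    simp only [_root_.add_apply, _root_.smul_apply, e1', e2']
    simp
  choose t ht using key
  -- Both orders of moving J out of the two arguments of Δ(JY, JZ) must agree, by symmetry.
  have rel : ∀ Y Z, t Y • I Z + t (J Z) • K Y = t Z • I Y + t (J Y) • K Z := by
    intro Y Z
    have e : ∀ Y Z, Δ (J Y) (J Z) = -Δ Y Z + t Y • I Z + t (J Z) • K Y := by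
      intro Y Z
      rw [ht (J Z) Y, hs Y (J Z), ht Y Z, hs Z Y]
      simp only [map_add, map_smul, h8, h2]
      module
    have := hs (J Y) (J Z)
    rw [e Y Z, e Z Y, hs Z Y] at this
    linear_combination (norm := module) this
  -- Taking Z = IY in `rel` gives a linear relation between Y, IY, JY, KY in which Y has coefficient
  -- −t(Y). Linearity of t is not needed.
  have t0 : ∀ Z ≠ 0, t Z = 0 := by
    intro Y hY
    have := rel Y (I Y)
    simp only [map_neg, h1, h2, h3, h4, h5, h6, h7, h8, h9] at this
    have e : (-t Y) • Y + (-t (I Y)) • I Y + (-t (J Y)) • J Y + t (-K Y) • K Y = 0 := by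
      linear_combination (norm := module) this
    linarith [(h.coeff_eq_zero hY e).1]
  have hJ' : ∀ Y Z, Δ (J Y) Z = J (Δ Y Z) := by
    intro Y Z
    rcases eq_or_ne Z 0 with rfl | hZ
    · simp
    · rw [ht Z, t0 Z hZ]
      simp
  ext Y Z
  -- Δ is now I-linear and J-linear in each argument. Extracting I and J from Δ(IY, JZ) in the two
  -- possible orders gives IJ and JI, which differ by a sign.
  have e1 : Δ (I Y) (J Z) = K (Δ Y Z) := by
    rw [hI, hs, hJ', h4, hs]
  have e2 : Δ (I Y) (J Z) = -K (Δ Y Z) := by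
    rw [hs, hJ', hs, hI, h5]
  have e3 : K (Δ Y Z) = 0 := by
    rw [e1] at e2
    linear_combination (norm := module) (1 / 2 : ℝ) • e2
  have := h3 (Δ Y Z)
  rw [e3, map_zero] at this
  simpa using this.symm

end QTriple

end Algebra

/-! ### The tensor attached to a 1-form -/

section OneForm

variable {V : Type*} [NormedAddCommGroup V] [InnerProductSpace ℝ V]

/-- The symmetric bilinear map
`(Y, Z) ↦ α(Z)Y + α(Y)Z - ∑ (α(I_i Y) I_i Z + α(I_i Z) I_i Y)`. -/
def oneForm (α : V →L[ℝ] ℝ) (I J K : V →L[ℝ] V) : V →L[ℝ] V →L[ℝ] V :=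
  ContinuousLinearMap.smulRightL ℝ V V α + α.smulRight (ContinuousLinearMap.id ℝ V)
    - (α.comp I).smulRight I - (ContinuousLinearMap.smulRightL ℝ V V (α.comp I)).comp I
    - (α.comp J).smulRight J - (ContinuousLinearMap.smulRightL ℝ V V (α.comp J)).comp J
    - (α.comp K).smulRight K - (ContinuousLinearMap.smulRightL ℝ V V (α.comp K)).comp K

lemma oneForm_apply (α : V →L[ℝ] ℝ) (I J K : V →L[ℝ] V) (Y Z : V) :
    oneForm α I J K Y Z = α Z • Y + α Y • Z - α (I Y) • I Z - α (I Z) • I Y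
      - α (J Y) • J Z - α (J Z) • J Y - α (K Y) • K Z - α (K Z) • K Y := by
  simp [oneForm]

lemma oneForm_symm (α : V →L[ℝ] ℝ) (I J K : V →L[ℝ] V) (Y Z : V) :
    oneForm α I J K Y Z = oneForm α I J K Z Y := by
  simp only [oneForm_apply]
  module

namespace QTriple

variable {I J K : V →L[ℝ] V} (h : QTriple I J K)
include h

/-- The triple enters only through ∑ I_i ⊗ I_i, contracted with α in one factor. -/
lemma oneForm_invariant [Nontrivial V] {I' J' K' : V →L[ℝ] V} (h' : QTriple I' J' K')
    (hI : I' ∈ Submodule.span ℝ {I, J, K}) (hJ : J' ∈ Submodule.span ℝ {I, J, K})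
    (hK : K' ∈ Submodule.span ℝ {I, J, K}) (α : V →L[ℝ] ℝ) :
    oneForm α I' J' K' = oneForm α I J K := by
  ext Y Z
  have e : ∀ Y Z : V, α (I' Y) • I' Z + α (J' Y) • J' Z + α (K' Y) • K' Z
      = α (I Y) • I Z + α (J Y) • J Z + α (K Y) • K Z := fun Y Z ↦
    h.sum_invariant h' hI hJ hK
      (α.toLinearMap.comp (ContinuousLinearMap.apply ℝ V Y).toLinearMap)
      (ContinuousLinearMap.apply ℝ V Z).toLinearMap
  simp only [oneForm_apply]
  linear_combination (norm := module) -e Y Z - e Z Y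

/-- The operators `Y ↦ oneForm Y Z` normalize the span of `I`, `J`, `K`. -/
lemma oneForm_comb (α : V →L[ℝ] ℝ) (a b c : ℝ) (Y Z : V) :
    oneForm α I J K ((a • I + b • J + c • K) Y) Z =
      ((2 * (b * α (K Z) - c * α (J Z))) • I + (2 * (c * α (I Z) - a * α (K Z))) • J
        + (2 * (a * α (J Z) - b * α (I Z))) • K) Y
      + (a • I + b • J + c • K) (oneForm α I J K Y Z) := by
  obtain ⟨h1, h2, h3, h4, h5, h6, h7, h8, h9⟩ := h.table
  simp only [oneForm_apply, _root_.add_apply, _root_.smul_apply, map_add, map_sub, map_neg,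
    map_smul, h1, h2, h3, h4, h5, h6, h7, h8, h9, smul_eq_mul]
  module

/-- The case (a,b,c) = (1,0,0) of `oneForm_comb`. For I = I_μ the J and K terms are what must cancel
the derivative of I_μ under the Levi-Civita connection. -/
lemma oneForm_I (α : V →L[ℝ] ℝ) (Y Z : V) :
    oneForm α I J K (I Y) Z =
      (2 * α (J Z)) • K Y - (2 * α (K Z)) • J Y + I (oneForm α I J K Y Z) := by
  have := h.oneForm_comb α 1 0 0 Y Z
  simp only [one_smul, zero_smul, add_zero] at this
  rw [this]
  simp only [_root_.add_apply, _root_.smul_apply]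
  module

/-- Each of the three is a product of the other two which changes sign when the factors are
exchanged, while the trace does not. -/
lemma trace_eq_zero : LinearMap.trace ℝ V I = 0 ∧ LinearMap.trace ℝ V J = 0 ∧
    LinearMap.trace ℝ V K = 0 := by
  obtain ⟨h1, h2, h3, h4, h5, h6, h7, h8, h9⟩ := h.table
  have key : ∀ {A B C : V →L[ℝ] V}, (∀ v, A (B v) = C v) → (∀ v, B (A v) = -C v) →
      LinearMap.trace ℝ V C = 0 := by
    intro A B C hab hba
    have e1 : A.toLinearMap * B.toLinearMap = C.toLinearMap := LinearMap.ext hab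
    have e2 : B.toLinearMap * A.toLinearMap = -C.toLinearMap := LinearMap.ext hba
    have := LinearMap.trace_mul_comm ℝ A.toLinearMap B.toLinearMap
    rw [e1, e2, map_neg] at this
    linarith
  exact ⟨key h8 h9, key h7 h6, key h4 h5⟩

/-- The identity contributes dim V, the term α(Y)Z contributes 1, and each −α(I_iY) I_iZ contributes
−α(I_i²Z) = α(Z), that is 3 in all. The terms in the operators I_i are traceless. This constant
determines the power of |μ| in the preserved volume form. -/
lemma trace_oneForm [FiniteDimensional ℝ V] (α : V →L[ℝ] ℝ) (Z : V) :
    LinearMap.trace ℝ V ((oneForm α I J K).flip Z).toLinearMap =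
      (Module.finrank ℝ V + 4) * α Z := by
  obtain ⟨h1, h2, h3, h4, h5, h6, h7, h8, h9⟩ := h.table
  obtain ⟨t1, t2, t3⟩ := h.trace_eq_zero
  have e : ((oneForm α I J K).flip Z).toLinearMap = α Z • LinearMap.id
      + α.toLinearMap.smulRight Z - (α.comp I).toLinearMap.smulRight (I Z)
      - α (I Z) • I.toLinearMap - (α.comp J).toLinearMap.smulRight (J Z)
      - α (J Z) • J.toLinearMap - (α.comp K).toLinearMap.smulRight (K Z)
      - α (K Z) • K.toLinearMap := by
    ext Y
    simp [oneForm_apply]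
  rw [e]
  simp only [map_sub, map_add, map_smul, LinearMap.trace_smulRight, t1, t2, t3,
    LinearMap.trace_id]
  simp [h1, h2, h3]
  ring

/-- In dimension four, `oneForm` is the difference tensor of a conformal change of metric. -/
lemma oneForm_of_finrank_eq_four (sI : ∀ v w, (inner ℝ (I v) w : ℝ) = -inner ℝ v (I w))
    (sJ : ∀ v w, (inner ℝ (J v) w : ℝ) = -inner ℝ v (J w))
    (sK : ∀ v w, (inner ℝ (K v) w : ℝ) = -inner ℝ v (K w))
    (h4 : Module.finrank ℝ V = 4) {α : V →L[ℝ] ℝ} {a : V}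
    (ha : ∀ v, α v = inner ℝ a v) (Y Z : V) :
    oneForm α I J K Y Z = (2 * α Z) • Y + (2 * α Y) • Z - (2 * inner ℝ Z Y : ℝ) • a := by
  obtain ⟨t1, t2, t3, t4, t5, t6, t7, t8, t9⟩ := h.table
  rcases eq_or_ne Z 0 with rfl | hZ
  · simp
  -- In dimension four Z, IZ, JZ, KZ is a basis, and by skewness it is orthogonal with all lengths
  -- equal. The identity is then checked on the coordinates of Y and a.
  have hli : LinearIndependent ℝ ![Z, I Z, J Z, K Z] := by
    rw [Fintype.linearIndependent_iff]
    intro g hg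
    simp only [Fin.sum_univ_four, Matrix.cons_val] at hg
    obtain ⟨p, q, r, s⟩ := h.coeff_eq_zero hZ hg
    intro i
    fin_cases i <;> assumption
  have : FiniteDimensional ℝ V := Module.finite_of_finrank_eq_succ h4
  have hsp := hli.span_eq_top_of_card_eq_finrank (by simp [h4])
  have ex : ∀ w : V, ∃ p q r s : ℝ, w = p • Z + q • I Z + r • J Z + s • K Z := by
    intro w
    have hw : w ∈ Submodule.span ℝ (Set.range ![Z, I Z, J Z, K Z]) := hsp ▸ Submodule.mem_top
    rw [Submodule.mem_span_range_iff_exists_fun] at hw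
    obtain ⟨c, hc⟩ := hw
    refine ⟨c 0, c 1, c 2, c 3, ?_⟩
    rw [← hc]
    simp [Fin.sum_univ_four]
  have skew0 : ∀ {A : V →L[ℝ] V}, (∀ v w, (inner ℝ (A v) w : ℝ) = -inner ℝ v (A w)) →
      ∀ v, (inner ℝ v (A v) : ℝ) = 0 := by
    intro A hA v
    have := hA v v
    rw [real_inner_comm] at this
    linarith
  have nI : (inner ℝ (I Z) (I Z) : ℝ) = inner ℝ Z Z := by rw [sI, t1, inner_neg_right, neg_neg]
  have nJ : (inner ℝ (J Z) (J Z) : ℝ) = inner ℝ Z Z := by rw [sJ, t2, inner_neg_right, neg_neg]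
  have nK : (inner ℝ (K Z) (K Z) : ℝ) = inner ℝ Z Z := by rw [sK, t3, inner_neg_right, neg_neg]
  have oI := skew0 sI Z
  have oJ := skew0 sJ Z
  have oK := skew0 sK Z
  have oI' : (inner ℝ (I Z) Z : ℝ) = 0 := by rw [real_inner_comm, oI]
  have oJ' : (inner ℝ (J Z) Z : ℝ) = 0 := by rw [real_inner_comm, oJ]
  have oK' : (inner ℝ (K Z) Z : ℝ) = 0 := by rw [real_inner_comm, oK]
  have oIJ : (inner ℝ (I Z) (J Z) : ℝ) = 0 := by rw [sI, t4, oK, neg_zero]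
  have oIK : (inner ℝ (I Z) (K Z) : ℝ) = 0 := by rw [sI, t6, inner_neg_right, oJ]; simp
  have oJK : (inner ℝ (J Z) (K Z) : ℝ) = 0 := by rw [sJ, t8, oI, neg_zero]
  have oJI : (inner ℝ (J Z) (I Z) : ℝ) = 0 := by rw [real_inner_comm, oIJ]
  have oKI : (inner ℝ (K Z) (I Z) : ℝ) = 0 := by rw [real_inner_comm, oIK]
  have oKJ : (inner ℝ (K Z) (J Z) : ℝ) = 0 := by rw [real_inner_comm, oJK]
  obtain ⟨y0, y1, y2, y3, rfl⟩ := ex Y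
  obtain ⟨a0, a1, a2, a3, rfl⟩ := ex a
  rw [oneForm_apply]
  simp only [ha, inner_add_left, inner_add_right, inner_smul_left,
    inner_smul_right, inner_neg_right, inner_neg_left, map_add, map_neg, map_smul,
    t1, t2, t3, t4, t5, t6, t7, t8, t9,
    nI, nJ, nK, oI, oJ, oK, oI', oJ', oK', oIJ, oIK, oJK, oJI, oKI, oKJ]
  simp only [conj_trivial]
  module

end QTriple
end OneForm

/-! ### Quaternionic linear algebra -/

section Quaternionic

/-- A complex-linear map commuting with a quaternionic structure has non-negative determinant. -/
lemma exists_det_eq_of_commute {V : Type*} [AddCommGroup V] [Module ℂ V] [FiniteDimensional ℂ V]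
    (j : V →ₛₗ[starRingEnd ℂ] V) (hj : ∀ v, j (j v) = -v) (f : V →ₗ[ℂ] V)
    (hf : ∀ v, f (j v) = j (f v)) : ∃ r : ℝ, 0 ≤ r ∧ LinearMap.det f = r := by
  induction hn : Module.finrank ℂ V using Nat.strong_induction_on generalizing V with
  | _ n ih =>
  subst hn
  rcases subsingleton_or_nontrivial V with hV | hV
  · exact ⟨1, zero_le_one, by simp [LinearMap.det_eq_one_of_subsingleton]⟩
  -- If v is an eigenvector for l, then j v is one for the conjugate of l. Their span W is stable
  -- under f and j, f has determinant |l|² on it, and induction applies to V/W.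
  obtain ⟨l, hl⟩ := Module.End.exists_eigenvalue f
  obtain ⟨v, hv⟩ := hl.exists_hasEigenvector
  have hfv : f v = l • v := hv.apply_eq_smul
  have hv0 : v ≠ 0 := hv.2
  have hfjv : f (j v) = (starRingEnd ℂ l) • j v := by rw [hf, hfv, LinearMap.map_smulₛₗ]
  have hjv : j v ≠ 0 := fun h0 ↦ hv0 (by simpa [h0] using (hj v).symm)
  -- If j v = a v, then −v = j(j v) = |a|² v, which is impossible.
  have hli : LinearIndependent ℂ ![v, j v] := by
    rw [LinearIndependent.pair_iff' hv0]
    intro a ha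
    have h1 := hj v
    rw [← ha, LinearMap.map_smulₛₗ, ← ha, smul_smul] at h1
    have h2 : ((starRingEnd ℂ a) * a + 1) • v = 0 := by rw [add_smul, h1]; simp
    have h3 := (smul_eq_zero.1 h2).resolve_right hv0
    rw [← Complex.normSq_eq_conj_mul_self] at h3
    have h4 : Complex.normSq a + 1 = 0 := by exact_mod_cast h3
    linarith [Complex.normSq_nonneg a]
  set W : Submodule ℂ V := Submodule.span ℂ (Set.range ![v, j v]) with hW
  have hvW : v ∈ W := Submodule.subset_span ⟨0, rfl⟩
  have hjvW : j v ∈ W := Submodule.subset_span ⟨1, rfl⟩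
  have hfW : W ≤ W.comap f := by
    rw [hW, Submodule.span_le]
    rintro _ ⟨i, rfl⟩
    fin_cases i
    · change f v ∈ W
      rw [hfv]
      exact W.smul_mem _ hvW
    · change f (j v) ∈ W
      rw [hfjv]
      exact W.smul_mem _ hjvW
  have hjW : W ≤ W.comap j := by
    rw [hW, Submodule.span_le]
    rintro _ ⟨i, rfl⟩
    fin_cases i
    · exact hjvW
    · change j (j v) ∈ W
      rw [hj]
      exact W.neg_mem hvW
  have hlt : Module.finrank ℂ (V ⧸ W) < Module.finrank ℂ V := by
    have h1 := W.finrank_quotient_add_finrank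
    have h2 : Module.finrank ℂ W = 2 := by
      rw [hW, finrank_span_eq_card hli]
      simp
    omega
  obtain ⟨r, hr, hdet⟩ := ih _ hlt (W.mapQ W j hjW)
    (by
      intro q
      obtain ⟨w, rfl⟩ := W.mkQ_surjective q
      simp [hj])
    (W.mapQ W f hfW)
    (by
      intro q
      obtain ⟨w, rfl⟩ := W.mkQ_surjective q
      simp [hf]) rfl
  have hres : LinearMap.det (f.restrict hfW) = (Complex.normSq l : ℂ) := by
    set b := Module.Basis.span hli
    have hb : LinearMap.toMatrix b b (f.restrict hfW) =
        Matrix.diagonal ![l, starRingEnd ℂ l] := by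
      have hb0 : f.restrict hfW (b 0) = l • b 0 := by
        apply Subtype.ext
        simp [b, Module.Basis.span_apply, hfv]
      have hb1 : f.restrict hfW (b 1) = starRingEnd ℂ l • b 1 := by
        apply Subtype.ext
        simp [b, Module.Basis.span_apply, hfjv]
      ext p q
      rw [LinearMap.toMatrix_apply]
      fin_cases q
      · simp only [Fin.zero_eta, hb0]
        fin_cases p <;> simp
      · simp only [Fin.mk_one, hb1]
        fin_cases p <;> simp
    rw [← LinearMap.det_toMatrix b, hb, Matrix.det_diagonal]
    simp [Fin.prod_univ_two, Complex.mul_conj]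
  refine ⟨Complex.normSq l * r, mul_nonneg (Complex.normSq_nonneg l) hr, ?_⟩
  rw [LinearMap.det_eq_det_mul_det W f hfW, hres, hdet]
  push_cast
  rfl

/-- `jMap` as a conjugate-linear map. -/
def jLin (m : ℕ) : (Fin m ⊕ Fin m → ℂ) →ₛₗ[starRingEnd ℂ] (Fin m ⊕ Fin m → ℂ) where
  toFun := jMap m
  map_add' v w := by
    ext (i | i) <;> simp [jMap, add_comm]
  map_smul' c v := by
    ext (i | i) <;> simp [jMap]

lemma jMap_jMap (m : ℕ) (v : Fin m ⊕ Fin m → ℂ) : jMap m (jMap m v) = -v := by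
  ext (i | i) <;> simp [jMap]

/-- The real-linear isomorphism `ℍ^m ≃ ℂ^{2m}`, `z + u j ↦ (z, -u)`. -/
def quaternionEquiv (m : ℕ) : (Fin m → Quaternion ℝ) ≃ₗ[ℝ] (Fin m ⊕ Fin m → ℂ) where
  -- Left multiplication by j sends z + u j to −ū + z̄ j. The minus sign in the second half turns
  -- this into `jMap`.
  toFun q := Sum.elim (fun k ↦ ⟨(q k).re, (q k).imI⟩) (fun k ↦ -⟨(q k).imJ, (q k).imK⟩)
  map_add' q r := by
    ext (i | i) <;> apply Complex.ext <;> simp [add_comm]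
  map_smul' c q := by
    ext (i | i) <;> apply Complex.ext <;> simp
  invFun v := fun k ↦ ⟨(v (Sum.inl k)).re, (v (Sum.inl k)).im, -(v (Sum.inr k)).re,
    -(v (Sum.inr k)).im⟩
  left_inv q := by
    ext k <;> simp
  right_inv v := by
    ext (i | i) <;> apply Complex.ext <;> simp

lemma quaternionEquiv_inl {m : ℕ} (q : Fin m → Quaternion ℝ) (k : Fin m) :
    quaternionEquiv m q (Sum.inl k) = ⟨(q k).re, (q k).imI⟩ := rfl

lemma quaternionEquiv_inr {m : ℕ} (q : Fin m → Quaternion ℝ) (k : Fin m) :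
    quaternionEquiv m q (Sum.inr k) = -⟨(q k).imJ, (q k).imK⟩ := rfl

variable {V : Type*} [NormedAddCommGroup V] [InnerProductSpace ℝ V]

/-- A vector space of dimension `4m` with a quaternionic triple is `ℂ^{2m}` with `i` and `j`. -/
lemma QTriple.exists_equiv {I J K : V →L[ℝ] V} (h : QTriple I J K) {m : ℕ}
    [FiniteDimensional ℝ V] (hV : Module.finrank ℝ V = 4 * m) :
    ∃ φ : V ≃ₗ[ℝ] (Fin m ⊕ Fin m → ℂ), (∀ v, φ (I v) = Complex.I • φ v) ∧
      (∀ v, φ (J v) = jMap m (φ v)) := by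
  -- The triple makes V a left module over the division ring ℍ, hence free, and 4·rank = 4m gives
  -- the rank. A basis identifies V with ℍ^m.
  let B : QuaternionAlgebra.Basis (Module.End ℝ V) (-1 : ℝ) 0 (-1) :=
    { i := I.toLinearMap
      j := J.toLinearMap
      k := K.toLinearMap
      i_mul_i := by ext v; simp [h.I_I]
      j_mul_j := by ext v; simp [h.J_J]
      i_mul_j := by ext v; simp [h.I_J]
      j_mul_i := by ext v; simp [h.J_I] }
  let ρ : Quaternion ℝ →ₐ[ℝ] Module.End ℝ V := B.liftHom
  let _ : Module (Quaternion ℝ) V := Module.compHom V ρ.toRingHom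
  have hsm : ∀ (q : Quaternion ℝ) (v : V), q • v = ρ q v := fun q v ↦ rfl
  have hρ : ∀ (q : Quaternion ℝ) (v : V),
      q • v = q.re • v + q.imI • I v + q.imJ • J v + q.imK • K v := by
    intro q v
    change B.lift q v = _
    simp [B, QuaternionAlgebra.Basis.lift, Algebra.algebraMap_eq_smul_one]
  have : IsScalarTower ℝ (Quaternion ℝ) V := ⟨fun c q v ↦ by
    rw [hsm, hsm, map_smul]; rfl⟩
  have : Module.Finite (Quaternion ℝ) V := Module.Finite.of_restrictScalars_finite ℝ _ V
  have hm : Module.finrank (Quaternion ℝ) V = m := by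
    have := Module.finrank_mul_finrank ℝ (Quaternion ℝ) V
    rw [hV, Quaternion.finrank_eq_four] at this
    omega
  let b : Module.Basis (Fin m) (Quaternion ℝ) V :=
    (Module.finBasis (Quaternion ℝ) V).reindex (finCongr hm)
  refine ⟨(b.equivFun.restrictScalars ℝ).trans (quaternionEquiv m), ?_, ?_⟩
  · intro v
    obtain ⟨q, q0, q1, q2, q3⟩ : ∃ q : Quaternion ℝ, q.re = 0 ∧ q.imI = 1 ∧ q.imJ = 0 ∧
      q.imK = 0 := ⟨⟨0, 1, 0, 0⟩, rfl, rfl, rfl, rfl⟩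
    have e : b.equivFun (I v) = q • b.equivFun v := by
      rw [← map_smul, hρ, q0, q1, q2, q3]
      simp
    change quaternionEquiv m (b.equivFun (I v)) = Complex.I • quaternionEquiv m (b.equivFun v)
    rw [e]
    ext (i | i) <;> apply Complex.ext <;>
      simp [quaternionEquiv_inl, quaternionEquiv_inr, q0, q1, q2, q3]
  · intro v
    obtain ⟨q, q0, q1, q2, q3⟩ : ∃ q : Quaternion ℝ, q.re = 0 ∧ q.imI = 0 ∧ q.imJ = 1 ∧
      q.imK = 0 := ⟨⟨0, 0, 1, 0⟩, rfl, rfl, rfl, rfl⟩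
    have e : b.equivFun (J v) = q • b.equivFun v := by
      rw [← map_smul, hρ, q0, q1, q2, q3]
      simp
    change quaternionEquiv m (b.equivFun (J v)) = jMap m (quaternionEquiv m (b.equivFun v))
    rw [e]
    ext (i | i) <;> apply Complex.ext <;>
      simp [quaternionEquiv_inl, quaternionEquiv_inr, jMap, q0, q1, q2, q3]

/-- A map commuting with `I`, normalizing the span of a quaternionic triple and preserving volume
is in `U*(2m)`. -/
lemma QTriple.exists_mem_UStar {I J K : V →L[ℝ] V} (h : QTriple I J K) {m : ℕ} [Nontrivial V]
    {φ : V ≃ₗ[ℝ] (Fin m ⊕ Fin m → ℂ)} (hφI : ∀ v, φ (I v) = Complex.I • φ v)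
    (hφJ : ∀ v, φ (J v) = jMap m (φ v)) {P : V →L[ℝ] V} (hPI : ∀ v, P (I v) = I (P v))
    (hPQ : ∃ B ∈ Submodule.span ℝ {I, J, K}, ∀ v, J (P v) = P (B v))
    (hdet : LinearMap.det P.toLinearMap ^ 2 = 1) :
    ∃ g ∈ UStar m, ∀ v, φ (P v) = g *ᵥ φ v := by
  obtain ⟨h1, h2, h3, h4, h5, h6, h7, h8, h9⟩ := h.table
  have : FiniteDimensional ℝ V := LinearEquiv.finiteDimensional φ.symm
  have hinj : ∀ v, P v = 0 → v = 0 := by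
    have hu : IsUnit (LinearMap.det P.toLinearMap) :=
      IsUnit.of_mul_eq_one (LinearMap.det P.toLinearMap) (by rw [← sq, hdet])
    have hk := ((LinearMap.isUnit_iff_ker_eq_bot _).1
      ((LinearMap.isUnit_iff_isUnit_det P.toLinearMap).2 hu))
    intro v hv
    exact (LinearMap.ker_eq_bot'.1 hk) v hv
  obtain ⟨u, hu⟩ := exists_ne (0 : V)
  obtain ⟨B, hB, hJP⟩ := hPQ
  obtain ⟨a, b, c, rfl⟩ := mem_span_iff.1 hB
  have sq0 : ∀ {x : ℝ}, x • u = 0 → x = 0 := fun e ↦ (smul_eq_zero.1 e).resolve_right hu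
  -- P commutes with I and IJ = −JI, so B anticommutes with I and has no component along it.
  -- Likewise J² = −1 gives b² + c² = 1 below.
  obtain rfl : a = 0 := by
    have e1 : P ((a • I + b • J + c • K) (I u)) = -P (I ((a • I + b • J + c • K) u)) := by
      rw [← hJP, hPI, hPI, ← hJP, h5, h4]
    have e2 : P ((a • I + b • J + c • K) (I u) + I ((a • I + b • J + c • K) u)) = 0 := by
      rw [map_add, e1, neg_add_cancel]
    have e3 := hinj _ e2
    simp only [_root_.add_apply, _root_.smul_apply, map_add, map_smul, h1, h2, h3, h4, h5, h6, h7,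
      h8, h9] at e3
    exact sq0 (by linear_combination (norm := module) (-1 / 2 : ℝ) • e3)
  have hbc : b ^ 2 + c ^ 2 = 1 := by
    have e1 := h2 (P u)
    rw [hJP, hJP, h.comb_comb, ← map_neg] at e1
    have e2 := hinj (_ - -u) (by rw [map_sub, e1, sub_self])
    have := sq0 (x := 1 - (b ^ 2 + c ^ 2)) (by linear_combination (norm := module) e2)
    linarith
  -- In complex terms P is a complex-linear f with f∘j = ζ j∘f, where |ζ| = 1.
  set ζ : ℂ := ⟨b, -c⟩ with hζ
  have hζn : ‖ζ‖ = 1 := by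
    rw [← sq_eq_sq₀ (norm_nonneg _) zero_le_one, ← Complex.normSq_eq_norm_sq, Complex.normSq_mk]
    linarith
  let f : (Fin m ⊕ Fin m → ℂ) →ₗ[ℂ] (Fin m ⊕ Fin m → ℂ) :=
    { toFun := fun w ↦ φ (P (φ.symm w))
      map_add' := fun v w ↦ by simp
      map_smul' := fun z w ↦ by
        obtain ⟨v, rfl⟩ := φ.surjective w
        have hz : ∀ v, φ.symm (z • φ v) = z.re • v + z.im • I v := by
          intro v
          rw [LinearEquiv.symm_apply_eq, map_add, map_smul, map_smul, hφI]
          ext i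
          simp only [Pi.smul_apply, Pi.add_apply, Complex.real_smul, smul_eq_mul]
          nth_rewrite 1 [← Complex.re_add_im z]
          ring
        simp only [hz, φ.symm_apply_apply, map_add, map_smul, hPI, hφI, RingHom.id_apply]
        ext i
        simp only [Pi.smul_apply, Pi.add_apply, Complex.real_smul, smul_eq_mul]
        nth_rewrite 3 [← Complex.re_add_im z]
        ring }
  have hf : ∀ v, f (φ v) = φ (P v) := fun v ↦ by simp [f]
  have hfj : ∀ w, f (jMap m w) = ζ • jMap m (f w) := by
    intro w
    obtain ⟨v, rfl⟩ := φ.surjective w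
    have e : P (J v) = b • J (P v) - c • K (P v) := by
      have e1 := hJP v
      have e2 : K (P v) = P (I (((0 : ℝ) • I + b • J + c • K) v)) := by rw [hPI, ← hJP, h4]
      rw [e2, e1, ← P.map_smul, ← P.map_smul, ← P.map_sub]
      congr 1
      simp only [_root_.add_apply, _root_.smul_apply, map_add, map_smul, h1, h2, h3, h4, h5, h6,
        h7, h8, h9]
      have : J v = (b ^ 2 + c ^ 2) • J v := by rw [hbc, one_smul]
      linear_combination (norm := module) this
    rw [← hφJ, hf, hf, e, map_sub, map_smul, map_smul, ← h4, hφI, hφJ]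
    ext i
    simp only [Pi.smul_apply, Pi.sub_apply, Complex.real_smul, smul_eq_mul]
    have : ζ = b - c * Complex.I := by apply Complex.ext <;> simp [hζ]
    rw [this]
    ring
  -- Half the argument of ζ: since j is antilinear, e^{−iθ}f commutes with j exactly when e^{2iθ} =
  -- ζ.
  set θ : ℝ := Complex.arg ζ / 2 with hθ
  have hexp : Complex.exp (θ * Complex.I) ^ 2 = ζ := by
    rw [← Complex.exp_nat_mul]
    have := Complex.norm_mul_exp_arg_mul_I ζ
    rw [hζn, Complex.ofReal_one, one_mul] at this
    rw [← this]
    congr 1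
    rw [hθ]
    push_cast
    ring
  have hconj : starRingEnd ℂ (Complex.exp (-(θ * Complex.I))) = Complex.exp (θ * Complex.I) := by
    rw [← Complex.exp_conj]
    simp
  have hee : Complex.exp (-(θ * Complex.I)) * Complex.exp (θ * Complex.I) = 1 := by
    rw [← Complex.exp_add]
    simp
  have hcomm : ∀ w, (Complex.exp (-(θ * Complex.I)) • f) (jLin m w) =
      jLin m ((Complex.exp (-(θ * Complex.I)) • f) w) := by
    intro w
    rw [LinearMap.smul_apply, LinearMap.smul_apply, LinearMap.map_smulₛₗ, hconj]
    change _ • f (jMap m w) = _ • jMap m (f w)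
    rw [hfj, smul_smul, ← hexp, sq, ← mul_assoc, hee, one_mul]
  -- The real determinant of a complex-linear map is the squared modulus of its complex determinant.
  -- Being real and nonnegative, the complex determinant is then 1.
  have hnorm : ‖LinearMap.det (Complex.exp (-(θ * Complex.I)) • f)‖ = 1 := by
    have e1 : ‖Complex.exp (-(θ * Complex.I))‖ = 1 := by
      rw [Complex.norm_exp]
      simp
    have e2 : LinearMap.det (f.restrictScalars ℝ) = LinearMap.det P.toLinearMap := by
      rw [← LinearMap.det_conj P.toLinearMap φ]
      rfl
    rw [LinearMap.det_restrictScalars, Algebra.norm_complex_apply] at e2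
    rw [← e2, Complex.normSq_eq_norm_sq, ← pow_mul] at hdet
    rw [LinearMap.det_smul, norm_mul, norm_pow, e1, one_pow, one_mul]
    exact (pow_eq_one_iff_of_nonneg (norm_nonneg _) (by norm_num)).1 hdet
  obtain ⟨r, hr, hrd⟩ := exists_det_eq_of_commute (jLin m) (jMap_jMap m) _ hcomm
  have hr1 : r = 1 := by
    rw [hrd, Complex.norm_real, Real.norm_of_nonneg hr] at hnorm
    exact hnorm
  refine ⟨LinearMap.toMatrix' f, ⟨θ, LinearMap.toMatrix' (Complex.exp (-(θ * Complex.I)) • f),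
    ⟨?_, ?_⟩, ?_⟩, ?_⟩
  · rw [LinearMap.det_toMatrix', hrd, hr1]
    simp
  · intro w
    rw [LinearMap.toMatrix'_mulVec, LinearMap.toMatrix'_mulVec]
    exact hcomm w
  · rw [map_smul, smul_smul, mul_comm, hee, one_smul]
  · intro v
    rw [LinearMap.toMatrix'_mulVec, hf]

end Quaternionic

/-! ### Derivatives of determinants -/

section Det

variable {ι : Type*} [Fintype ι] [DecidableEq ι]

lemma det_updateRow_eq_sum (A : Matrix ι ι ℝ) (i : ι) (b : ι → ℝ) :
    (A.updateRow i b).det = ∑ j, b j * A.adjugate j i := by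
  rw [← Matrix.cramer_transpose_apply, Matrix.cramer_eq_adjugate_mulVec, ← Matrix.adjugate_transpose]
  simp [Matrix.mulVec, dotProduct, mul_comm]

/-- Jacobi's formula. -/
lemma hasDerivWithinAt_det {G : ℝ → Matrix ι ι ℝ} {G' : Matrix ι ι ℝ} {s : Set ℝ} {t : ℝ}
    (h : ∀ i j, HasDerivWithinAt (fun u ↦ G u i j) (G' i j) s t) :
    HasDerivWithinAt (fun u ↦ (G u).det) (Matrix.trace (G' * (G t).adjugate)) s t := by
  -- The determinant is multilinear in the rows, so its derivative is the sum of the determinants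
  -- with one row replaced by its derivative.
  let f : ContinuousMultilinearMap ℝ (fun _ : ι ↦ (ι → ℝ)) ℝ :=
    { toMultilinearMap := (Matrix.detRowAlternating (n := ι) (R := ℝ)).toMultilinearMap
      cont := Continuous.matrix_det (A := fun M : ι → ι → ℝ ↦ (Matrix.of M)) (by
        exact continuous_id) }
  have hG : HasDerivWithinAt (fun u ↦ (fun i j ↦ G u i j : ι → ι → ℝ)) (fun i j ↦ G' i j) s t :=
    hasDerivWithinAt_pi.2 fun i ↦ hasDerivWithinAt_pi.2 fun j ↦ h i j
  have := (f.hasFDerivAt (x := fun i j ↦ G t i j)).comp_hasDerivWithinAt t hG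
  refine this.congr_deriv ?_
  rw [ContinuousMultilinearMap.linearDeriv_apply, Matrix.trace]
  refine Finset.sum_congr rfl fun i _ ↦ ?_
  rw [Matrix.diag_apply, Matrix.mul_apply, ← det_updateRow_eq_sum]
  rfl

variable {V : Type*} [NormedAddCommGroup V] [InnerProductSpace ℝ V]

/-- The Gram matrix of a family of vectors. -/
def gramMatrix (v : ι → V) : Matrix ι ι ℝ := Matrix.of fun i j ↦ inner ℝ (v i) (v j)

lemma gramMatrix_eq (b : OrthonormalBasis ι ℝ V) (v : ι → V) :
    gramMatrix v = (Matrix.of fun i c ↦ (inner ℝ (b c) (v i) : ℝ)) *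
      (Matrix.of fun i c ↦ (inner ℝ (b c) (v i) : ℝ))ᵀ := by
  ext i j
  simp only [gramMatrix, Matrix.of_apply, Matrix.mul_apply, Matrix.transpose_apply]
  rw [← b.sum_inner_mul_inner (v i) (v j)]
  exact Finset.sum_congr rfl fun c _ ↦ by rw [real_inner_comm]

lemma det_gramMatrix_orthonormal (b : OrthonormalBasis ι ℝ V) : (gramMatrix b).det = 1 := by
  have : gramMatrix b = 1 := by
    ext i j
    simp [gramMatrix, Matrix.one_apply, b.inner_eq_ite]
  rw [this, Matrix.det_one]

lemma det_gramMatrix_comp (b : OrthonormalBasis ι ℝ V) (P : V →ₗ[ℝ] V) :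
    (gramMatrix (fun i ↦ P (b i))).det = LinearMap.det P ^ 2 := by
  rw [gramMatrix_eq b, Matrix.det_mul, Matrix.det_transpose, ← sq]
  congr 1
  rw [← LinearMap.det_toMatrix b.toBasis P, ← Matrix.det_transpose]
  congr 1
  ext c i
  simp [LinearMap.toMatrix_apply, b.repr_apply_apply]

lemma linearIndependent_of_det_gramMatrix_ne_zero {v : ι → V} (h : (gramMatrix v).det ≠ 0) :
    LinearIndependent ℝ v := by
  rw [Fintype.linearIndependent_iff]
  intro g hg
  have : g ᵥ* gramMatrix v = 0 := by
    ext j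
    have : (inner ℝ (∑ i, g i • v i) (v j) : ℝ) = 0 := by rw [hg, inner_zero_left]
    rw [sum_inner] at this
    simpa [Matrix.vecMul, dotProduct, gramMatrix, inner_smul_left] using this
  exact congrFun (Matrix.eq_zero_of_vecMul_eq_zero h this)

/-- With Jacobi's formula this is Liouville's formula: if v' = Lv, the Gram determinant has
logarithmic derivative 2 tr L. Written with the adjugate it also covers linearly dependent families.
-/
lemma trace_mul_adjugate_gramMatrix [FiniteDimensional ℝ V]
    (hι : Fintype.card ι = Module.finrank ℝ V) (L : V →ₗ[ℝ] V)
    (v : ι → V) :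
    Matrix.trace ((Matrix.of fun i j ↦ (inner ℝ (L (v i)) (v j) + inner ℝ (v i) (L (v j)) : ℝ)) *
      (gramMatrix v).adjugate) = 2 * LinearMap.trace ℝ V L * (gramMatrix v).det := by
  obtain ⟨b⟩ : Nonempty (OrthonormalBasis ι ℝ V) :=
    ⟨(stdOrthonormalBasis ℝ V).reindex (Fintype.equivOfCardEq (by simp [hι]))⟩
  set N : Matrix ι ι ℝ := Matrix.of fun i c ↦ (inner ℝ (b c) (v i) : ℝ) with hN
  set A : Matrix ι ι ℝ := Matrix.of fun c d ↦ (inner ℝ (b c) (L (b d)) : ℝ) with hA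
  have hL : ∀ c i, (inner ℝ (b c) (L (v i)) : ℝ) = ∑ d, A c d * N i d := by
    intro c i
    conv_lhs => rw [← b.sum_repr' (v i), map_sum, inner_sum]
    refine Finset.sum_congr rfl fun d _ ↦ ?_
    rw [map_smul, inner_smul_right, hA, hN, Matrix.of_apply, Matrix.of_apply, mul_comm]
  have hH : (Matrix.of fun i j ↦ (inner ℝ (L (v i)) (v j) + inner ℝ (v i) (L (v j)) : ℝ)) =
      N * Aᵀ * Nᵀ + N * A * Nᵀ := by
    ext i j
    rw [Matrix.of_apply, ← b.sum_inner_mul_inner (L (v i)) (v j),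
      ← b.sum_inner_mul_inner (v i) (L (v j)), Matrix.add_apply, Matrix.mul_assoc N A,
      Matrix.mul_apply, Matrix.mul_apply]
    congr 1
    · refine Finset.sum_congr rfl fun c _ ↦ ?_
      rw [real_inner_comm, hL, Matrix.mul_apply]
      congr 1
      exact Finset.sum_congr rfl fun d _ ↦ mul_comm _ _
    · refine Finset.sum_congr rfl fun c _ ↦ ?_
      rw [real_inner_comm, hL, Matrix.mul_apply]
      rfl
  have key : ∀ C : Matrix ι ι ℝ, Matrix.trace (N * C * Nᵀ * (N * Nᵀ).adjugate) =
      N.det ^ 2 * Matrix.trace C := by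
    intro C
    rw [Matrix.adjugate_mul_distrib, Matrix.mul_assoc (N * C), ← Matrix.mul_assoc Nᵀ,
      Matrix.mul_adjugate, Matrix.smul_mul, Matrix.one_mul, Matrix.mul_smul, Matrix.trace_smul,
      Matrix.trace_mul_comm, ← Matrix.mul_assoc, Matrix.adjugate_mul, Matrix.smul_mul,
      Matrix.one_mul, Matrix.trace_smul, Matrix.det_transpose]
    simp only [smul_eq_mul]
    ring
  have htr : Matrix.trace A = LinearMap.trace ℝ V L := by
    rw [LinearMap.trace_eq_sum_inner L b]
    rfl
  rw [hH, gramMatrix_eq b, Matrix.add_mul, Matrix.trace_add, key, key, Matrix.trace_transpose, htr,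
    Matrix.det_mul, Matrix.det_transpose]
  ring

end Det

/-! ### Smooth fields near a point -/

section Smooth

variable {n : ℕ} {M : Type*} [TopologicalSpace M] [ChartedSpace (EuclideanSpace ℝ (Fin n)) M]
  [IsManifold (𝓡 n) ∞ M]

lemma SmoothVOn.contMDiffAt {Y : VField n M} {U : Set M} (h : SmoothVOn Y U) {x : M}
    (hx : U ∈ 𝓝 x) : ContMDiffAt (𝓡 n) ((𝓡 n).prod 𝓘(ℝ, EuclideanSpace ℝ (Fin n))) ∞
      (fun y ↦ TotalSpace.mk' (EuclideanSpace ℝ (Fin n)) y (Y y)) x :=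
  ContMDiffOn.contMDiffAt h hx

lemma SmoothVOn.diffVAt {Y : VField n M} {U : Set M} (h : SmoothVOn Y U) {x : M}
    (hx : U ∈ 𝓝 x) : DiffVAt Y x :=
  (h.contMDiffAt hx).mdifferentiableAt (by simp)

lemma SmoothVOn.mono {Y : VField n M} {U W : Set M} (h : SmoothVOn Y U) (hW : W ⊆ U) :
    SmoothVOn Y W := ContMDiffOn.mono h hW

lemma SmoothEndOn.mono {A : EndField n M} {U W : Set M} (h : SmoothEndOn A U) (hW : W ⊆ U) :
    SmoothEndOn A W := ContMDiffOn.mono h hW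

lemma SmoothVOn.congr {Y Z : VField n M} {U : Set M} (h : SmoothVOn Y U)
    (he : ∀ x ∈ U, Z x = Y x) : SmoothVOn Z U :=
  ContMDiffOn.congr h fun x hx ↦ by rw [he x hx]

lemma SmoothVOn.add {Y Z : VField n M} {U : Set M} (hY : SmoothVOn Y U) (hZ : SmoothVOn Z U) :
    SmoothVOn (fun x ↦ Y x + Z x) U := ContMDiffOn.add_section hY hZ

lemma SmoothVOn.sub {Y Z : VField n M} {U : Set M} (hY : SmoothVOn Y U) (hZ : SmoothVOn Z U) :
    SmoothVOn (fun x ↦ Y x - Z x) U := ContMDiffOn.sub_section hY hZ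

lemma SmoothVOn.smul {f : M → ℝ} {Y : VField n M} {U : Set M}
    (hf : ContMDiffOn (𝓡 n) 𝓘(ℝ, ℝ) ∞ f U) (hY : SmoothVOn Y U) :
    SmoothVOn (fun x ↦ f x • Y x) U := ContMDiffOn.smul_section hf hY

lemma SmoothEndOn.smul {f : M → ℝ} {A : EndField n M} {U : Set M}
    (hf : ContMDiffOn (𝓡 n) 𝓘(ℝ, ℝ) ∞ f U) (hA : SmoothEndOn A U) :
    SmoothEndOn (fun x ↦ f x • A x) U := ContMDiffOn.smul_section hf hA

lemma SmoothEndOn.apply {A : EndField n M} {Y : VField n M} {U : Set M} (hA : SmoothEndOn A U)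
    (hY : SmoothVOn Y U) : SmoothVOn (fun x ↦ A x (Y x)) U :=
  ContMDiffOn.clm_bundle_apply hA hY

lemma SmoothEndOn.diffVAt {A : EndField n M} {Y : VField n M} {U : Set M} {x : M}
    (hA : SmoothEndOn A U) (hx : U ∈ 𝓝 x) (hY : DiffVAt Y x) :
    DiffVAt (fun y ↦ A y (Y y)) x :=
  MDifferentiableAt.clm_bundle_apply
    ((ContMDiffOn.contMDiffAt hA hx).mdifferentiableAt (by simp)) hY

lemma DiffVAt.add {Y Z : VField n M} {x : M} (hY : DiffVAt Y x) (hZ : DiffVAt Z x) :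
    DiffVAt (fun y ↦ Y y + Z y) x := mdifferentiableAt_add_section hY hZ

lemma DiffVAt.sub {Y Z : VField n M} {x : M} (hY : DiffVAt Y x) (hZ : DiffVAt Z x) :
    DiffVAt (fun y ↦ Y y - Z y) x := mdifferentiableAt_sub_section hY hZ

lemma DiffVAt.smul {f : M → ℝ} {Y : VField n M} {x : M}
    (hf : MDifferentiableAt (𝓡 n) 𝓘(ℝ, ℝ) f x) (hY : DiffVAt Y x) :
    DiffVAt (fun y ↦ f y • Y y) x := MDifferentiableAt.smul_section hf hY

lemma DiffVAt.congr {Y Z : VField n M} {x : M} (hY : DiffVAt Y x)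
    (h : ∀ᶠ y in 𝓝 x, Z y = Y y) : DiffVAt Z x :=
  MDifferentiableAt.congr_of_eventuallyEq hY (h.mono fun y hy ↦ by simp [hy])

/-- The local field with constant components in the trivialization around `x`. -/
abbrev ext {x : M} (v : TangentSpace (𝓡 n) x) : VField n M :=
  FiberBundle.extend (EuclideanSpace ℝ (Fin n)) v

lemma ext_self {x : M} (v : TangentSpace (𝓡 n) x) : ext v x = v :=
  FiberBundle.extend_apply_self ..

lemma ext_diffVAt {x : M} (v : TangentSpace (𝓡 n) x) : DiffVAt (ext v) x :=
  FiberBundle.mdifferentiableAt_extend ..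

lemma exists_smoothVOn_ext {x : M} (v : TangentSpace (𝓡 n) x) :
    ∃ U ∈ 𝓝 x, SmoothVOn (ext v) U :=
  FiberBundle.exists_contMDiffOn_extend (k := ∞) (𝓡 n) _ v

/-- In coordinates an operator is the sum of its columns paired with the dual basis, and the columns
are its values on the fields `ext v`. -/
lemma contMDiffAt_end_of_apply {A : EndField n M} {x : M}
    (h : ∀ v : TangentSpace (𝓡 n) x, ContMDiffAt (𝓡 n)
      ((𝓡 n).prod 𝓘(ℝ, EuclideanSpace ℝ (Fin n))) ∞
      (fun y ↦ TotalSpace.mk' (EuclideanSpace ℝ (Fin n)) y (A y (ext v y))) x) :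
    ContMDiffAt (𝓡 n)
    ((𝓡 n).prod 𝓘(ℝ, EuclideanSpace ℝ (Fin n) →L[ℝ] EuclideanSpace ℝ (Fin n))) ∞
    (fun x ↦ TotalSpace.mk' (EuclideanSpace ℝ (Fin n) →L[ℝ] EuclideanSpace ℝ (Fin n))
      (E := fun x : M ↦ TangentSpace (𝓡 n) x →L[ℝ] TangentSpace (𝓡 n) x) x (A x)) x := by
  rw [contMDiffAt_hom_bundle]
  refine ⟨contMDiffAt_id, ?_⟩
  set e := trivializationAt (EuclideanSpace ℝ (Fin n)) (TangentSpace (𝓡 n) : M → Type _) x with he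
  have hxe : x ∈ e.baseSet := FiberBundle.mem_baseSet_trivializationAt' x
  let b := EuclideanSpace.basisFun (Fin n) ℝ
  have hsum : ∀ L : EuclideanSpace ℝ (Fin n) →L[ℝ] EuclideanSpace ℝ (Fin n),
      L = ∑ a, ContinuousLinearMap.smulRightL ℝ _ _ (EuclideanSpace.proj a) (L (b a)) := by
    intro L
    ext1 v
    conv_lhs => rw [← b.sum_repr v, map_sum]
    simp [b]
  have hcomp : ∀ w : EuclideanSpace ℝ (Fin n), ContMDiffAt (𝓡 n)
      𝓘(ℝ, EuclideanSpace ℝ (Fin n)) ∞ (fun y ↦ ContinuousLinearMap.inCoordinates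
        (EuclideanSpace ℝ (Fin n)) (TangentSpace (𝓡 n) : M → Type _)
        (EuclideanSpace ℝ (Fin n)) (TangentSpace (𝓡 n) : M → Type _) x y x y (A y) w) x := by
    intro w
    have h1 := (contMDiffAt_section _).1 (h (e.symm x w))
    refine h1.congr_of_eventuallyEq ?_
    filter_upwards [e.open_baseSet.mem_nhds hxe] with y hy
    rw [ContinuousLinearMap.inCoordinates_eq hy hy]
    simp [FiberBundle.extend, ← he, hxe, hy]
  have : (fun y ↦ ContinuousLinearMap.inCoordinates
        (EuclideanSpace ℝ (Fin n)) (TangentSpace (𝓡 n) : M → Type _)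
        (EuclideanSpace ℝ (Fin n)) (TangentSpace (𝓡 n) : M → Type _) x y x y (A y)) =
      fun y ↦ ∑ a, ContinuousLinearMap.smulRightL ℝ _ _ (EuclideanSpace.proj a)
        (ContinuousLinearMap.inCoordinates
        (EuclideanSpace ℝ (Fin n)) (TangentSpace (𝓡 n) : M → Type _)
        (EuclideanSpace ℝ (Fin n)) (TangentSpace (𝓡 n) : M → Type _) x y x y (A y) (b a)) := by
    ext1 y
    exact hsum _
  rw [this]
  refine ContMDiffAt.sum fun a _ ↦ ?_
  exact (ContinuousLinearMap.contMDiff (ContinuousLinearMap.smulRightL ℝ _ _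
    (EuclideanSpace.proj a))).contMDiffAt.comp x (hcomp (b a))

/-- A field of endomorphisms is smooth if its values on smooth local fields are smooth. -/
lemma smoothEndOn_of_apply {A : EndField n M} {U : Set M} (hU : IsOpen U)
    (h : ∀ W ⊆ U, IsOpen W → ∀ Y, SmoothVOn Y W → SmoothVOn (fun x ↦ A x (Y x)) W) :
    SmoothEndOn A U := by
  intro x hx
  refine (contMDiffAt_end_of_apply fun v ↦ ?_).contMDiffWithinAt
  obtain ⟨N, hN, hv⟩ := exists_smoothVOn_ext v
  have hW : interior N ∩ U ∈ 𝓝 x := Filter.inter_mem (interior_mem_nhds.2 hN) (hU.mem_nhds hx)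
  exact (h (interior N ∩ U) inter_subset_right (isOpen_interior.inter hU) _
    (hv.mono (inter_subset_left.trans interior_subset))).contMDiffAt hW

variable [T2Space M]

lemma exists_bump {x : M} {U : Set M} (hU : U ∈ 𝓝 x) :
    ∃ f : M → ℝ, ContMDiff (𝓡 n) 𝓘(ℝ, ℝ) ∞ f ∧ tsupport f ⊆ interior U ∧ ∀ᶠ y in 𝓝 x, f y = 1 := by
  obtain ⟨f, -, hf⟩ := (SmoothBumpFunction.nhds_basis_tsupport (I := 𝓡 n) x).mem_iff.1
    (interior_mem_nhds.2 hU)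
  exact ⟨f, f.contMDiff, hf, f.eventuallyEq_one⟩

/-- Multiplication by a bump function. Smoothness of a connection and the Einstein condition are
tested on fields over a given set, while the fields at hand are often local. -/
lemma SmoothVOn.exists_global {Y : VField n M} {x : M} {U : Set M} (hY : SmoothVOn Y U)
    (hU : U ∈ 𝓝 x) : ∃ Z : VField n M, SmoothVOn Z univ ∧ ∀ᶠ y in 𝓝 x, Z y = Y y := by
  obtain ⟨f, hf, hs, h1⟩ := exists_bump (n := n) hU
  refine ⟨fun y ↦ f y • Y y, contMDiffOn_univ.2 <| ?_, h1.mono fun y hy ↦ by simp [hy]⟩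
  exact ContMDiffOn.smul_section_of_tsupport hf.contMDiffOn isOpen_interior hs
    (ContMDiffOn.mono hY interior_subset)

/-- The fibres of Q are linear subspaces, so cutting off a section stays in Q, and the cut-off
section is zero where A is not controlled. -/
lemma SmoothEndOn.exists_global {A : EndField n M} {x : M} {U : Set M} (hA : SmoothEndOn A U)
    (hU : U ∈ 𝓝 x) {Q : ∀ x : M, Submodule ℝ (TangentSpace (𝓡 n) x →L[ℝ] TangentSpace (𝓡 n) x)}
    (hQ : ∀ y ∈ U, A y ∈ Q y) :
    ∃ B : EndField n M, SmoothEndOn B univ ∧ (∀ y, B y ∈ Q y) ∧ ∀ᶠ y in 𝓝 x, B y = A y := by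
  obtain ⟨f, hf, hs, h1⟩ := exists_bump (n := n) hU
  refine ⟨fun y ↦ f y • A y, contMDiffOn_univ.2 <| ?_, fun y ↦ ?_,
    h1.mono fun y hy ↦ by simp [hy]⟩
  · exact ContMDiffOn.smul_section_of_tsupport hf.contMDiffOn isOpen_interior hs
      (ContMDiffOn.mono hA interior_subset)
  · by_cases hy : y ∈ U
    · exact (Q y).smul_mem _ (hQ y hy)
    · have : f y = 0 := by
        by_contra h0
        exact hy (interior_subset (hs (subset_tsupport f h0)))
      simp only [this, zero_smul]
      exact (Q y).zero_mem

end Smooth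

/-! ### Calculus of connections -/

section Connection

variable {n : ℕ} {M : Type*} [TopologicalSpace M] [ChartedSpace (EuclideanSpace ℝ (Fin n)) M]
  [IsManifold (𝓡 n) ∞ M]

instance (x : M) : FiniteDimensional ℝ (TangentSpace (𝓡 n) x) :=
  inferInstanceAs (FiniteDimensional ℝ (EuclideanSpace ℝ (Fin n)))

lemma finrank_tangentSpace (x : M) : Module.finrank ℝ (TangentSpace (𝓡 n) x) = n :=
  finrank_euclideanSpace_fin

lemma nontrivial_tangentSpace (hn : 0 < n) (x : M) : Nontrivial (TangentSpace (𝓡 n) x) :=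
  Module.nontrivial_of_finrank_pos (R := ℝ) (by rw [finrank_tangentSpace]; exact hn)

lemma mvfderiv_comp_real {f : M → ℝ} {g : ℝ → ℝ} {x : M} {g' : ℝ}
    (hg : HasDerivAt g g' (f x)) (hf : MDifferentiableAt (𝓡 n) 𝓘(ℝ, ℝ) f x)
    (z : TangentSpace (𝓡 n) x) :
    mvfderiv (𝓡 n) (fun y ↦ g (f y)) x z = g' * mvfderiv (𝓡 n) f x z := by
  have h1 : HasMFDerivAt 𝓘(ℝ, ℝ) 𝓘(ℝ, ℝ) g (f x) (ContinuousLinearMap.toSpanSingleton ℝ g') :=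
    hg.hasFDerivAt.hasMFDerivAt
  have h2 := (h1.comp x hf.hasMFDerivAt).mfderiv
  have h3 : mvfderiv (𝓡 n) (fun y ↦ g (f y)) x z = mfderiv (𝓡 n) 𝓘(ℝ, ℝ) (g ∘ f) x z := rfl
  rw [h3, h2]
  exact mul_comm (mvfderiv (𝓡 n) f x z) g'

variable {D : ConnOp n M} {U : Set M} {x : M}

namespace IsAffineConnectionOn

variable (hD : IsAffineConnectionOn D U)
include hD

lemma add (hx : x ∈ U) {Y Z : VField n M} (hY : DiffVAt Y x) (hZ : DiffVAt Z x)
    (z : TangentSpace (𝓡 n) x) : D (fun y ↦ Y y + Z y) x z = D Y x z + D Z x z :=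
  congrArg (fun L ↦ L z) (hD.isCov.add hY hZ hx)

lemma smul (hx : x ∈ U) {f : M → ℝ} {Y : VField n M}
    (hf : MDifferentiableAt (𝓡 n) 𝓘(ℝ, ℝ) f x) (hY : DiffVAt Y x) (z : TangentSpace (𝓡 n) x) :
    D (fun y ↦ f y • Y y) x z = f x • D Y x z + mvfderiv (𝓡 n) f x z • Y x :=
  congrArg (fun L ↦ L z) (hD.isCov.leibniz hY hf hx)

lemma const_smul (hx : x ∈ U) (c : ℝ) {Y : VField n M} (hY : DiffVAt Y x)
    (z : TangentSpace (𝓡 n) x) : D (fun y ↦ c • Y y) x z = c • D Y x z :=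
  congrArg (fun L ↦ L z) (hD.isCov.smul_const c hY hx)

lemma neg (hx : x ∈ U) {Y : VField n M} (hY : DiffVAt Y x)
    (z : TangentSpace (𝓡 n) x) : D (fun y ↦ -Y y) x z = -D Y x z := by
  simpa using hD.const_smul hx (-1) hY z

lemma sub (hx : x ∈ U) {Y Z : VField n M} (hY : DiffVAt Y x) (hZ : DiffVAt Z x)
    (z : TangentSpace (𝓡 n) x) : D (fun y ↦ Y y - Z y) x z = D Y x z - D Z x z := by
  have hZ' : DiffVAt (fun y ↦ -Z y) x := by simpa using hZ.smul (f := fun _ ↦ -1) mdifferentiableAt_const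
  simpa [sub_eq_add_neg, hD.neg hx hZ z] using hD.add hx hY hZ' z

lemma congr (hU : U ∈ 𝓝 x) {Y Z : VField n M} (hY : DiffVAt Y x) (h : ∀ᶠ y in 𝓝 x, Z y = Y y) :
    D Z x = D Y x :=
  hD.isCov.congr_of_eventuallyEq (hY.congr h) hY hU h

/-- A field smooth on W need not extend smoothly to U. It is cut off near each point, which is
harmless because D depends only on germs. -/
lemma mono {W : Set M} [T2Space M] (hU : IsOpen U) (hW : IsOpen W) (h : W ⊆ U) :
    IsAffineConnectionOn D W := by
  refine ⟨hD.isCov.mono h, ⟨fun {Y} hY x hx ↦ ?_⟩⟩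
  have hY' : SmoothVOn Y W := hY
  obtain ⟨Z, hZ, he⟩ := hY'.exists_global (hW.mem_nhds hx)
  have h1 := hD.smooth.contMDiff (σ := Z) (ContMDiffOn.mono hZ (subset_univ _))
  refine ((h1.contMDiffAt (hU.mem_nhds (h hx))).congr_of_eventuallyEq ?_).contMDiffWithinAt
  filter_upwards [he.eventually_nhds, hU.mem_nhds (h hx)] with y hy hyU
  have : D Z y = D Y y := by
    refine hD.congr (hU.mem_nhds hyU) ?_ hy
    exact (hZ.diffVAt Filter.univ_mem).congr (hy.mono fun _ h ↦ h.symm)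
  simp [this]

lemma smoothEndOn [T2Space M] (hU : IsOpen U) {W : Set M} (hW : IsOpen W) (h : W ⊆ U)
    {Y : VField n M} (hY : SmoothVOn Y W) : SmoothEndOn (D Y) W :=
  (hD.mono hU hW h).smooth.contMDiff hY

end IsAffineConnectionOn

namespace IsEndDeriv

variable {A A' : EndField n M} {z : TangentSpace (𝓡 n) x}
  {B B' : TangentSpace (𝓡 n) x →L[ℝ] TangentSpace (𝓡 n) x}

lemma unique (h : IsEndDeriv D A x z B) (h' : IsEndDeriv D A x z B') : B = B' := by
  ext1 v
  have h1 := (h (ext v) (ext_diffVAt v)).symm.trans (h' (ext v) (ext_diffVAt v))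
  simpa [ext_self] using h1

lemma comp (h : IsEndDeriv D A x z B) (h' : IsEndDeriv D A' x z B') {N : Set M} (hN : N ∈ 𝓝 x)
    (hA' : SmoothEndOn A' N) :
    IsEndDeriv D (fun y ↦ (A y).comp (A' y)) x z (B.comp (A' x) + (A x).comp B') := by
  intro Y hY
  have h1 := h _ (hA'.diffVAt hN hY)
  simp only [ContinuousLinearMap.comp_apply, h1, h' Y hY, _root_.add_apply, map_add]
  abel

lemma congr (hD : IsAffineConnectionOn D U) (hU : U ∈ 𝓝 x) (h : IsEndDeriv D A x z B)
    {N : Set M} (hN : N ∈ 𝓝 x) (hA : SmoothEndOn A N) (he : ∀ᶠ y in 𝓝 x, A' y = A y) :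
    IsEndDeriv D A' x z B := by
  intro Y hY
  rw [hD.congr hU (hA.diffVAt hN hY) (he.mono fun y hy ↦ by rw [hy]), he.self_of_nhds]
  exact h Y hY

lemma smul (hD : IsAffineConnectionOn D U) (hx : x ∈ U) (h : IsEndDeriv D A x z B)
    {f : M → ℝ} (hf : MDifferentiableAt (𝓡 n) 𝓘(ℝ, ℝ) f x)
    {N : Set M} (hN : N ∈ 𝓝 x) (hA : SmoothEndOn A N) :
    IsEndDeriv D (fun y ↦ f y • A y) x z (f x • B + mvfderiv (𝓡 n) f x z • A x) := by
  intro Y hY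
  have := hD.smul hx hf (hA.diffVAt hN hY) z
  simp only [_root_.smul_apply, _root_.add_apply, this, h Y hY]
  module

lemma neg (hD : IsAffineConnectionOn D U) (hx : x ∈ U) (h : IsEndDeriv D A x z B)
    {N : Set M} (hN : N ∈ 𝓝 x) (hA : SmoothEndOn A N) :
    IsEndDeriv D (fun y ↦ -A y) x z (-B) := by
  intro Y hY
  have := hD.neg hx (hA.diffVAt hN hY) z
  simp only [_root_.neg_apply, this, h Y hY, neg_add]

end IsEndDeriv

/-- The relations between the derivatives of a local quaternionic triple. -/
lemma exists_triple_deriv (hD : IsAffineConnectionOn D U) (hU : IsOpen U)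
    {Q : ∀ x : M, Submodule ℝ (TangentSpace (𝓡 n) x →L[ℝ] TangentSpace (𝓡 n) x)}
    (hP : PreservesOn D Q U) {W : Set M} (hW : IsOpen W) {I J K : EndField n M}
    (hI : SmoothEndOn I W) (hJ : SmoothEndOn J W) (hK : SmoothEndOn K W)
    (hq : ∀ x ∈ W, IsQuaternionicTriple (I x) (J x) (K x) ∧ Q x = Submodule.span ℝ {I x, J x, K x})
    (hxU : x ∈ U) (hxW : x ∈ W) (z : TangentSpace (𝓡 n) x) :
    ∃ A ∈ Q x, ∃ B ∈ Q x, ∃ C ∈ Q x, IsEndDeriv D I x z A ∧ IsEndDeriv D J x z B ∧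
      IsEndDeriv D K x z C ∧ (∀ v, A (I x v) + I x (A v) = 0) ∧
      (∀ v, B (J x v) + J x (B v) = 0) ∧ (∀ v, C v = A (J x v) + I x (B v)) ∧
      ∀ v, -C v = B (I x v) + J x (A v) := by
  have hWx := hW.mem_nhds hxW
  have hm : ∀ y ∈ W, I y ∈ Q y ∧ J y ∈ Q y ∧ K y ∈ Q y := by
    intro y hy
    rw [(hq y hy).2]
    refine ⟨?_, ?_, ?_⟩ <;> exact Submodule.subset_span (by simp)
  obtain ⟨A, hA, dA⟩ := hP x hxU I ⟨W, hWx, hI, fun y hy ↦ (hm y hy).1⟩ z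
  obtain ⟨B, hB, dB⟩ := hP x hxU J ⟨W, hWx, hJ, fun y hy ↦ (hm y hy).2.1⟩ z
  obtain ⟨C, hC, dC⟩ := hP x hxU K ⟨W, hWx, hK, fun y hy ↦ (hm y hy).2.2⟩ z
  have hUx := hU.mem_nhds hxU
  -- The four relations are the derivatives of I² = −1, J² = −1, K = IJ and −K = JI.
  refine ⟨A, hA, B, hB, C, hC, dA, dB, dC, ?_, ?_, ?_, ?_⟩
  · intro v
    have h1 := dA.comp dA hWx hI (ext v) (ext_diffVAt v)
    have h2 := hD.congr hUx (Y := fun y ↦ -ext v y) (x := x)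
      (Z := fun y ↦ ((I y).comp (I y)) (ext v y))
      (by simpa using (ext_diffVAt v).smul (f := fun _ ↦ -1) mdifferentiableAt_const)
      (by filter_upwards [hWx] with y hy using (hq y hy).1.1 _)
    rw [h2, hD.neg hxU (ext_diffVAt v)] at h1
    simp only [ContinuousLinearMap.comp_apply, _root_.add_apply, ext_self, (hq x hxW).1.1] at h1
    simpa using h1
  · intro v
    have h1 := dB.comp dB hWx hJ (ext v) (ext_diffVAt v)
    have h2 := hD.congr hUx (Y := fun y ↦ -ext v y) (x := x)
      (Z := fun y ↦ ((J y).comp (J y)) (ext v y))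
      (by simpa using (ext_diffVAt v).smul (f := fun _ ↦ -1) mdifferentiableAt_const)
      (by filter_upwards [hWx] with y hy using (hq y hy).1.2.1 _)
    rw [h2, hD.neg hxU (ext_diffVAt v)] at h1
    simp only [ContinuousLinearMap.comp_apply, _root_.add_apply, ext_self, (hq x hxW).1.2.1] at h1
    simpa using h1
  · intro v
    have h1 := dA.comp dB hWx hJ
    have h2 := dC.congr hD hUx hWx hK (A' := fun y ↦ (I y).comp (J y)) (by
      filter_upwards [hWx] with y hy using ContinuousLinearMap.ext (hq y hy).1.2.2.1)
    rw [h2.unique h1]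
    simp
  · intro v
    have h1 := dB.comp dA hWx hI
    have h2 := (dC.neg hD hxU hWx hK).congr hD hUx hWx (hA := by
      simpa using hK.smul (f := fun _ ↦ -1) contMDiffOn_const) (A' := fun y ↦ (J y).comp (I y)) (by
      filter_upwards [hWx] with y hy using ContinuousLinearMap.ext (hq y hy).1.2.2.2)
    rw [← _root_.neg_apply, h2.unique h1]
    simp

end Connection

/-! ### The norm of the moment section -/

section SkewTriple

variable {V : Type*} [NormedAddCommGroup V] [InnerProductSpace ℝ V] {I J K : V →L[ℝ] V}
  (h : QTriple I J K) (sk : ∀ A ∈ Submodule.span ℝ {I, J, K}, ∀ v w, (inner ℝ (A v) w : ℝ) = -inner ℝ v (A w))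
include h

lemma QTriple.trace_comb [FiniteDimensional ℝ V] (a b c : ℝ) :
    LinearMap.trace ℝ V ((a • I + b • J + c • K).comp (a • I + b • J + c • K)).toLinearMap =
      -((a ^ 2 + b ^ 2 + c ^ 2) * Module.finrank ℝ V) := by
  have : ((a • I + b • J + c • K).comp (a • I + b • J + c • K)).toLinearMap =
      (-(a ^ 2 + b ^ 2 + c ^ 2)) • (LinearMap.id : V →ₗ[ℝ] V) := by
    refine LinearMap.ext fun v ↦ (h.comb_comb a b c v).trans ?_
    rw [LinearMap.smul_apply, LinearMap.id_apply, neg_smul]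
  rw [this, map_smul, LinearMap.trace_id, smul_eq_mul, neg_mul]

include sk

/-- Moving one factor across the inner product leaves terms g(v, Av) with A in the span, which
vanish by skewness, and multiples of g(v, v). Evaluation at a fixed vector v is thus a similarity
from the coefficients onto its image. -/
lemma QTriple.inner_comb (a b c x y z : ℝ) (v : V) :
    (inner ℝ ((a • I + b • J + c • K) v) ((x • I + y • J + z • K) v) : ℝ) =
      (a * x + b * y + c * z) * inner ℝ v v := by
  have mI : I ∈ Submodule.span ℝ {I, J, K} := Submodule.subset_span (by simp)
  have mJ : J ∈ Submodule.span ℝ {I, J, K} := Submodule.subset_span (by simp)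
  have mK : K ∈ Submodule.span ℝ {I, J, K} := Submodule.subset_span (by simp)
  have z : ∀ A ∈ Submodule.span ℝ {I, J, K}, (inner ℝ v (A v) : ℝ) = 0 := by
    intro A hA
    have := sk A hA v v
    rw [real_inner_comm] at this
    linarith
  obtain ⟨h1, h2, h3, h4, h5, h6, h7, h8, h9⟩ := h.table
  simp only [_root_.add_apply, _root_.smul_apply, inner_add_left, inner_add_right,
    real_inner_smul_left, real_inner_smul_right, sk I mI, sk J mJ, sk K mK, h1, h2, h3, h4, h5, h6,
    h7, h8, h9, inner_neg_right, z I mI, z J mJ, z K mK]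
  ring

end SkewTriple

section MomentNorm

variable {n : ℕ} {M : Type*} [TopologicalSpace M] [ChartedSpace (EuclideanSpace ℝ (Fin n)) M]
  [IsManifold (𝓡 n) ∞ M] [RiemannianBundle (fun x : M ↦ TangentSpace (𝓡 n) x)]
  [IsContMDiffRiemannianBundle (𝓡 n) ∞ (EuclideanSpace ℝ (Fin n))
      (fun x : M ↦ TangentSpace (𝓡 n) x)]

lemma DiffVAt.inner {Y Z : VField n M} {x : M} (hY : DiffVAt Y x) (hZ : DiffVAt Z x) :
    MDifferentiableAt (𝓡 n) 𝓘(ℝ, ℝ) (fun y ↦ (inner ℝ (Y y) (Z y) : ℝ)) x :=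
  have : IsContMDiffRiemannianBundle (𝓡 n) 1 (EuclideanSpace ℝ (Fin n))
      (fun x : M ↦ TangentSpace (𝓡 n) x) := .of_le (n := ∞) (by exact_mod_cast le_top)
  MDifferentiableAt.inner_bundle hY hZ

lemma SmoothVOn.inner {Y Z : VField n M} {U : Set M} (hY : SmoothVOn Y U) (hZ : SmoothVOn Z U) :
    ContMDiffOn (𝓡 n) 𝓘(ℝ, ℝ) ∞ (fun y ↦ (inner ℝ (Y y) (Z y) : ℝ)) U :=
  ContMDiffOn.inner_bundle hY hZ

variable {nabla : ConnOp n M}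
    {Q : ∀ x : M, Submodule ℝ (TangentSpace (𝓡 n) x →L[ℝ] TangentSpace (𝓡 n) x)}
    {X : VField n M} {μ : EndField n M}

section Pointwise

variable (hn : 0 < n) (hQ : IsQuaternionicKahler nabla Q) (hm : ∀ x, μ x ∈ Q x)
include hn hQ hm

/-- The square of aI + bJ + cK is −(a² + b² + c²), so the trace in `momentNorm` computes the
Euclidean length of the coefficients. -/
lemma moment_eq_comb {x : M} {I J K : TangentSpace (𝓡 n) x →L[ℝ] TangentSpace (𝓡 n) x}
    (h : QTriple I J K) (hs : Q x = Submodule.span ℝ {I, J, K}) :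
    ∃ a b c : ℝ, μ x = a • I + b • J + c • K ∧ momentNorm μ x ^ 2 = a ^ 2 + b ^ 2 + c ^ 2 := by
  obtain ⟨a, b, c, e⟩ := QTriple.mem_span_iff.1 (hs ▸ hm x)
  refine ⟨a, b, c, e, ?_⟩
  have hn' : (n : ℝ) ≠ 0 := by positivity
  rw [momentNorm, e, h.trace_comb, finrank_tangentSpace, neg_neg, mul_div_assoc, div_self hn',
    mul_one, Real.sq_sqrt (by positivity)]

lemma exists_triple (x : M) : ∃ I J K : TangentSpace (𝓡 n) x →L[ℝ] TangentSpace (𝓡 n) x,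
    QTriple I J K ∧ Q x = Submodule.span ℝ {I, J, K} := by
  obtain ⟨U, -, hx, I, J, K, -, -, -, h⟩ := hQ.almostQuaternionic x
  exact ⟨I x, J x, K x, h x hx⟩

lemma moment_moment (x : M) (v : TangentSpace (𝓡 n) x) :
    μ x (μ x v) = -(momentNorm μ x ^ 2 • v) := by
  obtain ⟨I, J, K, h, hs⟩ := exists_triple hn hQ hm x
  obtain ⟨a, b, c, e, e'⟩ := moment_eq_comb hn hQ hm h hs
  rw [e', e, h.comb_comb]

lemma inner_moment_moment (x : M) (v w : TangentSpace (𝓡 n) x) :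
    (inner ℝ (μ x v) (μ x w) : ℝ) = momentNorm μ x ^ 2 * inner ℝ v w := by
  rw [hQ.skew x _ (hm x), moment_moment hn hQ hm, inner_neg_right, neg_neg, real_inner_smul_right]

lemma momentNorm_sq_ne_zero {x : M} (hx : x ∈ nonzeroSet μ) : momentNorm μ x ^ 2 ≠ 0 := by
  intro h0
  refine hx (ContinuousLinearMap.ext fun v ↦ ?_)
  have := inner_moment_moment hn hQ hm x v v
  rw [h0, zero_mul] at this
  simpa using this

lemma momentNorm_pos {x : M} (hx : x ∈ nonzeroSet μ) : 0 < momentNorm μ x :=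
  lt_of_le_of_ne (Real.sqrt_nonneg _) fun h ↦
    momentNorm_sq_ne_zero hn hQ hm hx (by rw [← h]; simp)

lemma nonzeroSet_eq : nonzeroSet μ = {x | momentNorm μ x ^ 2 ≠ 0} := by
  ext x
  refine ⟨momentNorm_sq_ne_zero hn hQ hm, fun h h0 ↦ h ?_⟩
  simp [momentNorm, h0]

lemma exists_adapted_triple {x : M} (hx : x ∈ nonzeroSet μ) :
    ∃ J K, QTriple (momentStructure μ x) J K ∧
      Q x = Submodule.span ℝ {momentStructure μ x, J, K} := by
  have := nontrivial_tangentSpace hn x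
  obtain ⟨I, J, K, h, hs⟩ := exists_triple hn hQ hm x
  obtain ⟨a, b, c, e, e'⟩ := moment_eq_comb hn hQ hm h hs
  have hp := momentNorm_pos hn hQ hm hx
  set t := (momentNorm μ x)⁻¹ with ht
  have hI : momentStructure μ x = (t * a) • I + (t * b) • J + (t * c) • K := by
    rw [momentStructure, e, ← ht]
    module
  obtain ⟨J', hJ', K', hK', h'⟩ := h.exists_adapted (a := t * a) (b := t * b) (c := t * c) (by
    rw [mul_pow, mul_pow, mul_pow, ← mul_add, ← mul_add, ← e', ht, ← mul_pow,
      inv_mul_cancel₀ hp.ne', one_pow])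
  refine ⟨J', K', hI ▸ h', ?_⟩
  rw [hs, hI]
  exact h.span_eq h' (QTriple.mem_span_iff.2 ⟨_, _, _, rfl⟩) hJ' hK'

lemma momentStructure_sq {x : M} (hx : x ∈ nonzeroSet μ) (v : TangentSpace (𝓡 n) x) :
    momentStructure μ x (momentStructure μ x v) = -v := by
  obtain ⟨J, K, h, -⟩ := exists_adapted_triple hn hQ hm hx
  exact h.I_I v

end Pointwise

variable (hn : 0 < n) (hQ : IsQuaternionicKahler nabla Q) (hμ : IsMomentSection nabla Q X μ)
include hn hQ hμ

/-- By `inner_moment_moment`, |μ|² is the quotient |μY|²/|Y|² for any local field Y without zeros,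
and this is visibly smooth. -/
lemma contMDiff_momentNorm_sq :
    ContMDiff (𝓡 n) 𝓘(ℝ, ℝ) ∞ (fun y ↦ momentNorm μ y ^ 2) := by
  intro x
  have := nontrivial_tangentSpace hn x
  obtain ⟨v, hv⟩ := exists_ne (0 : TangentSpace (𝓡 n) x)
  obtain ⟨N, hN, hY⟩ := exists_smoothVOn_ext v
  have h1 := (hY.inner hY).contMDiffAt hN
  have hμY := (hμ.smooth.mono (subset_univ N)).apply hY
  have h2 := (hμY.inner hμY).contMDiffAt hN
  have h0 : (inner ℝ (ext v x) (ext v x) : ℝ) ≠ 0 := by simpa [ext_self] using hv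
  refine (h2.div₀ h1 h0).congr_of_eventuallyEq ?_
  filter_upwards [h1.continuousAt.eventually_ne h0] with y hy
  simp only [Pi.div_apply]
  rw [inner_moment_moment hn hQ hμ.mem, mul_div_assoc, div_self hy, mul_one]

lemma isOpen_nonzeroSet : IsOpen (nonzeroSet μ) := by
  rw [nonzeroSet_eq hn hQ hμ.mem]
  exact isOpen_ne.preimage (contMDiff_momentNorm_sq hn hQ hμ).continuous

lemma contMDiffOn_momentNorm : ContMDiffOn (𝓡 n) 𝓘(ℝ, ℝ) ∞ (momentNorm μ) (nonzeroSet μ) := by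
  intro x hx
  have h0 := momentNorm_sq_ne_zero hn hQ hμ.mem hx
  have h1 : ContMDiffAt 𝓘(ℝ, ℝ) 𝓘(ℝ, ℝ) ∞ Real.sqrt (momentNorm μ x ^ 2) :=
    (Real.contDiffAt_sqrt h0).contMDiffAt
  have := h1.comp x (contMDiff_momentNorm_sq hn hQ hμ x)
  refine ContMDiffAt.contMDiffWithinAt (this.congr_of_eventuallyEq (.of_forall fun y ↦ ?_))
  exact (Real.sqrt_sq (Real.sqrt_nonneg _)).symm

lemma smoothEndOn_momentStructure : SmoothEndOn (momentStructure μ) (nonzeroSet μ) := by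
  refine SmoothEndOn.smul ?_ (hμ.smooth.mono (subset_univ _))
  exact (contMDiffOn_momentNorm hn hQ hμ).inv₀ fun x hx ↦ (momentNorm_pos hn hQ hμ.mem hx).ne'

variable (hLC : IsLeviCivita nabla)
include hLC

/-- The differential of `|μ|²`. -/
lemma mvfderiv_momentNorm_sq (x : M) (z : TangentSpace (𝓡 n) x) :
    mvfderiv (𝓡 n) (fun y ↦ momentNorm μ y ^ 2) x z = 2 * (inner ℝ (μ x (X x)) z : ℝ) := by
  have := nontrivial_tangentSpace hn x
  obtain ⟨v, hv⟩ := exists_ne (0 : TangentSpace (𝓡 n) x)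
  obtain ⟨I, J, K, h, hs⟩ := exists_triple hn hQ hμ.mem x
  obtain ⟨a, b, c, e, -⟩ := moment_eq_comb hn hQ hμ.mem h hs
  have mI : I ∈ Q x := hs ▸ Submodule.subset_span (by simp)
  have mJ : J ∈ Q x := hs ▸ Submodule.subset_span (by simp)
  have mK : K ∈ Q x := hs ▸ Submodule.subset_span (by simp)
  have hd := hμ.deriv_eq x I mI J mJ K mK h z (ext v) (ext_diffVAt v)
  have dY := ext_diffVAt v
  have dμY := hμ.smooth.diffVAt Filter.univ_mem dY
  -- Differentiating |μY|² = |μ|²|Y|², the terms with ∇Y cancel. What is left is (d|μ|²)(z)|v|² =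
  -- 2g((∇_zμ)v, μv), and `inner_comb` evaluates the right-hand side as 2g(μX, z)|v|².
  have h1 := hLC.metric x _ _ dμY dμY z
  have h2 := hLC.metric x _ _ dY dY z
  have h3 : mvfderiv (𝓡 n) (fun y ↦ momentNorm μ y ^ 2 * (inner ℝ (ext v y) (ext v y) : ℝ)) x z
      = _ := congrArg (fun L ↦ L z) <| mvfderiv_fun_mul
      ((contMDiff_momentNorm_sq hn hQ hμ).mdifferentiable (by simp) x) (dY.inner dY)
  have h4 : (fun y ↦ (inner ℝ (μ y (ext v y)) (μ y (ext v y)) : ℝ)) =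
      fun y ↦ momentNorm μ y ^ 2 * (inner ℝ (ext v y) (ext v y) : ℝ) :=
    funext fun y ↦ inner_moment_moment hn hQ hμ.mem _ _ _
  have h5 := h.inner_comb (fun A hA ↦ hQ.skew x A (hs ▸ hA)) (inner ℝ (I (X x)) z)
    (inner ℝ (J (X x)) z) (inner ℝ (K (X x)) z) a b c v
  have h6 : (inner ℝ (μ x (X x)) z : ℝ) = inner ℝ (I (X x)) z * a + inner ℝ (J (X x)) z * b
      + inner ℝ (K (X x)) z * c := by
    rw [e]
    simp only [_root_.add_apply, _root_.smul_apply, inner_add_left, real_inner_smul_left]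
    ring
  rw [← e, ← h6] at h5
  set B := (inner ℝ (I (X x)) z : ℝ) • I + (inner ℝ (J (X x)) z : ℝ) • J
    + (inner ℝ (K (X x)) z : ℝ) • K
  rw [h4, h3, hd] at h1
  simp only [_root_.add_apply, _root_.smul_apply, h2, inner_add_left, inner_add_right,
    inner_moment_moment hn hQ hμ.mem, ext_self, smul_eq_mul] at h1
  have h7 : (inner ℝ v v : ℝ) ≠ 0 := by simpa using hv
  apply mul_right_cancel₀ h7
  rw [real_inner_comm (B v) (μ x v), h5] at h1
  linarith

/-- The differential of `log |μ|`. -/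
lemma momentForm_apply {x : M} (hx : x ∈ nonzeroSet μ) (z : TangentSpace (𝓡 n) x) :
    momentForm μ x z = -(1 / 2) * ((momentNorm μ x ^ 2)⁻¹ * inner ℝ (μ x (X x)) z) := by
  have h0 := momentNorm_sq_ne_zero hn hQ hμ.mem hx
  -- This holds at all points, including zeros of μ, and reduces the differential to that of |μ|².
  have h1 : (fun y ↦ Real.log (momentNorm μ y)) = fun y ↦ (1 / 2 : ℝ) * Real.log (momentNorm μ y ^ 2) := by
    ext y
    rw [Real.log_pow]
    push_cast
    ring
  have h2 : HasDerivAt (fun t ↦ (1 / 2 : ℝ) * Real.log t) (1 / 2 * (momentNorm μ x ^ 2)⁻¹)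
      (momentNorm μ x ^ 2) := (Real.hasDerivAt_log h0).const_mul _
  rw [momentForm, h1, mvfderiv_comp_real (f := fun y ↦ momentNorm μ y ^ 2) h2
    ((contMDiff_momentNorm_sq hn hQ hμ).mdifferentiable (by simp) x),
    mvfderiv_momentNorm_sq hn hQ hμ hLC]
  ring

end MomentNorm

/-! ### The modified connection -/

section Modified

variable {n : ℕ} {M : Type*} [TopologicalSpace M] [ChartedSpace (EuclideanSpace ℝ (Fin n)) M]

/-- `momentForm` as a continuous linear form. -/
def momentFormL (μ : EndField n M) (x : M) : TangentSpace (𝓡 n) x →L[ℝ] ℝ :=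
  (-(1 / 2) : ℝ) • mvfderiv (𝓡 n) (fun y ↦ Real.log (momentNorm μ y)) x

lemma momentFormL_apply (μ : EndField n M) (x : M) (z : TangentSpace (𝓡 n) x) :
    momentFormL μ x z = momentForm μ x z := by
  simp [momentFormL, momentForm]

variable [IsManifold (𝓡 n) ∞ M] [RiemannianBundle (fun x : M ↦ TangentSpace (𝓡 n) x)]

open Classical in
/-- The difference between the modified connection and `nabla`. -/
def modTensor (Q : ∀ x : M, Submodule ℝ (TangentSpace (𝓡 n) x →L[ℝ] TangentSpace (𝓡 n) x))
    (μ : EndField n M) (x : M) :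
    TangentSpace (𝓡 n) x →L[ℝ] TangentSpace (𝓡 n) x →L[ℝ] TangentSpace (𝓡 n) x :=
  -- The triple is an arbitrary choice at each point; by `modTensor_eq` the choice does not matter.
  -- On a quaternionic Kähler manifold a triple always exists, so the value 0 does not occur.
  if h : ∃ T : Fin 3 → TangentSpace (𝓡 n) x →L[ℝ] TangentSpace (𝓡 n) x,
    QTriple (T 0) (T 1) (T 2) ∧ Q x = Submodule.span ℝ {T 0, T 1, T 2} then
  oneForm (momentFormL μ x) (h.choose 0) (h.choose 1) (h.choose 2) else 0

/-- The modified connection. -/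
def modConn (nabla : ConnOp n M)
    (Q : ∀ x : M, Submodule ℝ (TangentSpace (𝓡 n) x →L[ℝ] TangentSpace (𝓡 n) x))
    (μ : EndField n M) : ConnOp n M :=
  fun Y x ↦ nabla Y x + modTensor Q μ x (Y x)

lemma modConn_apply {nabla : ConnOp n M}
    {Q : ∀ x : M, Submodule ℝ (TangentSpace (𝓡 n) x →L[ℝ] TangentSpace (𝓡 n) x)}
    {μ : EndField n M} (Y : VField n M) (x : M) (z : TangentSpace (𝓡 n) x) :
    modConn nabla Q μ Y x z = nabla Y x z + modTensor Q μ x (Y x) z := rfl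

variable {nabla : ConnOp n M}
    {Q : ∀ x : M, Submodule ℝ (TangentSpace (𝓡 n) x →L[ℝ] TangentSpace (𝓡 n) x)}
    {X : VField n M} {μ : EndField n M}

lemma modTensor_eq (hn : 0 < n) {x : M}
    {I J K : TangentSpace (𝓡 n) x →L[ℝ] TangentSpace (𝓡 n) x} (h : QTriple I J K)
    (hs : Q x = Submodule.span ℝ {I, J, K}) :
    modTensor Q μ x = oneForm (momentFormL μ x) I J K := by
  have := nontrivial_tangentSpace hn x
  have hex : ∃ T : Fin 3 → TangentSpace (𝓡 n) x →L[ℝ] TangentSpace (𝓡 n) x,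
    QTriple (T 0) (T 1) (T 2) ∧ Q x = Submodule.span ℝ {T 0, T 1, T 2} := ⟨![I, J, K], h, hs⟩
  rw [modTensor, dif_pos hex]
  obtain ⟨hT, hsT⟩ := hex.choose_spec
  refine h.oneForm_invariant hT ?_ ?_ ?_ _ <;> refine (hs.symm.trans hsT).ge ?_ <;>
    exact Submodule.subset_span (by simp)

lemma IsQuaternionicKahler.span_eq (hn : 0 < n) (hQ : IsQuaternionicKahler nabla Q) {x : M}
    {I J K : TangentSpace (𝓡 n) x →L[ℝ] TangentSpace (𝓡 n) x} (h : QTriple I J K)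
    (hI : I ∈ Q x) (hJ : J ∈ Q x) (hK : K ∈ Q x) : Q x = Submodule.span ℝ {I, J, K} := by
  have := nontrivial_tangentSpace hn x
  obtain ⟨U, -, hx, I', J', K', -, -, -, h'⟩ := hQ.almostQuaternionic x
  rw [(h' x hx).2] at hI hJ hK ⊢
  exact QTriple.span_eq (h' x hx).1 h hI hJ hK

/-- Elements of `Q` extend to smooth sections. -/
lemma IsAlmostQuaternionic.exists_section [T2Space M] (hQ : IsAlmostQuaternionic Q) {x : M}
    {B : TangentSpace (𝓡 n) x →L[ℝ] TangentSpace (𝓡 n) x} (hB : B ∈ Q x) :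
    ∃ A : EndField n M, SmoothEndOn A univ ∧ (∀ y, A y ∈ Q y) ∧ A x = B := by
  obtain ⟨U, hU, hx, I, J, K, sI, sJ, sK, h⟩ := hQ x
  obtain ⟨a, b, c, rfl⟩ := QTriple.mem_span_iff.1 ((h x hx).2 ▸ hB)
  have hs : SmoothEndOn (fun y ↦ a • I y + b • J y + c • K y) U :=
    ContMDiffOn.add_section (ContMDiffOn.add_section (sI.smul contMDiffOn_const)
      (sJ.smul contMDiffOn_const)) (sK.smul contMDiffOn_const)
  obtain ⟨A, h1, h2, h3⟩ := hs.exists_global (hU.mem_nhds hx) (Q := Q) fun y hy ↦ by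
    rw [(h y hy).2]
    exact QTriple.mem_span_iff.2 ⟨a, b, c, rfl⟩
  exact ⟨A, h1, h2, h3.self_of_nhds⟩

variable [T2Space M]
  [IsContMDiffRiemannianBundle (𝓡 n) ∞ (EuclideanSpace ℝ (Fin n))
      (fun x : M ↦ TangentSpace (𝓡 n) x)]
  (hn : 0 < n) (hQ : IsQuaternionicKahler nabla Q) (hμ : IsMomentSection nabla Q X μ)
  (hLC : IsLeviCivita nabla)
include hn hQ hμ hLC

lemma contMDiffOn_momentForm (hX : SmoothVOn X univ) {Y : VField n M} {W : Set M}
    (hW : W ⊆ nonzeroSet μ) (hY : SmoothVOn Y W) :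
    ContMDiffOn (𝓡 n) 𝓘(ℝ, ℝ) ∞ (fun y ↦ momentFormL μ y (Y y)) W := by
  have h1 : ContMDiffOn (𝓡 n) 𝓘(ℝ, ℝ) ∞ (fun y ↦ (momentNorm μ y ^ 2)⁻¹) W :=
    (contMDiff_momentNorm_sq hn hQ hμ).contMDiffOn.inv₀ fun x hx ↦
      momentNorm_sq_ne_zero hn hQ hμ.mem (hW hx)
  have h2 := ((hμ.smooth.apply hX).mono (subset_univ W)).inner hY
  refine ((contMDiffOn_const (c := (-(1 / 2) : ℝ))).mul (h1.mul h2)).congr fun x hx ↦ ?_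
  rw [momentFormL_apply, momentForm_apply hn hQ hμ hLC (hW hx)]
  rfl

/-- The chosen triples need not vary smoothly, but near each point they may be replaced by a smooth
local triple without changing the tensor. -/
lemma smoothVOn_modTensor (hX : SmoothVOn X univ) {Y Z : VField n M} {W : Set M} (hWo : IsOpen W)
    (hW : W ⊆ nonzeroSet μ) (hY : SmoothVOn Y W) (hZ : SmoothVOn Z W) :
    SmoothVOn (fun y ↦ modTensor Q μ y (Y y) (Z y)) W := by
  intro x hx
  obtain ⟨U, hU, hxU, I, J, K, sI, sJ, sK, h⟩ := hQ.almostQuaternionic x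
  have hN : W ∩ U ∈ 𝓝 x := Filter.inter_mem (hWo.mem_nhds hx) (hU.mem_nhds hxU)
  suffices hs : SmoothVOn (fun y ↦ modTensor Q μ y (Y y) (Z y)) (W ∩ U) from
    (hs.contMDiffAt hN).contMDiffWithinAt
  have hα : ∀ {T S : VField n M}, SmoothVOn T (W ∩ U) → SmoothVOn S (W ∩ U) →
      SmoothVOn (fun y ↦ momentFormL μ y (T y) • S y) (W ∩ U) := fun hT hS ↦ SmoothVOn.smul
    (contMDiffOn_momentForm hn hQ hμ hLC hX (inter_subset_left.trans hW) hT) hS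
  replace hY := hY.mono (inter_subset_left : W ∩ U ⊆ W)
  replace hZ := hZ.mono (inter_subset_left : W ∩ U ⊆ W)
  replace sI := sI.mono (inter_subset_right : W ∩ U ⊆ U)
  replace sJ := sJ.mono (inter_subset_right : W ∩ U ⊆ U)
  replace sK := sK.mono (inter_subset_right : W ∩ U ⊆ U)
  have := (((((((hα hZ hY).add (hα hY hZ)).sub (hα (sI.apply hY) (sI.apply hZ))).sub
    (hα (sI.apply hZ) (sI.apply hY))).sub (hα (sJ.apply hY) (sJ.apply hZ))).sub
    (hα (sJ.apply hZ) (sJ.apply hY))).sub (hα (sK.apply hY) (sK.apply hZ))).sub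
    (hα (sK.apply hZ) (sK.apply hY))
  refine this.congr fun y hy ↦ ?_
  rw [modTensor_eq hn (h y hy.2).1 (h y hy.2).2, oneForm_apply]

lemma isAffineConnectionOn_modConn (hX : SmoothVOn X univ) :
    IsAffineConnectionOn (modConn nabla Q μ) (nonzeroSet μ) := by
  have hU := isOpen_nonzeroSet hn hQ hμ
  have hD := hLC.conn.mono isOpen_univ hU (subset_univ _)
  refine ⟨hD.isCov.add_one_form (modTensor Q μ), ⟨fun {Y} hY ↦ ?_⟩⟩
  have hY' : SmoothVOn Y (nonzeroSet μ) := hY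
  refine ContMDiffOn.add_section (hLC.conn.smoothEndOn isOpen_univ hU (subset_univ _) hY') ?_
  exact smoothEndOn_of_apply hU fun W hW hWo Z hZ ↦
    smoothVOn_modTensor hn hQ hμ hLC hX hWo hW (hY'.mono hW) hZ

omit hμ in
-- The difference tensor is symmetric, so the torsion is that of the Levi-Civita connection.
lemma isTorsionFreeOn_modConn : IsTorsionFreeOn (modConn nabla Q μ) (nonzeroSet μ) := by
  intro x hx Y Z hY hZ
  obtain ⟨U, -, hxU, I, J, K, -, -, -, h⟩ := hQ.almostQuaternionic x
  rw [← hLC.torsionFree x (mem_univ x) Y Z hY hZ, modConn_apply, modConn_apply,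
    modTensor_eq hn (h x hxU).1 (h x hxU).2, oneForm_symm]
  abel

omit hμ hLC in
-- By `oneForm_comb` the added operators normalize Q. The particular form of α plays no role here.
lemma preservesOn_modConn : PreservesOn (modConn nabla Q μ) Q (nonzeroSet μ) := by
  intro x hx A hA z
  obtain ⟨B, hB, hd⟩ := hQ.parallel x (mem_univ x) A hA z
  obtain ⟨N, hN, -, hAQ⟩ := hA
  obtain ⟨U, -, hxU, I, J, K, -, -, -, h⟩ := hQ.almostQuaternionic x
  have hq : QTriple (I x) (J x) (K x) := (h x hxU).1
  have hs := (h x hxU).2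
  have hAx := hAQ x (mem_of_mem_nhds hN)
  rw [hs] at hAx
  obtain ⟨a, b, c, e⟩ := QTriple.mem_span_iff.1 hAx
  have hex : ∃ C ∈ Q x, ∀ v, oneForm (momentFormL μ x) (I x) (J x) (K x) (A x v) z =
      C v + A x (oneForm (momentFormL μ x) (I x) (J x) (K x) v z) := by
    rw [e, hs]
    exact ⟨_, QTriple.mem_span_iff.2 ⟨_, _, _, rfl⟩, fun v ↦ hq.oneForm_comb _ a b c v z⟩
  obtain ⟨C, hC, hCv⟩ := hex
  refine ⟨B + C, (Q x).add_mem hB hC, fun Y hY ↦ ?_⟩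
  rw [modConn_apply, modConn_apply, hd Y hY, modTensor_eq hn hq hs, hCv, _root_.add_apply, map_add]
  abel

lemma mvfderiv_momentNorm_inv {x : M} (hx : x ∈ nonzeroSet μ) (z : TangentSpace (𝓡 n) x) :
    mvfderiv (𝓡 n) (fun y ↦ (momentNorm μ y)⁻¹) x z =
      -((momentNorm μ x ^ 2)⁻¹ * (inner ℝ (momentStructure μ x (X x)) z : ℝ)) := by
  have hp := momentNorm_pos hn hQ hμ.mem hx
  have h0 : momentNorm μ x ^ 2 ≠ 0 := by positivity
  have h2 : HasDerivAt (fun t ↦ (√t)⁻¹) (-(1 / (2 * √(momentNorm μ x ^ 2))) /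
      √(momentNorm μ x ^ 2) ^ 2) (momentNorm μ x ^ 2) :=
    (Real.hasDerivAt_sqrt h0).inv (by rw [Real.sqrt_sq hp.le]; exact hp.ne')
  have h1 : (fun y ↦ (momentNorm μ y)⁻¹) = fun y ↦ (√(momentNorm μ y ^ 2))⁻¹ :=
    funext fun y ↦ by rw [Real.sqrt_sq (x := momentNorm μ y) (Real.sqrt_nonneg _)]
  rw [h1, mvfderiv_comp_real (f := fun y ↦ momentNorm μ y ^ 2) h2
    ((contMDiff_momentNorm_sq hn hQ hμ).mdifferentiable (by simp) x),
    mvfderiv_momentNorm_sq hn hQ hμ hLC, Real.sqrt_sq hp.le, momentStructure, _root_.smul_apply,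
    real_inner_smul_left]
  field_simp

/-- In a triple adapted to I_μ, the component of ∇μ along I_μ is d|μ|, which the derivative of the
factor |μ|⁻¹ removes. Only the J and K components remain. -/
lemma isEndDeriv_momentStructure {x : M} (hx : x ∈ nonzeroSet μ)
    {J K : TangentSpace (𝓡 n) x →L[ℝ] TangentSpace (𝓡 n) x}
    (h : QTriple (momentStructure μ x) J K)
    (hs : Q x = Submodule.span ℝ {momentStructure μ x, J, K}) (z : TangentSpace (𝓡 n) x) :
    IsEndDeriv nabla (momentStructure μ) x z ((momentNorm μ x)⁻¹ •
      ((inner ℝ (J (X x)) z : ℝ) • J + (inner ℝ (K (X x)) z : ℝ) • K)) := by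
  have hp := momentNorm_pos hn hQ hμ.mem hx
  have mI : momentStructure μ x ∈ Q x := hs ▸ Submodule.subset_span (by simp)
  have mJ : J ∈ Q x := hs ▸ Submodule.subset_span (by simp)
  have mK : K ∈ Q x := hs ▸ Submodule.subset_span (by simp)
  have h1 := (hμ.deriv_eq x _ mI J mJ K mK h z).smul hLC.conn (mem_univ x)
    (f := fun y ↦ (momentNorm μ y)⁻¹)
    ((((contMDiffOn_momentNorm hn hQ hμ).inv₀ fun x hx ↦
      (momentNorm_pos hn hQ hμ.mem hx).ne').contMDiffAt
      ((isOpen_nonzeroSet hn hQ hμ).mem_nhds hx)).mdifferentiableAt (by simp))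
    Filter.univ_mem hμ.smooth
  rw [mvfderiv_momentNorm_inv hn hQ hμ hLC hx] at h1
  have h2 : μ x = momentNorm μ x • momentStructure μ x := by
    rw [momentStructure, smul_smul, mul_inv_cancel₀ hp.ne', one_smul]
  have h3 : (momentNorm μ x)⁻¹ • ((inner ℝ (J (X x)) z : ℝ) • J + (inner ℝ (K (X x)) z : ℝ) • K) =
      (momentNorm μ x)⁻¹ • ((inner ℝ (momentStructure μ x (X x)) z : ℝ) • momentStructure μ x
        + (inner ℝ (J (X x)) z : ℝ) • J + (inner ℝ (K (X x)) z : ℝ) • K)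
        + -((momentNorm μ x ^ 2)⁻¹ * (inner ℝ (momentStructure μ x (X x)) z : ℝ)) • μ x := by
    have h4 : (momentNorm μ x ^ 2)⁻¹ * (inner ℝ (momentStructure μ x (X x)) z : ℝ)
        * momentNorm μ x = (momentNorm μ x)⁻¹ * (inner ℝ (momentStructure μ x (X x)) z : ℝ) := by
      field_simp
    generalize momentStructure μ x = S at *
    rw [h2, smul_smul, neg_mul, h4]
    module
  rw [h3]
  exact h1

/-- Here the choice of α enters. Since α = −½|μ|⁻¹ g(I_μX, ·), skewness gives 2α(Jz) = −|μ|⁻¹ g(KX,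
z) and 2α(Kz) = |μ|⁻¹ g(JX, z). Thus the terms of `oneForm_I` are exactly the negative of the
Levi-Civita derivative of I_μ. -/
lemma isParallelEndOn_modConn :
    IsParallelEndOn (modConn nabla Q μ) (momentStructure μ) (nonzeroSet μ) := by
  intro x hx z Y hY
  obtain ⟨J, K, h, hs⟩ := exists_adapted_triple hn hQ hμ.mem hx
  have hp := momentNorm_pos hn hQ hμ.mem hx
  have hd := isEndDeriv_momentStructure hn hQ hμ hLC hx h hs z Y hY
  have mJ : J ∈ Q x := hs ▸ Submodule.subset_span (by simp)
  have mK : K ∈ Q x := hs ▸ Submodule.subset_span (by simp)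
  have h2 : μ x = momentNorm μ x • momentStructure μ x := by
    rw [momentStructure, smul_smul, mul_inv_cancel₀ hp.ne', one_smul]
  have e : ∀ w, momentFormL μ x w =
      -(1 / 2) * ((momentNorm μ x)⁻¹ * inner ℝ (momentStructure μ x (X x)) w) := by
    intro w
    rw [momentFormL_apply, momentForm_apply hn hQ hμ hLC hx]
    have h3 : μ x (X x) = momentNorm μ x • momentStructure μ x (X x) :=
      congrArg (fun L ↦ L (X x)) h2
    rw [h3, real_inner_smul_left]
    field_simp
  have eJ : momentFormL μ x (J z) = -(1 / 2) * ((momentNorm μ x)⁻¹ * inner ℝ (K (X x)) z) := by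
    have := hQ.skew x J mJ (momentStructure μ x (X x)) z
    rw [h.J_I, inner_neg_left] at this
    rw [e, neg_injective this]
  have eK : momentFormL μ x (K z) = (1 / 2) * ((momentNorm μ x)⁻¹ * inner ℝ (J (X x)) z) := by
    have := hQ.skew x K mK (momentStructure μ x (X x)) z
    rw [h.K_I] at this
    rw [e, this]
    ring
  rw [modConn_apply, modConn_apply, hd, modTensor_eq hn h hs, h.oneForm_I, map_add, eJ, eK]
  simp only [_root_.add_apply, _root_.smul_apply, _root_.zero_apply]
  module

omit hμ hLC in
lemma modConn_eq_modified {x : M} {I J K : TangentSpace (𝓡 n) x →L[ℝ] TangentSpace (𝓡 n) x}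
    (hI : I ∈ Q x) (hJ : J ∈ Q x) (hK : K ∈ Q x) (h : QTriple I J K) (Y : VField n M)
    (Z : TangentSpace (𝓡 n) x) :
    modConn nabla Q μ Y x Z = modified (momentForm μ x) I J K (nabla Y x Z) (Y x) Z := by
  rw [modConn_apply, modTensor_eq hn h (hQ.span_eq hn h hI hJ hK), oneForm_apply]
  simp only [momentFormL_apply, modified]
  abel

omit hLC in
-- Two connections differ by a tensor Δ. Vanishing torsion makes Δ symmetric, a parallel I_μ makes
-- it commute with I_μ, and preservation of Q supplies the last hypothesis of `eq_zero_of_symm`.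
lemma eq_of_preservesOn {D D' : ConnOp n M} (hD : IsAffineConnectionOn D (nonzeroSet μ))
    (hT : IsTorsionFreeOn D (nonzeroSet μ)) (hP : PreservesOn D Q (nonzeroSet μ))
    (hI : IsParallelEndOn D (momentStructure μ) (nonzeroSet μ))
    (hD' : IsAffineConnectionOn D' (nonzeroSet μ))
    (hT' : IsTorsionFreeOn D' (nonzeroSet μ)) (hP' : PreservesOn D' Q (nonzeroSet μ))
    (hI' : IsParallelEndOn D' (momentStructure μ) (nonzeroSet μ))
    {x : M} (hx : x ∈ nonzeroSet μ) {Y : VField n M} (hY : DiffVAt Y x) : D' Y x = D Y x := by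
  have hU := (isOpen_nonzeroSet hn hQ hμ).mem_nhds hx
  set Δ := hD'.isCov.difference hD.isCov x with hΔ
  have eΔ : ∀ Y : VField n M, DiffVAt Y x → Δ (Y x) = D' Y x - D Y x := fun Y hY ↦
    hD'.isCov.difference_apply hD.isCov hx hY
  have eΔ' : ∀ v w, Δ v w = D' (ext v) x w - D (ext v) x w := by
    intro v w
    have := eΔ (ext v) (ext_diffVAt v)
    rw [ext_self] at this
    rw [this]
    rfl
  obtain ⟨J, K, h, hs⟩ := exists_adapted_triple hn hQ hμ.mem hx
  have key : Δ = 0 := by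
    refine h.eq_zero_of_symm (fun v w ↦ ?_) (fun v w ↦ ?_) (fun w ↦ ?_)
    · have h1 := hT x hx (ext v) (ext w) (ext_diffVAt v) (ext_diffVAt w)
      have h2 := hT' x hx (ext v) (ext w) (ext_diffVAt v) (ext_diffVAt w)
      rw [← h1] at h2
      simp only [ext_self] at h2
      rw [eΔ', eΔ']
      linear_combination (norm := module) -h2
    · have dI := (smoothEndOn_momentStructure hn hQ hμ).diffVAt hU (ext_diffVAt v)
      have h1 := hI x hx w (ext v) (ext_diffVAt v)
      have h2 := hI' x hx w (ext v) (ext_diffVAt v)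
      have h3 := congrArg (fun L ↦ L w) (eΔ _ dI)
      simp only [ext_self, _root_.sub_apply, h1, h2, _root_.zero_apply, zero_add] at h3
      rw [h3, eΔ', map_sub]
    -- Preservation of Q concerns sections, so J is extended to a section A of Q before the two
    -- derivatives are subtracted.
    · obtain ⟨A, hA, hAQ, hAx⟩ := hQ.almostQuaternionic.exists_section
        (B := J) (x := x) (hs ▸ Submodule.subset_span (by simp))
      obtain ⟨B, hB, h1⟩ := hP x hx A ⟨univ, Filter.univ_mem, hA, fun y _ ↦ hAQ y⟩ w
      obtain ⟨B', hB', h1'⟩ := hP' x hx A ⟨univ, Filter.univ_mem, hA, fun y _ ↦ hAQ y⟩ w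
      refine ⟨B' - B, hs ▸ (Q x).sub_mem hB' hB, fun v ↦ ?_⟩
      have dA := hA.diffVAt Filter.univ_mem (ext_diffVAt v)
      have h3 := congrArg (fun L ↦ L w) (eΔ _ dA)
      simp only [ext_self, _root_.sub_apply, h1 _ (ext_diffVAt v), h1' _ (ext_diffVAt v), hAx] at h3
      rw [h3, eΔ', map_sub, _root_.sub_apply]
      abel
  have := eΔ Y hY
  rw [key] at this
  exact (sub_eq_zero.1 (by simpa using this.symm))

end Modified

/-! ### Integrability from a torsion-free connection -/

section Integrable

variable {n : ℕ} {M : Type*} [TopologicalSpace M] [ChartedSpace (EuclideanSpace ℝ (Fin n)) M]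
  [IsManifold (𝓡 n) ∞ M]

/-- An almost complex structure parallel for a torsion-free connection is integrable. -/
lemma isIntegrableOn_of_parallel {D : ConnOp n M} {I : EndField n M} {U : Set M} (hU : IsOpen U)
    (hT : IsTorsionFreeOn D U) (hs : SmoothEndOn I U) (hI : IsParallelEndOn D I U)
    (hsq : ∀ x ∈ U, ∀ v, I x (I x v) = -v) : IsIntegrableOn I U := by
  intro Y Z hY hZ x hx
  have dY := hY.diffVAt (hU.mem_nhds hx)
  have dZ := hZ.diffVAt (hU.mem_nhds hx)
  have dIY := hs.diffVAt (hU.mem_nhds hx) dY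
  have dIZ := hs.diffVAt (hU.mem_nhds hx) dZ
  -- Torsion-freeness turns all four brackets into covariant derivatives. As I is parallel it can be
  -- pulled out, and I² = −1 cancels the terms in pairs.
  rw [← hT x hx _ _ dIY dIZ, ← hT x hx _ _ dIY dZ, ← hT x hx _ _ dY dIZ, ← hT x hx _ _ dY dZ]
  simp only [hI x hx _ Y dY, hI x hx _ Z dZ, _root_.zero_apply, zero_add, map_sub, hsq x hx]
  abel

end Integrable

/-! ### Covariant derivatives along curves -/

lemma eq_of_hasDerivWithinAt_zero {f : ℝ → ℝ}
    (h : ∀ t ∈ Icc (0 : ℝ) 1, HasDerivWithinAt f 0 (Icc 0 1) t) {t : ℝ} (ht : t ∈ Icc (0 : ℝ) 1) :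
    f t = f 0 := by
  refine constant_of_has_deriv_right_zero (fun t ht ↦ (h t ht).continuousWithinAt)
    (fun t ht ↦ ?_) t ht
  exact (h t ⟨ht.1, ht.2.le⟩).mono_of_mem_nhdsWithin (Icc_mem_nhdsGE_of_mem ht)

section Along

variable {n : ℕ} {M : Type*} [TopologicalSpace M] [ChartedSpace (EuclideanSpace ℝ (Fin n)) M]
  [IsManifold (𝓡 n) ∞ M]

/-- The velocity of a curve on `[0, 1]`. -/
abbrev velocity (γ : ℝ → M) (t : ℝ) : TangentSpace (𝓡 n) (γ t) :=
  mfderivWithin 𝓘(ℝ, ℝ) (𝓡 n) γ (Icc 0 1) t (1 : ℝ)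

/-- `v'` is the covariant derivative of the field `V` along `γ` at the time `t`. -/
def HasCovDeriv (D : ConnOp n M) (γ : ℝ → M) (V : ∀ t : ℝ, TangentSpace (𝓡 n) (γ t)) (t : ℝ)
    (v' : TangentSpace (𝓡 n) (γ t)) : Prop :=
  ∃ w : EuclideanSpace ℝ (Fin n),
    HasDerivWithinAt
      (fun s ↦ (trivializationAt (EuclideanSpace ℝ (Fin n))
        (TangentSpace (𝓡 n) : M → Type _) (γ t) ⟨γ s, V s⟩).2) w (Icc 0 1) t ∧
    (trivializationAt (EuclideanSpace ℝ (Fin n))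
        (TangentSpace (𝓡 n) : M → Type _) (γ t)).symm (γ t) w
      + D (ext (V t)) (γ t) (velocity γ t) = v'

lemma hasDerivWithinAt_comp_curve {F : Type*} [NormedAddCommGroup F] [NormedSpace ℝ F] {γ : ℝ → M}
    {t : ℝ} (hγ : MDifferentiableWithinAt 𝓘(ℝ, ℝ) (𝓡 n) γ (Icc 0 1) t)
    {f : M → F} (hf : MDifferentiableAt (𝓡 n) 𝓘(ℝ, F) f (γ t)) :
    HasDerivWithinAt (fun s ↦ f (γ s)) (mvfderiv (𝓡 n) f (γ t) (velocity γ t)) (Icc 0 1) t := by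
  have h1 := hf.hasMFDerivAt.comp_hasMFDerivWithinAt t hγ.hasMFDerivWithinAt
  have h2 : HasFDerivWithinAt (fun s ↦ f (γ s)) ((mvfderiv (𝓡 n) f (γ t)).comp
      (mfderivWithin 𝓘(ℝ, ℝ) (𝓡 n) γ (Icc 0 1) t)) (Icc 0 1) t :=
    hasMFDerivWithinAt_iff_hasFDerivWithinAt.1 h1
  exact h2.hasDerivWithinAt

variable {D : ConnOp n M} {U : Set M} {x : M}

lemma DiffVAt.sum {ι : Type*} (S : Finset ι) {Y : ι → VField n M}
    (hY : ∀ i ∈ S, DiffVAt (Y i) x) : DiffVAt (fun y ↦ ∑ i ∈ S, Y i y) x := by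
  classical
  induction S using Finset.induction_on with
  | empty =>
    simp only [Finset.sum_empty]
    exact (mdifferentiableAt_zeroSection ..)
  | insert a S ha ih =>
    simp only [Finset.sum_insert ha]
    exact (hY a (by simp)).add (ih fun i hi ↦ hY i (by simp [hi]))

lemma IsAffineConnectionOn.sum (hD : IsAffineConnectionOn D U) (hx : x ∈ U) {ι : Type*}
    (S : Finset ι) {Y : ι → VField n M} (hY : ∀ i ∈ S, DiffVAt (Y i) x)
    (z : TangentSpace (𝓡 n) x) :
    D (fun y ↦ ∑ i ∈ S, Y i y) x z = ∑ i ∈ S, D (Y i) x z := by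
  classical
  induction S using Finset.induction_on with
  | empty =>
    simp only [Finset.sum_empty]
    have := hD.isCov.zero (x := x) hx
    exact congrArg (fun L ↦ L z) this
  | insert a S ha ih =>
    simp only [Finset.sum_insert ha]
    rw [hD.add hx (hY a (by simp)) (DiffVAt.sum S fun i hi ↦ hY i (by simp [hi])),
      ih fun i hi ↦ hY i (by simp [hi])]

lemma ext_sum {ι : Type*} (S : Finset ι) (c : ι → ℝ) (v : ι → TangentSpace (𝓡 n) x) {y : M}
    (hy : y ∈ (trivializationAt (EuclideanSpace ℝ (Fin n))
      (TangentSpace (𝓡 n) : M → Type _) x).baseSet) :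
    ext (∑ i ∈ S, c i • v i) y = ∑ i ∈ S, c i • ext (v i) y := by
  set e := trivializationAt (EuclideanSpace ℝ (Fin n)) (TangentSpace (𝓡 n) : M → Type _) x
  have hx : x ∈ e.baseSet := FiberBundle.mem_baseSet_trivializationAt' x
  have h1 : ∀ v : TangentSpace (𝓡 n) x, ext v y = e.symmL ℝ y (e.continuousLinearMapAt ℝ x v) := by
    intro v
    rw [Trivialization.continuousLinearMapAt_apply_of_mem ℝ e hx, e.symmL_apply hy]
    rfl
  simp only [h1, map_sum, map_smul]

lemma IsAffineConnectionOn.ext_sum (hD : IsAffineConnectionOn D U) (hU : U ∈ 𝓝 x) {ι : Type*}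
    (S : Finset ι) (c : ι → ℝ) (v : ι → TangentSpace (𝓡 n) x) (z : TangentSpace (𝓡 n) x) :
    D (ext (∑ i ∈ S, c i • v i)) x z = ∑ i ∈ S, c i • D (ext (v i)) x z := by
  have hx := mem_of_mem_nhds hU
  have hd : ∀ i ∈ S, DiffVAt (fun y ↦ c i • ext (v i) y) x := fun i _ ↦
    (ext_diffVAt (v i)).smul (f := fun _ ↦ c i) mdifferentiableAt_const
  rw [hD.congr hU (DiffVAt.sum S hd) (by
    filter_upwards [(trivializationAt (EuclideanSpace ℝ (Fin n))
      (TangentSpace (𝓡 n) : M → Type _) x).open_baseSet.mem_nhds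
        (FiberBundle.mem_baseSet_trivializationAt' x)] with y hy
    exact QK.ext_sum S c v hy), hD.sum hx S hd]
  exact Finset.sum_congr rfl fun i _ ↦ hD.const_smul hx (c i) (ext_diffVAt (v i)) z

/-- The frame with constant components in the trivialization at `x`. -/
def triFrame (x : M) (a : Fin n) : VField n M :=
  ext ((trivializationAt (EuclideanSpace ℝ (Fin n)) (TangentSpace (𝓡 n) : M → Type _) x).symm x
    (EuclideanSpace.basisFun (Fin n) ℝ a))

lemma diffVAt_triFrame (x : M) (a : Fin n) : DiffVAt (triFrame x a) x := ext_diffVAt _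

lemma eq_sum_triFrame {x y : M} (hy : y ∈ (trivializationAt (EuclideanSpace ℝ (Fin n))
      (TangentSpace (𝓡 n) : M → Type _) x).baseSet) (v : TangentSpace (𝓡 n) y) :
    v = ∑ a, ((trivializationAt (EuclideanSpace ℝ (Fin n))
      (TangentSpace (𝓡 n) : M → Type _) x) ⟨y, v⟩).2 a • triFrame x a y := by
  set e := trivializationAt (EuclideanSpace ℝ (Fin n)) (TangentSpace (𝓡 n) : M → Type _) x with he
  have hx : x ∈ e.baseSet := FiberBundle.mem_baseSet_trivializationAt' x
  have h1 : ∀ a, triFrame x a y = e.symmL ℝ y (EuclideanSpace.basisFun (Fin n) ℝ a) := by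
    intro a
    simp [triFrame, FiberBundle.extend, ← he, hx, hy]
  simp only [h1, ← map_smul, ← map_sum]
  have h2 := (EuclideanSpace.basisFun (Fin n) ℝ).sum_repr (e ⟨y, v⟩).2
  simp only [EuclideanSpace.basisFun_repr] at h2
  rw [h2]
  simp [hy]

lemma symm_eq_sum_triFrame (x : M) (w : EuclideanSpace ℝ (Fin n)) :
    (trivializationAt (EuclideanSpace ℝ (Fin n)) (TangentSpace (𝓡 n) : M → Type _) x).symm x w =
      ∑ a, w a • triFrame x a x := by
  set e := trivializationAt (EuclideanSpace ℝ (Fin n)) (TangentSpace (𝓡 n) : M → Type _) x with he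
  have hx : x ∈ e.baseSet := FiberBundle.mem_baseSet_trivializationAt' x
  have := eq_sum_triFrame (x := x) hx (e.symm x w)
  rw [← he] at this
  conv_lhs => rw [this]
  simp [hx]

/-- The covariant derivative in terms of components in the trivialization. -/
lemma IsAffineConnectionOn.eq_symm_add (hD : IsAffineConnectionOn D U) (hU : U ∈ 𝓝 x)
    {Y : VField n M} (hY : DiffVAt Y x) (z : TangentSpace (𝓡 n) x) :
    MDifferentiableAt (𝓡 n) 𝓘(ℝ, EuclideanSpace ℝ (Fin n)) (fun y ↦ (trivializationAt
      (EuclideanSpace ℝ (Fin n)) (TangentSpace (𝓡 n) : M → Type _) x ⟨y, Y y⟩).2) x ∧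
    D Y x z = (trivializationAt (EuclideanSpace ℝ (Fin n))
      (TangentSpace (𝓡 n) : M → Type _) x).symm x (mvfderiv (𝓡 n) (fun y ↦ (trivializationAt
      (EuclideanSpace ℝ (Fin n)) (TangentSpace (𝓡 n) : M → Type _) x ⟨y, Y y⟩).2) x z)
      + D (ext (Y x)) x z := by
  set e := trivializationAt (EuclideanSpace ℝ (Fin n)) (TangentSpace (𝓡 n) : M → Type _) x with he
  have hx : x ∈ e.baseSet := FiberBundle.mem_baseSet_trivializationAt' x
  have hxU := mem_of_mem_nhds hU
  have hF : MDifferentiableAt (𝓡 n) 𝓘(ℝ, EuclideanSpace ℝ (Fin n)) (fun y ↦ (e ⟨y, Y y⟩).2) x :=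
    (mdifferentiableAt_section ..).1 hY
  refine ⟨hF, ?_⟩
  have hFa : ∀ a, MDifferentiableAt (𝓡 n) 𝓘(ℝ, ℝ) (fun y ↦ (e ⟨y, Y y⟩).2 a) x ∧
      mvfderiv (𝓡 n) (fun y ↦ (e ⟨y, Y y⟩).2 a) x z =
        (mvfderiv (𝓡 n) (fun y ↦ (e ⟨y, Y y⟩).2) x z) a := by
    intro a
    have h1 := (EuclideanSpace.proj (𝕜 := ℝ) (ι := Fin n) a).hasMFDerivAt
      (x := (e ⟨x, Y x⟩).2)
    have h2 := h1.comp x hF.hasMFDerivAt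
    refine ⟨h2.mdifferentiableAt, ?_⟩
    exact congrArg (fun L ↦ L z) h2.mfderiv
  have h1 : D Y x = D (fun y ↦ ∑ a, (e ⟨y, Y y⟩).2 a • triFrame x a y) x := by
    refine hD.congr hU (DiffVAt.sum _ fun a _ ↦ (diffVAt_triFrame x a).smul (hFa a).1) ?_
    filter_upwards [e.open_baseSet.mem_nhds hx] with y hy
    exact eq_sum_triFrame hy (Y y)
  rw [h1, hD.sum hxU _ fun a _ ↦ (diffVAt_triFrame x a).smul (hFa a).1]
  have h2 : D (ext (Y x)) x z = ∑ a, (e ⟨x, Y x⟩).2 a • D (triFrame x a) x z := by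
    conv_lhs => rw [eq_sum_triFrame hx (Y x)]
    rw [hD.ext_sum hU]
    refine Finset.sum_congr rfl fun a _ ↦ ?_
    rw [triFrame, ext_self]
  rw [h2, symm_eq_sum_triFrame, ← Finset.sum_add_distrib]
  refine Finset.sum_congr rfl fun a _ ↦ ?_
  rw [hD.smul hxU (hFa a).1 (diffVAt_triFrame x a), (hFa a).2, add_comm]

variable {γ : ℝ → M} {t : ℝ}

lemma HasCovDeriv.unique {V : ∀ t : ℝ, TangentSpace (𝓡 n) (γ t)} {v v' : TangentSpace (𝓡 n) (γ t)}
    (ht : t ∈ Icc (0 : ℝ) 1) (h : HasCovDeriv D γ V t v) (h' : HasCovDeriv D γ V t v') :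
    v = v' := by
  obtain ⟨w, hw, e⟩ := h
  obtain ⟨w', hw', e'⟩ := h'
  rw [← e, ← e', (uniqueDiffOn_Icc zero_lt_one t ht).eq_deriv _ hw hw']

/-- The definition uses the trivialization at γ t; this computes the same derivative from arbitrary
differentiable fields on M, by expanding each of them in the trivialization. -/
lemma hasCovDeriv_sum (hD : IsAffineConnectionOn D U) (hU : U ∈ 𝓝 (γ t))
    (hγ : MDifferentiableWithinAt 𝓘(ℝ, ℝ) (𝓡 n) γ (Icc 0 1) t) (ht : t ∈ Icc (0 : ℝ) 1)
    {ι : Type*} [Fintype ι] {V : ∀ t : ℝ, TangentSpace (𝓡 n) (γ t)} {f : ι → ℝ → ℝ} {f' : ι → ℝ}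
    {Y : ι → VField n M} (hf : ∀ a, HasDerivWithinAt (f a) (f' a) (Icc 0 1) t)
    (hY : ∀ a, DiffVAt (Y a) (γ t))
    (hV : ∀ᶠ s in 𝓝[Icc 0 1] t, V s = ∑ a, f a s • Y a (γ s)) :
    HasCovDeriv D γ V t
      (∑ a, (f' a • Y a (γ t) + f a t • D (Y a) (γ t) (velocity γ t))) := by
  set e := trivializationAt (EuclideanSpace ℝ (Fin n)) (TangentSpace (𝓡 n) : M → Type _) (γ t)
    with he
  have hx : γ t ∈ e.baseSet := FiberBundle.mem_baseSet_trivializationAt' (γ t)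
  have hVt := hV.self_of_nhdsWithin ht
  have hC := fun a ↦ hD.eq_symm_add hU (hY a) (velocity γ t)
  rw [← he] at hC
  have hd : ∀ a, HasDerivWithinAt (fun s ↦ f a s • (e ⟨γ s, Y a (γ s)⟩).2)
      (f a t • mvfderiv (𝓡 n) (fun y ↦ (e ⟨y, Y a y⟩).2) (γ t) (velocity γ t)
        + f' a • (e ⟨γ t, Y a (γ t)⟩).2) (Icc 0 1) t := fun a ↦
    (hf a).smul (hasDerivWithinAt_comp_curve hγ (hC a).1)
  have hs := HasDerivWithinAt.fun_sum (u := Finset.univ) fun a _ ↦ hd a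
  refine ⟨_, hs.congr_of_eventuallyEq ?_ ?_, ?_⟩
  · have : ∀ᶠ s in 𝓝[Icc 0 1] t, γ s ∈ e.baseSet :=
      hγ.continuousWithinAt (e.open_baseSet.mem_nhds hx)
    filter_upwards [this, hV] with s hs hVs
    rw [hVs, ← he]
    have h1 : ∀ v, (e ⟨γ s, v⟩).2 = e.continuousLinearMapAt ℝ (γ s) v := by
      intro v
      rw [Trivialization.continuousLinearMapAt_apply_of_mem ℝ e hs]
    simp only [h1, map_sum, map_smul]
  · rw [hVt, ← he]
    have h1 : ∀ v, (e ⟨γ t, v⟩).2 = e.continuousLinearMapAt ℝ (γ t) v := by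
      intro v
      rw [Trivialization.continuousLinearMapAt_apply_of_mem ℝ e hx]
    simp only [h1, map_sum, map_smul]
  · rw [hVt, hD.ext_sum hU, ← he]
    have h1 : ∀ w, e.symm (γ t) w = e.symmL ℝ (γ t) w := fun w ↦ (e.symmL_apply hx w).symm
    have h2 : ∀ v, e.symmL ℝ (γ t) (e ⟨γ t, v⟩).2 = v := by
      intro v
      simp [hx]
    simp only [h1] at hC ⊢
    rw [map_sum, ← Finset.sum_add_distrib]
    refine Finset.sum_congr rfl fun a _ ↦ ?_
    rw [(hC a).2, map_add, map_smul, map_smul, h2]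
    module

/-- The coordinate frame of the trivialization serves. With `hasCovDeriv_sum` it reduces every
product rule along γ to the corresponding rule for fields on M. -/
lemma HasCovDeriv.exists_frame (hD : IsAffineConnectionOn D U) (hU : U ∈ 𝓝 (γ t))
    (hγ : MDifferentiableWithinAt 𝓘(ℝ, ℝ) (𝓡 n) γ (Icc 0 1) t) (ht : t ∈ Icc (0 : ℝ) 1)
    {V : ∀ t : ℝ, TangentSpace (𝓡 n) (γ t)} {v' : TangentSpace (𝓡 n) (γ t)}
    (h : HasCovDeriv D γ V t v') :
    ∃ (f : Fin n → ℝ → ℝ) (f' : Fin n → ℝ) (Y : Fin n → VField n M),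
      (∀ a, HasDerivWithinAt (f a) (f' a) (Icc 0 1) t) ∧ (∀ a, DiffVAt (Y a) (γ t)) ∧
      (∀ᶠ s in 𝓝[Icc 0 1] t, V s = ∑ a, f a s • Y a (γ s)) ∧
      v' = ∑ a, (f' a • Y a (γ t) + f a t • D (Y a) (γ t) (velocity γ t)) := by
  obtain ⟨w, hw, e'⟩ := id h
  set e := trivializationAt (EuclideanSpace ℝ (Fin n)) (TangentSpace (𝓡 n) : M → Type _) (γ t)
    with he
  have hx : γ t ∈ e.baseSet := FiberBundle.mem_baseSet_trivializationAt' (γ t)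
  have h1 : ∀ a, HasDerivWithinAt (fun s ↦ (e ⟨γ s, V s⟩).2 a) (w a) (Icc 0 1) t := fun a ↦
    (EuclideanSpace.proj (𝕜 := ℝ) (ι := Fin n) a).hasFDerivAt.comp_hasDerivWithinAt t hw
  have h2 : ∀ᶠ s in 𝓝[Icc 0 1] t, V s = ∑ a, (e ⟨γ s, V s⟩).2 a • triFrame (γ t) a (γ s) := by
    have : ∀ᶠ s in 𝓝[Icc 0 1] t, γ s ∈ e.baseSet :=
      hγ.continuousWithinAt (e.open_baseSet.mem_nhds hx)
    filter_upwards [this] with s hs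
    exact eq_sum_triFrame hs (V s)
  exact ⟨_, w, triFrame (γ t), h1, diffVAt_triFrame (γ t), h2,
    h.unique ht (hasCovDeriv_sum hD hU hγ ht h1 (diffVAt_triFrame (γ t)) h2)⟩

lemma HasCovDeriv.apply (hD : IsAffineConnectionOn D U) (hU : U ∈ 𝓝 (γ t))
    (hγ : MDifferentiableWithinAt 𝓘(ℝ, ℝ) (𝓡 n) γ (Icc 0 1) t) (ht : t ∈ Icc (0 : ℝ) 1)
    {V : ∀ t : ℝ, TangentSpace (𝓡 n) (γ t)} {v' : TangentSpace (𝓡 n) (γ t)}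
    (h : HasCovDeriv D γ V t v') {A : EndField n M} {N : Set M} (hN : N ∈ 𝓝 (γ t))
    (hA : SmoothEndOn A N) {B : TangentSpace (𝓡 n) (γ t) →L[ℝ] TangentSpace (𝓡 n) (γ t)}
    (hB : IsEndDeriv D A (γ t) (velocity γ t) B) :
    HasCovDeriv D γ (fun s ↦ A (γ s) (V s)) t (B (V t) + A (γ t) v') := by
  obtain ⟨f, f', Y, hf, hY, hV, rfl⟩ := h.exists_frame hD hU hγ ht
  have h1 := hasCovDeriv_sum hD hU hγ ht hf (fun a ↦ hA.diffVAt hN (hY a))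
    (V := fun s ↦ A (γ s) (V s)) (hV.mono fun s hs ↦ by simp [hs])
  convert h1 using 1
  rw [hV.self_of_nhdsWithin ht, map_sum, map_sum, ← Finset.sum_add_distrib]
  refine Finset.sum_congr rfl fun a _ ↦ ?_
  rw [hB (Y a) (hY a), map_smul, map_add, map_smul, map_smul]
  module

end Along

/-! ### Metric compatibility along curves -/

section Riem

variable {n : ℕ} {M : Type*} [TopologicalSpace M] [ChartedSpace (EuclideanSpace ℝ (Fin n)) M]
  [IsManifold (𝓡 n) ∞ M] [RiemannianBundle (fun x : M ↦ TangentSpace (𝓡 n) x)]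
  [IsContMDiffRiemannianBundle (𝓡 n) ∞ (EuclideanSpace ℝ (Fin n))
      (fun x : M ↦ TangentSpace (𝓡 n) x)]
  {nabla : ConnOp n M} (hLC : IsLeviCivita nabla) {γ : ℝ → M} {t : ℝ}
  (hγ : MDifferentiableWithinAt 𝓘(ℝ, ℝ) (𝓡 n) γ (Icc 0 1) t) (ht : t ∈ Icc (0 : ℝ) 1)
include hLC hγ ht

lemma HasCovDeriv.hasDerivWithinAt_inner {V W : ∀ t : ℝ, TangentSpace (𝓡 n) (γ t)}
    {v' w' : TangentSpace (𝓡 n) (γ t)} (hV : HasCovDeriv nabla γ V t v')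
    (hW : HasCovDeriv nabla γ W t w') :
    HasDerivWithinAt (fun s ↦ (inner ℝ (V s) (W s) : ℝ))
      (inner ℝ v' (W t) + inner ℝ (V t) w') (Icc 0 1) t := by
  obtain ⟨f, f', Y, hf, hY, eV, rfl⟩ := hV.exists_frame hLC.conn Filter.univ_mem hγ ht
  obtain ⟨g, g', Z, hg, hZ, eW, rfl⟩ := hW.exists_frame hLC.conn Filter.univ_mem hγ ht
  have h1 : ∀ a b, HasDerivWithinAt (fun s ↦ f a s * g b s * (inner ℝ (Y a (γ s)) (Z b (γ s)) : ℝ))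
      ((f' a * g b t + f a t * g' b) * inner ℝ (Y a (γ t)) (Z b (γ t)) + f a t * g b t *
        (inner ℝ (nabla (Y a) (γ t) (velocity γ t)) (Z b (γ t))
          + inner ℝ (Y a (γ t)) (nabla (Z b) (γ t) (velocity γ t)))) (Icc 0 1) t := by
    intro a b
    have h2 := hasDerivWithinAt_comp_curve hγ ((hY a).inner (hZ b))
    rw [hLC.metric _ _ _ (hY a) (hZ b)] at h2
    exact ((hf a).mul (hg b)).mul h2
  have h2 := HasDerivWithinAt.fun_sum (u := Finset.univ) fun a _ ↦
    HasDerivWithinAt.fun_sum (u := Finset.univ) fun b _ ↦ h1 a b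
  have h3 : (fun s ↦ (inner ℝ (V s) (W s) : ℝ)) =ᶠ[𝓝[Icc 0 1] t]
      fun s ↦ ∑ a, ∑ b, f a s * g b s * (inner ℝ (Y a (γ s)) (Z b (γ s)) : ℝ) := by
    filter_upwards [eV, eW] with s hs hs'
    rw [hs, hs', sum_inner]
    refine Finset.sum_congr rfl fun a _ ↦ ?_
    rw [inner_sum]
    refine Finset.sum_congr rfl fun b _ ↦ ?_
    rw [real_inner_smul_left, real_inner_smul_right]
    ring
  refine (h2.congr_of_eventuallyEq h3 (h3.self_of_nhdsWithin ht)).congr_deriv ?_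
  rw [eV.self_of_nhdsWithin ht, eW.self_of_nhdsWithin ht]
  simp only [sum_inner]
  simp only [inner_sum]
  rw [← Finset.sum_add_distrib]
  refine Finset.sum_congr rfl fun a _ ↦ ?_
  rw [← Finset.sum_add_distrib]
  refine Finset.sum_congr rfl fun b _ ↦ ?_
  simp only [real_inner_smul_left, real_inner_smul_right, inner_add_left, inner_add_right]
  ring

end Riem

/-! ### Coordinates with respect to a frame -/

section GramCoord

variable {V : Type*} [NormedAddCommGroup V] [InnerProductSpace ℝ V]
  {ι : Type*} [Fintype ι] [DecidableEq ι]

/-- The coordinates with respect to a frame, computed from its Gram matrix. -/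
def gramCoord (v : ι → V) (l : ι) : V →ₗ[ℝ] ℝ :=
  ∑ k, (gramMatrix v)⁻¹ l k • (innerSL ℝ (v k)).toLinearMap

lemma gramCoord_apply (v : ι → V) (l : ι) (w : V) :
    gramCoord v l w = ((gramMatrix v)⁻¹ *ᵥ fun k ↦ (inner ℝ (v k) w : ℝ)) l := by
  simp [gramCoord, Matrix.mulVec, dotProduct]

variable {v : ι → V} (h : (gramMatrix v).det ≠ 0)
include h

lemma gramCoord_eq_of_mulVec {c : ι → ℝ} {w : V}
    (hc : gramMatrix v *ᵥ c = fun k ↦ (inner ℝ (v k) w : ℝ)) (l : ι) : gramCoord v l w = c l := by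
  rw [gramCoord_apply, ← hc, Matrix.mulVec_mulVec, Matrix.nonsing_inv_mul _ h.isUnit,
    Matrix.one_mulVec]

lemma gramMatrix_mulVec_gramCoord (w : V) (k : ι) :
    ∑ l, (inner ℝ (v k) (v l) : ℝ) * gramCoord v l w = inner ℝ (v k) w := by
  have : gramMatrix v *ᵥ ((gramMatrix v)⁻¹ *ᵥ fun k ↦ (inner ℝ (v k) w : ℝ)) =
      fun k ↦ (inner ℝ (v k) w : ℝ) := by
    rw [Matrix.mulVec_mulVec, Matrix.mul_nonsing_inv _ h.isUnit, Matrix.one_mulVec]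
  have h2 := congrFun this k
  rw [Matrix.mulVec, dotProduct] at h2
  simpa [gramCoord_apply, gramMatrix] using h2

lemma sum_gramCoord [FiniteDimensional ℝ V] (hι : Fintype.card ι = Module.finrank ℝ V) (w : V) :
    ∑ l, gramCoord v l w • v l = w := by
  have hli := linearIndependent_of_det_gramMatrix_ne_zero h
  have hw : w ∈ Submodule.span ℝ (Set.range v) := by
    rw [hli.span_eq_top_of_card_eq_finrank' hι]
    trivial
  obtain ⟨c, rfl⟩ := (Submodule.mem_span_range_iff_exists_fun ℝ).1 hw
  refine Finset.sum_congr rfl fun l _ ↦ ?_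
  rw [gramCoord_eq_of_mulVec h (c := c)]
  ext k
  simp [Matrix.mulVec, dotProduct, gramMatrix, inner_sum, real_inner_smul_right, mul_comm]

end GramCoord

/-! ### Derivatives of coordinates in a moving frame -/

section Along

variable {n : ℕ} {M : Type*} [TopologicalSpace M] [ChartedSpace (EuclideanSpace ℝ (Fin n)) M]
  [IsManifold (𝓡 n) ∞ M] [RiemannianBundle (fun x : M ↦ TangentSpace (𝓡 n) x)]
  [IsContMDiffRiemannianBundle (𝓡 n) ∞ (EuclideanSpace ℝ (Fin n))
      (fun x : M ↦ TangentSpace (𝓡 n) x)]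
  {nabla : ConnOp n M} (hLC : IsLeviCivita nabla) {γ : ℝ → M} {t : ℝ}
  (hγ : MDifferentiableWithinAt 𝓘(ℝ, ℝ) (𝓡 n) γ (Icc 0 1) t) (ht : t ∈ Icc (0 : ℝ) 1)
  {V : Fin n → ∀ t : ℝ, TangentSpace (𝓡 n) (γ t)}
include hLC hγ ht

/-- Cramer's rule shows that the coordinates c_l of W are differentiable. Their derivatives are then
read off by differentiating ∑ g(V_k, V_l) c_l = g(V_k, W) and inverting the Gram matrix. -/
lemma hasDerivWithinAt_gramCoord
    (hdet : ∀ s ∈ Icc (0 : ℝ) 1, (gramMatrix fun i ↦ V i s).det ≠ 0)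
    {v' : Fin n → TangentSpace (𝓡 n) (γ t)} (hV : ∀ i, HasCovDeriv nabla γ (V i) t (v' i))
    {W : ∀ t : ℝ, TangentSpace (𝓡 n) (γ t)} {w' : TangentSpace (𝓡 n) (γ t)}
    (hW : HasCovDeriv nabla γ W t w') (l : Fin n) :
    HasDerivWithinAt (fun s ↦ gramCoord (fun i ↦ V i s) l (W s))
      (gramCoord (fun i ↦ V i t) l (w' - ∑ k, gramCoord (fun i ↦ V i t) k (W t) • v' k))
      (Icc 0 1) t := by
  have hG : ∀ i j, HasDerivWithinAt (fun s ↦ gramMatrix (fun i ↦ V i s) i j)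
      (inner ℝ (v' i) (V j t) + inner ℝ (V i t) (v' j)) (Icc 0 1) t := fun i j ↦
    (hV i).hasDerivWithinAt_inner hLC hγ ht (hV j)
  have hw : ∀ i, HasDerivWithinAt (fun s ↦ (inner ℝ (V i s) (W s) : ℝ))
      (inner ℝ (v' i) (W t) + inner ℝ (V i t) w') (Icc 0 1) t := fun i ↦
    (hV i).hasDerivWithinAt_inner hLC hγ ht hW
  have hinv : ∀ i j, DifferentiableWithinAt ℝ
      (fun s ↦ (gramMatrix (fun i ↦ V i s))⁻¹ i j) (Icc 0 1) t := by
    intro i j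
    have h1 : DifferentiableWithinAt ℝ (fun s ↦ (gramMatrix (fun i ↦ V i s)).det) (Icc 0 1) t :=
      (hasDerivWithinAt_det hG).differentiableWithinAt
    have h2 : DifferentiableWithinAt ℝ
        (fun s ↦ (gramMatrix (fun i ↦ V i s)).adjugate i j) (Icc 0 1) t := by
      simp only [Matrix.adjugate_apply]
      -- An entry of the adjugate is the determinant of the Gram matrix with row j replaced by a
      -- constant row, whose derivative is zero.
      refine (hasDerivWithinAt_det (G' := Matrix.of fun a b ↦ if a = j then 0 else
        (inner ℝ (v' a) (V b t) + inner ℝ (V a t) (v' b))) fun a b ↦ ?_).differentiableWithinAt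
      simp only [Matrix.updateRow_apply, Matrix.of_apply]
      split_ifs with hab
      · exact hasDerivWithinAt_const _ _ _
      · exact hG a b
    have h3 := (h1.inv (hdet t ht)).mul h2
    refine h3.congr (fun s _ ↦ ?_) ?_ <;>
    simp [Matrix.inv_def, Ring.inverse_eq_inv']
  have hc : ∀ l, ∃ c', HasDerivWithinAt (fun s ↦ gramCoord (fun i ↦ V i s) l (W s)) c'
      (Icc 0 1) t := by
    intro l
    have h1 : DifferentiableWithinAt ℝ (fun s ↦ gramCoord (fun i ↦ V i s) l (W s))
        (Icc 0 1) t := by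
      simp only [gramCoord_apply, Matrix.mulVec, dotProduct]
      exact DifferentiableWithinAt.fun_sum fun k _ ↦ (hinv l k).mul (hw k).differentiableWithinAt
    exact ⟨_, h1.hasDerivWithinAt⟩
  choose c' hc' using hc
  refine (hc' l).congr_deriv ?_
  have hsum := sum_gramCoord (hdet t ht) (by rw [finrank_tangentSpace, Fintype.card_fin]) (W t)
  refine (gramCoord_eq_of_mulVec (hdet t ht) (c := c') ?_ l).symm
  ext k
  have h1 := HasDerivWithinAt.fun_sum (u := Finset.univ) fun l _ ↦ (hG k l).mul (hc' l)
  have h2 := (uniqueDiffOn_Icc zero_lt_one t ht).eq_deriv _ (h1.congr (f₁ := fun s ↦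
    (inner ℝ (V k s) (W s) : ℝ))
    (fun s hs ↦ (gramMatrix_mulVec_gramCoord (hdet s hs) (W s) k).symm)
    (gramMatrix_mulVec_gramCoord (hdet t ht) (W t) k).symm) (hw k)
  rw [Finset.sum_add_distrib] at h2
  have h3 : (∑ l, (inner ℝ (v' k) (V l t) + inner ℝ (V k t) (v' l) : ℝ)
      * gramCoord (fun i ↦ V i t) l (W t)) = inner ℝ (v' k) (W t)
      + inner ℝ (V k t) (∑ l, gramCoord (fun i ↦ V i t) l (W t) • v' l) := by
    have h4 : (inner ℝ (v' k) (W t) : ℝ) =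
        ∑ l, gramCoord (fun i ↦ V i t) l (W t) * inner ℝ (v' k) (V l t) := by
      conv_lhs => rw [← hsum]
      simp only [inner_sum, real_inner_smul_right]
    rw [h4, inner_sum, ← Finset.sum_add_distrib]
    refine Finset.sum_congr rfl fun l _ ↦ ?_
    rw [real_inner_smul_right]
    ring
  rw [h3] at h2
  rw [inner_sub_right]
  simp only [Matrix.mulVec, dotProduct]
  have h4 : ∀ l, gramMatrix (fun i ↦ V i t) k l = inner ℝ (V k t) (V l t) := fun l ↦ rfl
  simp only [h4] at h2 ⊢
  linarith

variable {Q : ∀ x : M, Submodule ℝ (TangentSpace (𝓡 n) x →L[ℝ] TangentSpace (𝓡 n) x)}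
  {μ : EndField n M}

omit hLC hγ ht in
lemma HasCovDeriv.of_modConn {V : ∀ t : ℝ, TangentSpace (𝓡 n) (γ t)}
    {v' : TangentSpace (𝓡 n) (γ t)} (h : HasCovDeriv (modConn nabla Q μ) γ V t v') :
    HasCovDeriv nabla γ V t (v' - modTensor Q μ (γ t) (V t) (velocity γ t)) := by
  obtain ⟨w, hw, e⟩ := h
  refine ⟨w, hw, ?_⟩
  rw [← e, modConn_apply, ext_self]
  abel

/-- Inner products are differentiated with the Levi-Civita connection, but the correction is linear
in the field, so the corrections of W and of the parallel frame cancel. In such a frame, covariant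
differentiation is differentiation of coordinates. -/
lemma hasDerivWithinAt_gramCoord_modConn
    (hdet : ∀ s ∈ Icc (0 : ℝ) 1, (gramMatrix fun i ↦ V i s).det ≠ 0)
    (hV : ∀ i, HasCovDeriv (modConn nabla Q μ) γ (V i) t 0)
    {W : ∀ t : ℝ, TangentSpace (𝓡 n) (γ t)} {w' : TangentSpace (𝓡 n) (γ t)}
    (hW : HasCovDeriv (modConn nabla Q μ) γ W t w') (l : Fin n) :
    HasDerivWithinAt (fun s ↦ gramCoord (fun i ↦ V i s) l (W s))
      (gramCoord (fun i ↦ V i t) l w') (Icc 0 1) t := by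
  refine (hasDerivWithinAt_gramCoord hLC hγ ht hdet (fun i ↦ (hV i).of_modConn) hW.of_modConn
    l).congr_deriv ?_
  congr 1
  have hsum := sum_gramCoord (hdet t ht) (by rw [finrank_tangentSpace, Fintype.card_fin]) (W t)
  have : modTensor Q μ (γ t) (W t) (velocity γ t) = ∑ l, gramCoord (fun i ↦ V i t) l (W t) •
      modTensor Q μ (γ t) (V l t) (velocity γ t) := by
    conv_lhs => rw [← hsum]
    simp
  rw [this]
  simp

end Along

/-! ### Parallel transport of the modified connection -/

section Transport

variable {n : ℕ} {M : Type*} [TopologicalSpace M] [ChartedSpace (EuclideanSpace ℝ (Fin n)) M]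
  [IsManifold (𝓡 n) ∞ M] [RiemannianBundle (fun x : M ↦ TangentSpace (𝓡 n) x)]

/-- The density, relative to the Riemannian one, of the volume form preserved by the modified
connection. -/
def momentDensity (μ : EndField n M) (x : M) : ℝ :=
  -- This is |μ|^{−(n+4)} on M₀, used as a weight for Gram determinants, that is, for squared
  -- volumes. The exponential form makes it nonzero everywhere.
  Real.exp (-(n + 4) * Real.log (momentNorm μ x))

/-- The properties of parallel transport that put the holonomy into `U*(2m)`. -/
structure PreservesStructure
    (Q : ∀ x : M, Submodule ℝ (TangentSpace (𝓡 n) x →L[ℝ] TangentSpace (𝓡 n) x))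
    (μ : EndField n M) {x y : M} (P : TangentSpace (𝓡 n) x →L[ℝ] TangentSpace (𝓡 n) y) : Prop where
  structure_apply : ∀ v, momentStructure μ y (P v) = P (momentStructure μ x v)
  exists_comm : ∀ B ∈ Q y, ∃ B' ∈ Q x, ∀ v, B (P v) = P (B' v)
  volume : ∀ e : Fin n → TangentSpace (𝓡 n) x, (gramMatrix fun i ↦ P (e i)).det * momentDensity μ y
    = (gramMatrix e).det * momentDensity μ x

variable {nabla : ConnOp n M}
    {Q : ∀ x : M, Submodule ℝ (TangentSpace (𝓡 n) x →L[ℝ] TangentSpace (𝓡 n) x)}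
    {X : VField n M} {μ : EndField n M} [T2Space M]
  [IsContMDiffRiemannianBundle (𝓡 n) ∞ (EuclideanSpace ℝ (Fin n))
      (fun x : M ↦ TangentSpace (𝓡 n) x)]
  (hn : 0 < n) (hQ : IsQuaternionicKahler nabla Q) (hμ : IsMomentSection nabla Q X μ)
  (hLC : IsLeviCivita nabla)
  {γ : ℝ → M} (hγ : ∀ t ∈ Icc (0 : ℝ) 1, MDifferentiableWithinAt 𝓘(ℝ, ℝ) (𝓡 n) γ (Icc 0 1) t)
  (hU : ∀ t ∈ Icc (0 : ℝ) 1, γ t ∈ nonzeroSet μ)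
  {V : Fin n → ∀ t : ℝ, TangentSpace (𝓡 n) (γ t)}
  (hV : ∀ i, ∀ t ∈ Icc (0 : ℝ) 1, HasCovDeriv (modConn nabla Q μ) γ (V i) t 0)
include hn hQ hμ hLC hγ hU hV

/-- A parallel field has Levi-Civita derivative −S(V, γ'). By Jacobi's formula and `trace_oneForm`
the Gram determinant has logarithmic derivative −2(n+4)α(γ') = (n+4) d log|μ|(γ'), which the weight
compensates. The family may be linearly dependent. -/
lemma det_gramMatrix_mul_momentDensity {t : ℝ} (ht : t ∈ Icc (0 : ℝ) 1) :
    (gramMatrix fun i ↦ V i t).det * momentDensity μ (γ t) =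
      (gramMatrix fun i ↦ V i 0).det * momentDensity μ (γ 0) := by
  refine eq_of_hasDerivWithinAt_zero (f := fun t ↦ (gramMatrix fun i ↦ V i t).det *
    momentDensity μ (γ t)) (fun t ht ↦ ?_) ht
  have hx := hU t ht
  obtain ⟨J, K, hq, hs⟩ := exists_adapted_triple hn hQ hμ.mem hx
  set L : TangentSpace (𝓡 n) (γ t) →L[ℝ] TangentSpace (𝓡 n) (γ t) :=
    (modTensor Q μ (γ t)).flip (velocity γ t) with hL
  have hG : ∀ i j, HasDerivWithinAt (fun s ↦ gramMatrix (fun i ↦ V i s) i j)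
      (Matrix.of (fun i j ↦ (inner ℝ ((-L).toLinearMap (V i t)) (V j t)
        + inner ℝ (V i t) ((-L).toLinearMap (V j t)) : ℝ)) i j) (Icc 0 1) t := by
    intro i j
    refine ((hV i t ht).of_modConn.hasDerivWithinAt_inner hLC (hγ t ht) ht
      (hV j t ht).of_modConn).congr_deriv ?_
    simp [hL]
  have h1 := hasDerivWithinAt_det hG
  rw [trace_mul_adjugate_gramMatrix (by rw [finrank_tangentSpace, Fintype.card_fin])] at h1
  have htr : LinearMap.trace ℝ _ (-L).toLinearMap =
      -((n + 4) * momentFormL μ (γ t) (velocity γ t)) := by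
    have h2 := hq.trace_oneForm (momentFormL μ (γ t)) (velocity γ t)
    rw [← modTensor_eq hn hq hs, finrank_tangentSpace] at h2
    rw [← h2, show (-L).toLinearMap = -L.toLinearMap from rfl, map_neg]
  have hlog : MDifferentiableAt (𝓡 n) 𝓘(ℝ, ℝ) (fun y ↦ Real.log (momentNorm μ y)) (γ t) := by
    have h3 : MDifferentiableAt (𝓡 n) 𝓘(ℝ, ℝ) (momentNorm μ) (γ t) :=
      ((contMDiffOn_momentNorm hn hQ hμ).contMDiffAt
        ((isOpen_nonzeroSet hn hQ hμ).mem_nhds hx)).mdifferentiableAt (by simp)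
    have h4 : MDifferentiableAt 𝓘(ℝ, ℝ) 𝓘(ℝ, ℝ) Real.log (momentNorm μ (γ t)) :=
      (Real.hasDerivAt_log (momentNorm_pos hn hQ hμ.mem hx).ne').differentiableAt.mdifferentiableAt
    exact h4.comp (γ t) h3
  have h2 := ((hasDerivWithinAt_comp_curve (hγ t ht) hlog).const_mul (-((n : ℝ) + 4))).exp
  refine (h1.mul h2).congr_deriv ?_
  have h3 : mvfderiv (𝓡 n) (fun y ↦ Real.log (momentNorm μ y)) (γ t) (velocity γ t) =
      -2 * momentFormL μ (γ t) (velocity γ t) := by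
    rw [momentFormL_apply, momentForm]
    ring
  rw [htr, h3]
  ring

variable (h0 : (gramMatrix fun i ↦ V i 0).det ≠ 0)
include h0

/-- A parallel family independent at time 0 stays independent: the conserved volume replaces a
uniqueness theorem for the transport equation. -/
lemma det_gramMatrix_ne_zero {t : ℝ} (ht : t ∈ Icc (0 : ℝ) 1) :
    (gramMatrix fun i ↦ V i t).det ≠ 0 := by
  intro h
  have h1 := det_gramMatrix_mul_momentDensity hn hQ hμ hLC hγ hU hV ht
  rw [h, zero_mul] at h1
  exact mul_ne_zero h0 (Real.exp_ne_zero _) h1.symm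

lemma gramCoord_momentStructure (hX : SmoothVOn X univ) (j l : Fin n) :
    gramCoord (fun i ↦ V i 1) l (momentStructure μ (γ 1) (V j 1)) =
      gramCoord (fun i ↦ V i 0) l (momentStructure μ (γ 0) (V j 0)) := by
  refine eq_of_hasDerivWithinAt_zero (f := fun t ↦ gramCoord (fun i ↦ V i t) l
    (momentStructure μ (γ t) (V j t))) (fun t ht ↦ ?_) (by simp)
  have hN := (isOpen_nonzeroSet hn hQ hμ).mem_nhds (hU t ht)
  have h1 := (hV j t ht).apply (isAffineConnectionOn_modConn hn hQ hμ hLC hX) hN (hγ t ht) ht hN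
    (smoothEndOn_momentStructure hn hQ hμ)
    (isParallelEndOn_modConn hn hQ hμ hLC (γ t) (hU t ht) (velocity γ t))
  refine (hasDerivWithinAt_gramCoord_modConn hLC (hγ t ht) ht
    (fun s hs ↦ det_gramMatrix_ne_zero hn hQ hμ hLC hγ hU hV h0 hs)
    (fun i ↦ hV i t ht) h1 l).congr_deriv ?_
  simp

/-- Single elements of Q need not extend to parallel sections, but ∑ I_i ⊗ I_i is canonical and
parallel, so its components in a parallel frame are constant. T may depend on t in any way: near
each time it is exchanged for a smooth local triple by `sum_invariant`, and `sum_derivative` gives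
derivative zero. -/
lemma sum_gramCoord_triple (hX : SmoothVOn X univ)
    {T : Fin 3 → ∀ t : ℝ, TangentSpace (𝓡 n) (γ t) →L[ℝ] TangentSpace (𝓡 n) (γ t)}
    (hT : ∀ t, QTriple (T 0 t) (T 1 t) (T 2 t) ∧
      Q (γ t) = Submodule.span ℝ {T 0 t, T 1 t, T 2 t}) (j l j' l' : Fin n) :
    ∑ a, gramCoord (fun i ↦ V i 1) l (T a 1 (V j 1)) *
        gramCoord (fun i ↦ V i 1) l' (T a 1 (V j' 1)) =
      ∑ a, gramCoord (fun i ↦ V i 0) l (T a 0 (V j 0)) *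
        gramCoord (fun i ↦ V i 0) l' (T a 0 (V j' 0)) := by
  refine eq_of_hasDerivWithinAt_zero (f := fun t ↦ ∑ a,
    gramCoord (fun i ↦ V i t) l (T a t (V j t)) *
      gramCoord (fun i ↦ V i t) l' (T a t (V j' t))) (fun t ht ↦ ?_) (by simp)
  have hUo := isOpen_nonzeroSet hn hQ hμ
  have hN := hUo.mem_nhds (hU t ht)
  have hD := isAffineConnectionOn_modConn hn hQ hμ hLC hX
  have hdet : ∀ s ∈ Icc (0 : ℝ) 1, (gramMatrix fun i ↦ V i s).det ≠ 0 :=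
    fun s hs ↦ det_gramMatrix_ne_zero hn hQ hμ hLC hγ hU hV h0 hs
  have := nontrivial_tangentSpace hn (γ t)
  obtain ⟨W, hW, hxW, I, J, K, sI, sJ, sK, hq⟩ := hQ.almostQuaternionic (γ t)
  obtain ⟨A, hA, B, hB, C, hC, dA, dB, dC, r1, r2, r3, r4⟩ := exists_triple_deriv hD hUo
    (preservesOn_modConn hn hQ) hW sI sJ sK hq (hU t ht) hxW (velocity γ t)
  have hd : ∀ {A : EndField n M} {B : TangentSpace (𝓡 n) (γ t) →L[ℝ] TangentSpace (𝓡 n) (γ t)},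
      SmoothEndOn A W → IsEndDeriv (modConn nabla Q μ) A (γ t) (velocity γ t) B → ∀ j l : Fin n,
      HasDerivWithinAt (fun s ↦ gramCoord (fun i ↦ V i s) l (A (γ s) (V j s)))
        (gramCoord (fun i ↦ V i t) l (B (V j t))) (Icc 0 1) t := by
    intro A B hA hB j l
    have h1 := (hV j t ht).apply hD hN (hγ t ht) ht (hW.mem_nhds hxW) hA hB
    refine (hasDerivWithinAt_gramCoord_modConn hLC (hγ t ht) ht hdet
      (fun i ↦ hV i t ht) h1 l).congr_deriv ?_
    simp
  have h1 := (((hd sI dA j l).mul (hd sI dA j' l')).add ((hd sJ dB j l).mul (hd sJ dB j' l'))).add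
    ((hd sK dC j l).mul (hd sK dC j' l'))
  have hev : ∀ᶠ s in 𝓝[Icc 0 1] t, γ s ∈ W :=
    (hγ t ht).continuousWithinAt (hW.mem_nhds hxW)
  have h2 : (fun s ↦ ∑ a, gramCoord (fun i ↦ V i s) l (T a s (V j s)) *
      gramCoord (fun i ↦ V i s) l' (T a s (V j' s))) =ᶠ[𝓝[Icc 0 1] t] fun s ↦
      gramCoord (fun i ↦ V i s) l (I (γ s) (V j s)) *
        gramCoord (fun i ↦ V i s) l' (I (γ s) (V j' s)) +
      gramCoord (fun i ↦ V i s) l (J (γ s) (V j s)) *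
        gramCoord (fun i ↦ V i s) l' (J (γ s) (V j' s)) +
      gramCoord (fun i ↦ V i s) l (K (γ s) (V j s)) *
        gramCoord (fun i ↦ V i s) l' (K (γ s) (V j' s)) := by
    filter_upwards [hev] with s hs
    have := nontrivial_tangentSpace hn (γ s)
    have hm := (hT s).2.symm.trans (hq (γ s) hs).2
    have h3 := QTriple.sum_invariant (hq (γ s) hs).1 (hT s).1
      (hm ▸ Submodule.subset_span (by simp)) (hm ▸ Submodule.subset_span (by simp))
      (hm ▸ Submodule.subset_span (by simp))
      ((gramCoord (fun i ↦ V i s) l).comp (ContinuousLinearMap.apply ℝ _ (V j s)).toLinearMap)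
      ((gramCoord (fun i ↦ V i s) l').comp (ContinuousLinearMap.apply ℝ _ (V j' s)).toLinearMap)
    rw [Fin.sum_univ_three]
    exact h3
  refine (h1.congr_of_eventuallyEq h2 (h2.self_of_nhdsWithin ht)).congr_deriv ?_
  have h4 := QTriple.sum_derivative (hq (γ t) hxW).1 ((hq (γ t) hxW).2 ▸ hA)
    ((hq (γ t) hxW).2 ▸ hB) r1 r2 r3 r4
    ((gramCoord (fun i ↦ V i t) l).comp (ContinuousLinearMap.apply ℝ _ (V j t)).toLinearMap)
    ((gramCoord (fun i ↦ V i t) l').comp (ContinuousLinearMap.apply ℝ _ (V j' t)).toLinearMap)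
  exact h4

omit hV h0 in
-- The parallel fields starting at an orthonormal basis stay a frame, and P matches coordinates in
-- this frame at the two ends. Tensors with constant components in it are therefore intertwined by
-- P.
lemma preservesStructure_of_parallel (hX : SmoothVOn X univ)
    {P : TangentSpace (𝓡 n) (γ 0) →L[ℝ] TangentSpace (𝓡 n) (γ 1)}
    (hP : ∀ v, ∃ V : ∀ t : ℝ, TangentSpace (𝓡 n) (γ t),
        IsParallelAlong (modConn nabla Q μ) γ V ∧ V 0 = v ∧ V 1 = P v) :
    PreservesStructure Q μ P := by
  choose F hF hF0 hF1 using hP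
  -- Being parallel is by definition having covariant derivative 0 at all times.
  have hF' : ∀ v, ∀ t ∈ Icc (0 : ℝ) 1, HasCovDeriv (modConn nabla Q μ) γ (F v) t 0 := hF
  let b : OrthonormalBasis (Fin n) ℝ (TangentSpace (𝓡 n) (γ 0)) :=
    (stdOrthonormalBasis ℝ (TangentSpace (𝓡 n) (γ 0))).reindex
      (finCongr (finrank_tangentSpace (γ 0)))
  have hb : (gramMatrix fun i ↦ F (b i) 0).det ≠ 0 := by
    simp only [hF0]
    rw [det_gramMatrix_orthonormal b]
    exact one_ne_zero
  have hV : ∀ i, ∀ t ∈ Icc (0 : ℝ) 1, HasCovDeriv (modConn nabla Q μ) γ (F (b i)) t 0 :=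
    fun i ↦ hF' (b i)
  have hb1 := det_gramMatrix_ne_zero hn hQ hμ hLC hγ hU hV hb (t := 1) (by simp)
  have hcard : ∀ t, Fintype.card (Fin n) = Module.finrank ℝ (TangentSpace (𝓡 n) (γ t)) := by
    intro t
    rw [finrank_tangentSpace, Fintype.card_fin]
  have hcoord : ∀ (w : TangentSpace (𝓡 n) (γ 0)) (w' : TangentSpace (𝓡 n) (γ 1)),
      (∀ l, gramCoord (fun i ↦ F (b i) 1) l w' = gramCoord (fun i ↦ F (b i) 0) l w) →
      w' = P w := by
    intro w w' h
    rw [← sum_gramCoord hb1 (hcard 1) w', ← sum_gramCoord hb (hcard 0) w, map_sum]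
    refine Finset.sum_congr rfl fun l _ ↦ ?_
    rw [h l, map_smul, hF0, hF1]
  have hext : ∀ (A : TangentSpace (𝓡 n) (γ 1) →L[ℝ] TangentSpace (𝓡 n) (γ 1))
      (A' : TangentSpace (𝓡 n) (γ 0) →L[ℝ] TangentSpace (𝓡 n) (γ 0)),
      (∀ i, A (P (b i)) = P (A' (b i))) → ∀ v, A (P v) = P (A' v) := by
    intro A A' h v
    have h1 : (A.toLinearMap.comp P.toLinearMap) = (P.toLinearMap.comp A'.toLinearMap) :=
      b.toBasis.ext fun i ↦ by simpa using h i
    exact congrArg (fun L ↦ L v) h1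
  refine ⟨fun v ↦ ?_, fun B hB ↦ ?_, fun e ↦ ?_⟩
  · refine hext _ _ (fun i ↦ hcoord _ _ fun l ↦ ?_) v
    have := gramCoord_momentStructure hn hQ hμ hLC hγ hU hV hb hX i l
    rwa [hF0, hF1] at this
  · have hex : ∀ t, ∃ T : Fin 3 → TangentSpace (𝓡 n) (γ t) →L[ℝ] TangentSpace (𝓡 n) (γ t),
        QTriple (T 0) (T 1) (T 2) ∧ Q (γ t) = Submodule.span ℝ {T 0, T 1, T 2} := by
      intro t
      obtain ⟨I, J, K, h⟩ := exists_triple hn hQ hμ.mem (γ t)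
      exact ⟨![I, J, K], h⟩
    choose T hT using hex
    have key := sum_gramCoord_triple hn hQ hμ hLC hγ hU hV hb hX (T := fun a t ↦ T t a) hT
    -- B is to be recovered from ∑ T_k ⊗ T_k at γ 1 by contracting one factor with a vector u and a
    -- functional f. Any nonzero u will do.
    let j₀ : Fin n := ⟨0, hn⟩
    set u := F (b j₀) 1 with hu
    have hu0 : (inner ℝ u u : ℝ) ≠ 0 := by
      rw [inner_self_ne_zero]
      exact (linearIndependent_of_det_gramMatrix_ne_zero hb1).ne_zero j₀
    obtain ⟨b1, b2, b3, eB⟩ := QTriple.mem_span_iff.1 ((hT 1).2 ▸ hB)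
    have hin := (hT 1).1.inner_comb (fun A hA ↦ hQ.skew _ A ((hT 1).2 ▸ hA)) b1 b2 b3
    -- By `inner_comb`, f(T_k u) is the coefficient of B along T_k, so ∑ f(T_k u) T_k = B.
    let f : TangentSpace (𝓡 n) (γ 1) →ₗ[ℝ] ℝ :=
      (inner ℝ u u : ℝ)⁻¹ • (innerSL ℝ (B u)).toLinearMap
    have hf : f (T 1 0 u) = b1 ∧ f (T 1 1 u) = b2 ∧ f (T 1 2 u) = b3 := by
      have e0 := hin 1 0 0 u
      have e1 := hin 0 1 0 u
      have e2 := hin 0 0 1 u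
      simp only [one_smul, zero_smul, add_zero, zero_add] at e0 e1 e2
      rw [← eB] at e0 e1 e2
      refine ⟨?_, ?_, ?_⟩ <;> simp only [f, LinearMap.smul_apply, smul_eq_mul]
      · exact (congrArg _ e0).trans (by field_simp; ring)
      · exact (congrArg _ e1).trans (by field_simp; ring)
      · exact (congrArg _ e2).trans (by field_simp; ring)
    -- The same contraction at γ 0, with f expressed in the parallel frame. As the components of ∑
    -- T_k ⊗ T_k agree at both ends, it yields the operator corresponding to B under P.
    let a : Fin 3 → ℝ := fun k ↦
      ∑ l, f (F (b l) 1) * gramCoord (fun i ↦ F (b i) 0) l (T 0 k (b j₀))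
    refine ⟨∑ k, a k • T 0 k, ?_, ?_⟩
    · rw [(hT 0).2]
      exact QTriple.mem_span_iff.2 ⟨a 0, a 1, a 2, Fin.sum_univ_three _⟩
    refine hext _ _ fun i ↦ hcoord _ _ fun l ↦ ?_
    have h1 : ∀ w, ∑ l, f (F (b l) 1) * gramCoord (fun i ↦ F (b i) 1) l w = f w := by
      intro w
      conv_rhs => rw [← sum_gramCoord hb1 (hcard 1) w, map_sum]
      refine Finset.sum_congr rfl fun l _ ↦ ?_
      rw [map_smul, smul_eq_mul, mul_comm]
    have h2 : ∀ k, ∑ l', f (F (b l') 1) * (gramCoord (fun i ↦ F (b i) 1) l' (T 1 k u) *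
        gramCoord (fun i ↦ F (b i) 1) l (T 1 k (F (b i) 1))) =
        f (T 1 k u) * gramCoord (fun i ↦ F (b i) 1) l (T 1 k (F (b i) 1)) := by
      intro k
      rw [← h1 (T 1 k u), Finset.sum_mul]
      exact Finset.sum_congr rfl fun l' _ ↦ by ring
    have h3 : ∀ k, ∑ l', f (F (b l') 1) * (gramCoord (fun i ↦ F (b i) 0) l' (T 0 k (b j₀)) *
        gramCoord (fun i ↦ F (b i) 0) l (T 0 k (b i))) =
        a k * gramCoord (fun i ↦ F (b i) 0) l (T 0 k (b i)) := by
      intro k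
      simp only [a]
      rw [Finset.sum_mul]
      exact Finset.sum_congr rfl fun l' _ ↦ by ring
    have h4 : ∑ k, f (T 1 k u) * gramCoord (fun i ↦ F (b i) 1) l (T 1 k (F (b i) 1)) =
        ∑ k, a k * gramCoord (fun i ↦ F (b i) 0) l (T 0 k (b i)) := by
      simp only [← h2, ← h3]
      rw [Finset.sum_comm, Finset.sum_comm (s := (Finset.univ : Finset (Fin 3)))]
      refine Finset.sum_congr rfl fun l' _ ↦ ?_
      rw [← Finset.mul_sum, ← Finset.mul_sum]
      have := key j₀ l' i l
      simp only [hF0] at this ⊢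
      rw [← this]
    rw [← hF1, eB]
    rw [Fin.sum_univ_three, hf.1, hf.2.1, hf.2.2] at h4
    simpa [map_add, map_smul, _root_.add_apply, _root_.smul_apply] using h4
  -- The vectors e i are arbitrary, so the parallel fields starting at them are used instead of
  -- those of the basis.
  · have := det_gramMatrix_mul_momentDensity hn hQ hμ hLC hγ hU (V := fun i ↦ F (e i))
      (fun i ↦ hF' (e i)) (t := 1) (by simp)
    simpa only [hF0, hF1] using this

end Transport

/-! ### The holonomy group -/

section Holonomy

variable {n : ℕ} {M : Type*} [TopologicalSpace M] [ChartedSpace (EuclideanSpace ℝ (Fin n)) M]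
  [IsManifold (𝓡 n) ∞ M] [RiemannianBundle (fun x : M ↦ TangentSpace (𝓡 n) x)]
  {Q : ∀ x : M, Submodule ℝ (TangentSpace (𝓡 n) x →L[ℝ] TangentSpace (𝓡 n) x)}
  {μ : EndField n M}

lemma PreservesStructure.id (x : M) :
    PreservesStructure Q μ (ContinuousLinearMap.id ℝ (TangentSpace (𝓡 n) x)) :=
  ⟨fun _ ↦ rfl, fun B hB ↦ ⟨B, hB, fun _ ↦ rfl⟩, fun _ ↦ rfl⟩

lemma PreservesStructure.comp {x y z : M}
    {P : TangentSpace (𝓡 n) y →L[ℝ] TangentSpace (𝓡 n) z}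
    {R : TangentSpace (𝓡 n) x →L[ℝ] TangentSpace (𝓡 n) y}
    (hP : PreservesStructure Q μ P) (hR : PreservesStructure Q μ R) :
    PreservesStructure Q μ (P.comp R) := by
  refine ⟨fun v ↦ ?_, fun B hB ↦ ?_, fun e ↦ ?_⟩
  · rw [ContinuousLinearMap.comp_apply, hP.structure_apply, hR.structure_apply]
    rfl
  · obtain ⟨B', hB', h'⟩ := hP.exists_comm B hB
    obtain ⟨B'', hB'', h''⟩ := hR.exists_comm B' hB'
    refine ⟨B'', hB'', fun v ↦ ?_⟩
    rw [ContinuousLinearMap.comp_apply, h', h'']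
    rfl
  · exact (hP.volume fun i ↦ R (e i)).trans (hR.volume e)

variable {nabla : ConnOp n M} {X : VField n M} [T2Space M]
  [IsContMDiffRiemannianBundle (𝓡 n) ∞ (EuclideanSpace ℝ (Fin n))
      (fun x : M ↦ TangentSpace (𝓡 n) x)]
  (hn : 0 < n) (hQ : IsQuaternionicKahler nabla Q) (hμ : IsMomentSection nabla Q X μ)
  (hLC : IsLeviCivita nabla)
include hn hQ hμ hLC

lemma IsTransport.preservesStructure (hX : SmoothVOn X univ) {x y : M}
    {P : TangentSpace (𝓡 n) x →L[ℝ] TangentSpace (𝓡 n) y}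
    (h : IsTransport (modConn nabla Q μ) (nonzeroSet μ) x y P) : PreservesStructure Q μ P := by
  induction h with
  | refl _ => exact .id x
  | step γ hγ hU R _ P hP ih =>
    exact (preservesStructure_of_parallel hn hQ hμ hLC
      (fun t ht ↦ (hγ t ht).mdifferentiableWithinAt (by simp)) hU hX hP).comp ih

end Holonomy

/-- Around a loop the densities at the two ends coincide and cancel, which leaves det P² = 1. An
adapted triple gives the identification with ℂ^{2m}, and `QTriple.exists_mem_UStar` concludes. -/
lemma holonomyInUStar_modConn {m : ℕ} (hm : 1 ≤ m) {M : Type*} [TopologicalSpace M] [T2Space M]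
    [ChartedSpace (EuclideanSpace ℝ (Fin (4 * m))) M] [IsManifold (𝓡 (4 * m)) ∞ M]
    [RiemannianBundle (fun x : M ↦ TangentSpace (𝓡 (4 * m)) x)]
    [IsContMDiffRiemannianBundle (𝓡 (4 * m)) ∞ (EuclideanSpace ℝ (Fin (4 * m)))
      (fun x : M ↦ TangentSpace (𝓡 (4 * m)) x)]
    {nabla : ConnOp (4 * m) M} (hLC : IsLeviCivita nabla)
    {Q : ∀ x : M, Submodule ℝ (TangentSpace (𝓡 (4 * m)) x →L[ℝ] TangentSpace (𝓡 (4 * m)) x)}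
    (hQ : IsQuaternionicKahler nabla Q) {X : VField (4 * m) M} (hX : SmoothVOn X univ)
    {μ : EndField (4 * m) M} (hμ : IsMomentSection nabla Q X μ) {x : M} (hx : x ∈ nonzeroSet μ) :
    HolonomyInUStar (modConn nabla Q μ) (nonzeroSet μ) Q (momentStructure μ) x := by
  have hn : 0 < 4 * m := by omega
  have := nontrivial_tangentSpace hn x
  obtain ⟨J, K, h, hs⟩ := exists_adapted_triple hn hQ hμ.mem hx
  obtain ⟨φ, hφI, hφJ⟩ := h.exists_equiv (m := m) (finrank_tangentSpace x)
  refine ⟨φ, hφI, fun B ↦ ?_, fun P hP ↦ ?_⟩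
  · rw [hs, QTriple.mem_span_iff]
    have hφK : ∀ v, φ (K v) = Complex.I • jMap m (φ v) := fun v ↦ by
      rw [← h.I_J, hφI, hφJ]
    refine exists_congr fun a ↦ exists_congr fun b ↦ exists_congr fun c ↦ ?_
    have e : ∀ v, φ ((a • momentStructure μ x + b • J + c • K) v) =
        a • (Complex.I • φ v) + b • jMap m (φ v) + c • (Complex.I • jMap m (φ v)) := fun v ↦ by
      rw [_root_.add_apply, _root_.add_apply, _root_.smul_apply, _root_.smul_apply,
        _root_.smul_apply, map_add, map_add, map_smul, map_smul, map_smul, hφI, hφJ, hφK]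
    constructor
    · rintro rfl v
      exact e v
    · intro hB
      ext1 v
      exact φ.injective ((hB v).trans (e v).symm)
  · have hp := IsTransport.preservesStructure hn hQ hμ hLC hX hP
    refine h.exists_mem_UStar hφI hφJ (fun v ↦ (hp.structure_apply v).symm) ?_ ?_
    · obtain ⟨B, hB, hB'⟩ := hp.exists_comm J (hs ▸ Submodule.subset_span (by simp))
      exact ⟨B, hs ▸ hB, hB'⟩
    · let b : OrthonormalBasis (Fin (4 * m)) ℝ (TangentSpace (𝓡 (4 * m)) x) :=
        (stdOrthonormalBasis ℝ (TangentSpace (𝓡 (4 * m)) x)).reindex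
          (finCongr (finrank_tangentSpace x))
      have h1 := mul_right_cancel₀ (Real.exp_ne_zero _) (hp.volume b)
      rw [det_gramMatrix_orthonormal] at h1
      exact (det_gramMatrix_comp b P.toLinearMap).symm.trans h1

/-! ### Curvature under a conformal change -/

section Curvature

variable {n : ℕ} {M : Type*} [TopologicalSpace M] [ChartedSpace (EuclideanSpace ℝ (Fin n)) M]
  [IsManifold (𝓡 n) ∞ M]

/-- Connections and brackets depend only on germs. This allows frames defined on M₀ to be replaced
by global ones, on which the Einstein condition is tested. -/
lemma curvature_congr [T2Space M] {D : ConnOp n M} {U : Set M} (hU : IsOpen U)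
    (hD : IsAffineConnectionOn D U)
    {x : M} (hx : x ∈ U) {Y Z W Y' Z' W' : VField n M} (hY : SmoothVOn Y U) (hZ : SmoothVOn Z U)
    (hW : SmoothVOn W U) (eY : ∀ᶠ y in 𝓝 x, Y' y = Y y) (eZ : ∀ᶠ y in 𝓝 x, Z' y = Z y)
    (eW : ∀ᶠ y in 𝓝 x, W' y = W y) : curvature D Y' Z' W' x = curvature D Y Z W x := by
  have hWs := hD.smoothEndOn hU hU subset_rfl hW
  have h1 : ∀ᶠ y in 𝓝 x, D W' y = D W y := by
    filter_upwards [eW.eventually_nhds, hU.mem_nhds hx] with y hy hyU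
    exact hD.congr (hU.mem_nhds hyU) (hW.diffVAt (hU.mem_nhds hyU)) hy
  have h2 : ∀ {Z Z' : VField n M}, SmoothVOn Z U → (∀ᶠ y in 𝓝 x, Z' y = Z y) →
      D (fun y ↦ D W' y (Z' y)) x = D (fun y ↦ D W y (Z y)) x := by
    intro Z Z' hZ eZ
    refine hD.congr (hU.mem_nhds hx) ((hWs.apply hZ).diffVAt (hU.mem_nhds hx)) ?_
    filter_upwards [h1, eZ] with y hy hy'
    rw [hy, hy']
  have h3 : mlieBracket (𝓡 n) Y' Z' x = mlieBracket (𝓡 n) Y Z x :=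
    Filter.EventuallyEq.mlieBracket_vectorField_eq eY eZ
  rw [curvature, curvature, h2 hZ eZ, h2 hY eY, h3, h1.self_of_nhds, eY.self_of_nhds,
    eZ.self_of_nhds]

variable [RiemannianBundle (fun x : M ↦ TangentSpace (𝓡 n) x)]
  [IsContMDiffRiemannianBundle (𝓡 n) ∞ (EuclideanSpace ℝ (Fin n))
      (fun x : M ↦ TangentSpace (𝓡 n) x)]
  [T2Space M] {nabla : ConnOp n M} (hLC : IsLeviCivita nabla)
  {D : ConnOp n M} {U : Set M} (hU : IsOpen U) {b : VField n M} (hb : SmoothVOn b U)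
  (hD : ∀ y ∈ U, ∀ (Y : VField n M) (z : TangentSpace (𝓡 n) y), D Y y z = nabla Y y z
    + (inner ℝ (b y) z : ℝ) • Y y + (inner ℝ (b y) (Y y) : ℝ) • z - (inner ℝ z (Y y) : ℝ) • b y)
include hLC hU hb hD

lemma conformal_second_derivative {x : M} (hx : x ∈ U) {Z W : VField n M} (hZ : SmoothVOn Z U)
    (hW : SmoothVOn W U) (v : TangentSpace (𝓡 n) x) :
    D (fun y ↦ D W y (Z y)) x v = nabla (fun y ↦ nabla W y (Z y)) x v
      + ((inner ℝ (b x) (Z x) : ℝ) • nabla W x v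
        + (inner ℝ (nabla b x v) (Z x) + inner ℝ (b x) (nabla Z x v) : ℝ) • W x)
      + ((inner ℝ (b x) (W x) : ℝ) • nabla Z x v
        + (inner ℝ (nabla b x v) (W x) + inner ℝ (b x) (nabla W x v) : ℝ) • Z x)
      - ((inner ℝ (Z x) (W x) : ℝ) • nabla b x v
        + (inner ℝ (nabla Z x v) (W x) + inner ℝ (Z x) (nabla W x v) : ℝ) • b x)
      + (inner ℝ (b x) v : ℝ) • D W x (Z x) + (inner ℝ (b x) (D W x (Z x)) : ℝ) • v
      - (inner ℝ v (D W x (Z x)) : ℝ) • b x := by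
  have hN := hU.mem_nhds hx
  have hWs := hLC.conn.smoothEndOn isOpen_univ hU (subset_univ _) hW
  have dZ := hZ.diffVAt hN
  have dW := hW.diffVAt hN
  have db := hb.diffVAt hN
  have d0 := (hWs.apply hZ).diffVAt hN
  have d1 := dW.smul (db.inner dZ)
  have d2 := dZ.smul (db.inner dW)
  have d3 := db.smul (dZ.inner dW)
  have e : nabla (fun y ↦ D W y (Z y)) x = nabla (fun y ↦ nabla W y (Z y)
      + (inner ℝ (b y) (Z y) : ℝ) • W y + (inner ℝ (b y) (W y) : ℝ) • Z y
      - (inner ℝ (Z y) (W y) : ℝ) • b y) x := by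
    refine hLC.conn.congr Filter.univ_mem (((d0.add d1).add d2).sub d3) ?_
    filter_upwards [hN] with y hy using hD y hy W (Z y)
  rw [hD x hx (fun y ↦ D W y (Z y)), e,
    hLC.conn.sub (mem_univ x) ((d0.add d1).add d2) d3,
    hLC.conn.add (mem_univ x) (d0.add d1) d2, hLC.conn.add (mem_univ x) d0 d1,
    hLC.conn.smul (mem_univ x) (db.inner dZ) dW, hLC.conn.smul (mem_univ x) (db.inner dW) dZ,
    hLC.conn.smul (mem_univ x) (dZ.inner dW) db, hLC.metric x _ _ db dZ, hLC.metric x _ _ db dW,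
    hLC.metric x _ _ dZ dW]

/-- The curvature of the Levi-Civita connection of a conformal metric. -/
lemma curvature_conformal {x : M} (hx : x ∈ U) {Y Z W : VField n M} (hY : SmoothVOn Y U)
    (hZ : SmoothVOn Z U) (hW : SmoothVOn W U) :
    curvature D Y Z W x = curvature nabla Y Z W x
      + (inner ℝ (nabla b x (Y x)) (Z x) - inner ℝ (nabla b x (Z x)) (Y x) : ℝ) • W x
      + (inner ℝ (nabla b x (Y x)) (W x) : ℝ) • Z x - (inner ℝ (nabla b x (Z x)) (W x) : ℝ) • Y x
      - (inner ℝ (Z x) (W x) : ℝ) • nabla b x (Y x) + (inner ℝ (Y x) (W x) : ℝ) • nabla b x (Z x)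
      + (inner ℝ (b x) (Z x) * inner ℝ (b x) (W x) : ℝ) • Y x
      - (inner ℝ (b x) (Y x) * inner ℝ (b x) (W x) : ℝ) • Z x
      - (inner ℝ (b x) (b x) : ℝ) • ((inner ℝ (Z x) (W x) : ℝ) • Y x
          - (inner ℝ (Y x) (W x) : ℝ) • Z x)
      + (inner ℝ (b x) (Y x) * inner ℝ (Z x) (W x)
          - inner ℝ (b x) (Z x) * inner ℝ (Y x) (W x) : ℝ) • b x := by
  have hN := hU.mem_nhds hx
  have hbr := hLC.torsionFree x (mem_univ x) Y Z (hY.diffVAt hN) (hZ.diffVAt hN)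
  rw [curvature, curvature, conformal_second_derivative hLC hU hb hD hx hZ hW,
    conformal_second_derivative hLC hU hb hD hx hY hW, hD x hx W, hD x hx W, hD x hx W]
  -- The bracket of Y and Z contributes through D_{[Y,Z]}W; torsion-freeness expresses it by first
  -- derivatives, which cancel those coming from the second derivatives.
  have e1 : (inner ℝ (b x) (mlieBracket (𝓡 n) Y Z x) : ℝ) =
      inner ℝ (b x) (nabla Z x (Y x)) - inner ℝ (b x) (nabla Y x (Z x)) := by
    rw [← hbr, inner_sub_right]
  have e2 : (inner ℝ (mlieBracket (𝓡 n) Y Z x) (W x) : ℝ) =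
      inner ℝ (nabla Z x (Y x)) (W x) - inner ℝ (nabla Y x (Z x)) (W x) := by
    rw [← hbr, inner_sub_left]
  have e3 : (inner ℝ (b x) (W x) : ℝ) • mlieBracket (𝓡 n) Y Z x =
      (inner ℝ (b x) (W x) : ℝ) • (nabla Z x (Y x) - nabla Y x (Z x)) := by
    rw [← hbr]
  rw [e1, e2, e3]
  simp only [inner_add_right, inner_sub_right, real_inner_smul_right]
  rw [real_inner_comm (b x) (Y x), real_inner_comm (b x) (Z x), real_inner_comm (Z x) (Y x)]
  module

/-- The double trace of `curvature_conformal`. The antisymmetric part of ∇b drops out, so b need not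
be a gradient here. The last coefficient is −(n−1)(n−2). -/
lemma scalar_conformal {x : M} (hx : x ∈ U) {e : Fin n → VField n M} (he : ∀ i, SmoothVOn (e i) U)
    (ho : Orthonormal ℝ fun i ↦ e i x) :
    ∑ i, ∑ j, (inner ℝ (curvature D (e j) (e i) (e i) x) (e j x) : ℝ) =
      ∑ i, ∑ j, (inner ℝ (curvature nabla (e j) (e i) (e i) x) (e j x) : ℝ)
      + (2 - 2 * n) * ∑ i, (inner ℝ (nabla b x (e i x)) (e i x) : ℝ)
      + (3 * n - 2 - n ^ 2) * inner ℝ (b x) (b x) := by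
  have hδ : ∀ i j, (inner ℝ (e i x) (e j x) : ℝ) = if i = j then 1 else 0 :=
    orthonormal_iff_ite.1 ho
  have hB : (inner ℝ (b x) (b x) : ℝ) = ∑ i, (inner ℝ (b x) (e i x) : ℝ) * inner ℝ (b x) (e i x) := by
    let ob : OrthonormalBasis (Fin n) ℝ (TangentSpace (𝓡 n) x) :=
      OrthonormalBasis.mk ho (by
        rw [ho.linearIndependent.span_eq_top_of_card_eq_finrank'
          (by rw [finrank_tangentSpace, Fintype.card_fin])])
    rw [← ob.sum_inner_mul_inner (b x) (b x)]
    refine Finset.sum_congr rfl fun i _ ↦ ?_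
    simp only [ob, OrthonormalBasis.coe_mk]
    rw [real_inner_comm (b x) (e i x)]
  have key : ∀ i j, (inner ℝ (curvature D (e j) (e i) (e i) x) (e j x) : ℝ) =
      inner ℝ (curvature nabla (e j) (e i) (e i) x) (e j x)
      + (if i = j then (2 * inner ℝ (nabla b x (e i x)) (e i x) : ℝ) else 0)
      - inner ℝ (nabla b x (e i x)) (e i x) - inner ℝ (nabla b x (e j x)) (e j x)
      + inner ℝ (b x) (e i x) * inner ℝ (b x) (e i x)
      + inner ℝ (b x) (e j x) * inner ℝ (b x) (e j x)
      - inner ℝ (b x) (b x)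
      + (if i = j then (inner ℝ (b x) (b x) - 2 * inner ℝ (b x) (e i x) * inner ℝ (b x) (e i x) : ℝ)
        else 0) := by
    intro i j
    rw [curvature_conformal hLC hU hb hD hx (he j) (he i) (he i)]
    simp only [inner_add_left, inner_sub_left, real_inner_smul_left, hδ]
    rcases eq_or_ne i j with rfl | hij
    · simp
      ring
    · simp [hij, hij.symm]
      ring
  simp only [key, Finset.sum_add_distrib, Finset.sum_sub_distrib, Finset.sum_ite_eq,
    Finset.mem_univ, if_true, Finset.sum_const, Finset.card_univ, Fintype.card_fin, nsmul_eq_mul,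
    ← Finset.mul_sum, mul_assoc, ← hB]
  ring

end Curvature

/-! ### Scalar flatness in dimension four -/

/-- The tensor `∑ g(I_i u, z) I_i v`. -/
def tau {V : Type*} [NormedAddCommGroup V] [InnerProductSpace ℝ V] (I J K : V →L[ℝ] V)
    (u z v : V) : V :=
  (inner ℝ (I u) z : ℝ) • I v + (inner ℝ (J u) z : ℝ) • J v + (inner ℝ (K u) z : ℝ) • K v

lemma QTriple.tau_invariant {V : Type*} [NormedAddCommGroup V] [InnerProductSpace ℝ V]
    [Nontrivial V] {I J K I' J' K' : V →L[ℝ] V} (h : QTriple I J K) (h' : QTriple I' J' K')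
    (hI : I' ∈ Submodule.span ℝ {I, J, K}) (hJ : J' ∈ Submodule.span ℝ {I, J, K})
    (hK : K' ∈ Submodule.span ℝ {I, J, K}) (u z v : V) :
    tau I' J' K' u z v = tau I J K u z v := by
  have := h.sum_invariant h' hI hJ hK
    ((innerSL ℝ z).toLinearMap.comp (ContinuousLinearMap.apply ℝ V u).toLinearMap)
    (ContinuousLinearMap.apply ℝ V v).toLinearMap
  simpa [tau, real_inner_comm] using this

section

variable {n : ℕ} {M : Type*} [TopologicalSpace M] [ChartedSpace (EuclideanSpace ℝ (Fin n)) M]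
  [IsManifold (𝓡 n) ∞ M] [RiemannianBundle (fun x : M ↦ TangentSpace (𝓡 n) x)]
  [IsContMDiffRiemannianBundle (𝓡 n) ∞ (EuclideanSpace ℝ (Fin n))
      (fun x : M ↦ TangentSpace (𝓡 n) x)] [T2Space M]
  {nabla : ConnOp n M}
  {Q : ∀ x : M, Submodule ℝ (TangentSpace (𝓡 n) x →L[ℝ] TangentSpace (𝓡 n) x)}
  {X : VField n M} {μ : EndField n M}
  (hn : 0 < n) (hQ : IsQuaternionicKahler nabla Q) (hμ : IsMomentSection nabla Q X μ)
  (hLC : IsLeviCivita nabla) (hX : SmoothVOn X univ)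
include hn hQ hμ hLC hX

/-- ∇μ is a tensor in X with coefficients ∑ I_i ⊗ I_i, and this sum is parallel: by `sum_derivative`
the derivatives of a local triple contribute nothing. Only X, Z and V are differentiated. -/
lemma nabla_nabla_moment {x : M} {I J K : TangentSpace (𝓡 n) x →L[ℝ] TangentSpace (𝓡 n) x}
    (h : QTriple I J K) (hs : Q x = Submodule.span ℝ {I, J, K})
    {Z V : VField n M} (hZ : SmoothVOn Z univ) (hV : SmoothVOn V univ)
    (w : TangentSpace (𝓡 n) x) :
    nabla (fun y ↦ nabla (fun y ↦ μ y (V y)) y (Z y)) x w =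
      tau I J K (nabla X x w) (Z x) (V x) + tau I J K (X x) (nabla Z x w) (V x)
      + tau I J K (X x) (Z x) (nabla V x w) + tau I J K (X x) w (nabla V x (Z x))
      + μ x (nabla (fun y ↦ nabla V y (Z y)) x w) := by
  have := nontrivial_tangentSpace hn x
  obtain ⟨W, hW, hxW, I', J', K', sI, sJ, sK, hq⟩ := hQ.almostQuaternionic x
  obtain ⟨A, hA, B, hB, C, hC, dA, dB, dC, r1, r2, r3, r4⟩ := exists_triple_deriv hLC.conn
    isOpen_univ hQ.parallel hW sI sJ sK hq (mem_univ x) hxW w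
  have hN := hW.mem_nhds hxW
  have hinv : ∀ u z v, tau I J K u z v = tau (I' x) (J' x) (K' x) u z v := by
    have hm := hs.symm.trans (hq x hxW).2
    exact QTriple.tau_invariant (hq x hxW).1 h (hm ▸ Submodule.subset_span (by simp))
      (hm ▸ Submodule.subset_span (by simp)) (hm ▸ Submodule.subset_span (by simp))
  simp only [hinv]
  have hmem : ∀ y ∈ W, I' y ∈ Q y ∧ J' y ∈ Q y ∧ K' y ∈ Q y := by
    intro y hy
    rw [(hq y hy).2]
    refine ⟨?_, ?_, ?_⟩ <;> exact Submodule.subset_span (by simp)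
  have hmom : ∀ y ∈ W, ∀ (z : TangentSpace (𝓡 n) y) (V : VField n M), DiffVAt V y →
      nabla (fun y ↦ μ y (V y)) y z = tau (I' y) (J' y) (K' y) (X y) z (V y)
        + μ y (nabla V y z) := by
    intro y hy z V hV
    obtain ⟨m1, m2, m3⟩ := hmem y hy
    exact hμ.deriv_eq y _ m1 _ m2 _ m3 (hq y hy).1 z V hV
  have dV := hV.diffVAt (x := x) Filter.univ_mem
  have dZ := hZ.diffVAt (x := x) Filter.univ_mem
  have dX := hX.diffVAt (x := x) Filter.univ_mem
  have hVs := (hLC.conn.smoothEndOn isOpen_univ isOpen_univ subset_rfl hV).apply hZ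
  have dVZ := hVs.diffVAt (x := x) Filter.univ_mem
  have dμVZ := (hμ.smooth.apply hVs).diffVAt (x := x) Filter.univ_mem
  have fd : ∀ {A : EndField n M}, SmoothEndOn A W →
      MDifferentiableAt (𝓡 n) 𝓘(ℝ, ℝ) (fun y ↦ (inner ℝ (A y (X y)) (Z y) : ℝ)) x :=
    fun hA ↦ (hA.diffVAt hN dX).inner dZ
  have d1 := fun {A : EndField n M} (hA : SmoothEndOn A W) ↦ (hA.diffVAt hN dV).smul (fd hA)
  have hterm : ∀ {A : EndField n M} {B : TangentSpace (𝓡 n) x →L[ℝ] TangentSpace (𝓡 n) x},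
      SmoothEndOn A W → IsEndDeriv nabla A x w B →
      nabla (fun y ↦ (inner ℝ (A y (X y)) (Z y) : ℝ) • A y (V y)) x w =
        (inner ℝ (A x (X x)) (Z x) : ℝ) • (B (V x) + A x (nabla V x w))
        + (inner ℝ (B (X x) + A x (nabla X x w)) (Z x)
          + inner ℝ (A x (X x)) (nabla Z x w) : ℝ) • A x (V x) := by
    intro A B hA hB
    rw [hLC.conn.smul (mem_univ x) (fd hA) (hA.diffVAt hN dV), hB V dV,
      hLC.metric x _ _ (hA.diffVAt hN dX) dZ, hB X dX]
  have e : nabla (fun y ↦ nabla (fun y ↦ μ y (V y)) y (Z y)) x =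
      nabla (fun y ↦ (inner ℝ (I' y (X y)) (Z y) : ℝ) • I' y (V y)
        + (inner ℝ (J' y (X y)) (Z y) : ℝ) • J' y (V y)
        + (inner ℝ (K' y (X y)) (Z y) : ℝ) • K' y (V y) + μ y (nabla V y (Z y))) x := by
    refine hLC.conn.congr Filter.univ_mem ((((d1 sI).add (d1 sJ)).add (d1 sK)).add dμVZ) ?_
    filter_upwards [hN] with y hy
    exact hmom y hy (Z y) V (hV.diffVAt Filter.univ_mem)
  rw [e, hLC.conn.add (mem_univ x) (((d1 sI).add (d1 sJ)).add (d1 sK)) dμVZ,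
    hLC.conn.add (mem_univ x) ((d1 sI).add (d1 sJ)) (d1 sK),
    hLC.conn.add (mem_univ x) (d1 sI) (d1 sJ), hterm sI dA, hterm sJ dB, hterm sK dC,
    hmom x hxW w _ dVZ]
  have hz := QTriple.sum_derivative (hq x hxW).1 ((hq x hxW).2 ▸ hA) ((hq x hxW).2 ▸ hB) r1 r2 r3 r4
    ((innerSL ℝ (Z x)).toLinearMap.comp (ContinuousLinearMap.apply ℝ _ (X x)).toLinearMap)
    (ContinuousLinearMap.apply ℝ _ (V x)).toLinearMap
  have hz' : (inner ℝ (A (X x)) (Z x) : ℝ) • I' x (V x) + (inner ℝ (I' x (X x)) (Z x) : ℝ) • A (V x)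
      + ((inner ℝ (B (X x)) (Z x) : ℝ) • J' x (V x)
        + (inner ℝ (J' x (X x)) (Z x) : ℝ) • B (V x))
      + ((inner ℝ (C (X x)) (Z x) : ℝ) • K' x (V x)
        + (inner ℝ (K' x (X x)) (Z x) : ℝ) • C (V x)) = 0 := by
    simpa [real_inner_comm] using hz
  simp only [tau, inner_add_left]
  linear_combination (norm := module) hz'

/-- The curvature of `μ`. -/
lemma curvature_moment {x : M} {I J K : TangentSpace (𝓡 n) x →L[ℝ] TangentSpace (𝓡 n) x}
    (h : QTriple I J K) (hs : Q x = Submodule.span ℝ {I, J, K})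
    {Y Z V : VField n M} (hY : SmoothVOn Y univ) (hZ : SmoothVOn Z univ) (hV : SmoothVOn V univ) :
    curvature nabla Y Z (fun y ↦ μ y (V y)) x = μ x (curvature nabla Y Z V x)
      + tau I J K (nabla X x (Y x)) (Z x) (V x) - tau I J K (nabla X x (Z x)) (Y x) (V x) := by
  have mI : I ∈ Q x := hs ▸ Submodule.subset_span (by simp)
  have mJ : J ∈ Q x := hs ▸ Submodule.subset_span (by simp)
  have mK : K ∈ Q x := hs ▸ Submodule.subset_span (by simp)
  have hbr := hLC.torsionFree x (mem_univ x) Y Z (hY.diffVAt Filter.univ_mem)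
    (hZ.diffVAt Filter.univ_mem)
  have e := hμ.deriv_eq x I mI J mJ K mK h (mlieBracket (𝓡 n) Y Z x) V
    (hV.diffVAt Filter.univ_mem)
  rw [curvature, curvature, nabla_nabla_moment hn hQ hμ hLC hX h hs hZ hV,
    nabla_nabla_moment hn hQ hμ hLC hX h hs hY hV, e]
  have e2 : ∀ u, (inner ℝ u (mlieBracket (𝓡 n) Y Z x) : ℝ) =
      inner ℝ u (nabla Z x (Y x)) - inner ℝ u (nabla Y x (Z x)) := by
    intro u
    rw [← hbr, inner_sub_right]
  simp only [tau, _root_.add_apply, _root_.smul_apply, e2, map_sub]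
  module

end

lemma _root_.OrthonormalBasis.sum_inner_comp_comm {V ι : Type*} [NormedAddCommGroup V]
    [InnerProductSpace ℝ V] [Fintype ι] (b : OrthonormalBasis ι ℝ V) (S T : V →L[ℝ] V) :
    ∑ i, (inner ℝ (S (T (b i))) (b i) : ℝ) = ∑ i, (inner ℝ (T (S (b i))) (b i) : ℝ) := by
  have h := LinearMap.trace_mul_comm ℝ S.toLinearMap T.toLinearMap
  rw [LinearMap.trace_eq_sum_inner _ b, LinearMap.trace_eq_sum_inner _ b] at h
  simpa [real_inner_comm] using h

/-- For B = ∇X this is the contraction of the ∇X terms in the curvature of μ with J. Only the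
coefficient of K is needed later; cyclicity of the trace and JK = I make its two halves equal. -/
lemma QTriple.sum_tau {V ι : Type*} [NormedAddCommGroup V]
    [InnerProductSpace ℝ V] [Fintype ι] {I J K : V →L[ℝ] V} (h : QTriple I J K)
    (sJ : ∀ v w, (inner ℝ (J v) w : ℝ) = -inner ℝ v (J w)) (e : OrthonormalBasis ι ℝ V)
    (B : V →L[ℝ] V) (v : V) :
    ∃ p q : ℝ, ∑ i, (tau I J K (B (e i)) (J (e i)) v - tau I J K (B (J (e i))) (e i) v) =
      p • I v + q • J v + (-2 * ∑ i, (inner ℝ (I (B (e i))) (e i) : ℝ)) • K v := by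
  refine ⟨∑ i, (inner ℝ (I (B (e i))) (J (e i)) - inner ℝ (I (B (J (e i)))) (e i) : ℝ),
    ∑ i, (inner ℝ (J (B (e i))) (J (e i)) - inner ℝ (J (B (J (e i)))) (e i) : ℝ), ?_⟩
  have h1 : -2 * ∑ i, (inner ℝ (I (B (e i))) (e i) : ℝ) =
      ∑ i, (inner ℝ (K (B (e i))) (J (e i)) - inner ℝ (K (B (J (e i)))) (e i) : ℝ) := by
    have h2 := e.sum_inner_comp_comm (K.comp B) J
    simp only [ContinuousLinearMap.comp_apply, h.J_K] at h2
    have h3 : ∀ i, (inner ℝ (K (B (e i))) (J (e i)) : ℝ) = -inner ℝ (I (B (e i))) (e i) := by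
      intro i
      rw [← h.J_K, sJ, neg_neg]
    rw [Finset.sum_sub_distrib, h2]
    simp only [h3, Finset.sum_neg_distrib]
    ring
  rw [h1]
  simp only [Finset.sum_smul, ← Finset.sum_add_distrib]
  refine Finset.sum_congr rfl fun i _ ↦ ?_
  simp only [tau]
  module

section

variable {n : ℕ} {M : Type*} [TopologicalSpace M] [ChartedSpace (EuclideanSpace ℝ (Fin n)) M]
  [IsManifold (𝓡 n) ∞ M] [RiemannianBundle (fun x : M ↦ TangentSpace (𝓡 n) x)]

/-- An orthonormal family of `n` tangent vectors is a basis. -/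
def tangentBasis {x : M} {e : Fin n → TangentSpace (𝓡 n) x} (ho : Orthonormal ℝ e) :
    OrthonormalBasis (Fin n) ℝ (TangentSpace (𝓡 n) x) :=
  OrthonormalBasis.mk ho (by
    rw [ho.linearIndependent.span_eq_top_of_card_eq_finrank'
      (by rw [finrank_tangentSpace, Fintype.card_fin])])

lemma tangentBasis_apply {x : M} {e : Fin n → TangentSpace (𝓡 n) x} (ho : Orthonormal ℝ e)
    (i : Fin n) : tangentBasis ho i = e i := by
  simp [tangentBasis]

lemma sum_inner_mul_inner_self {x : M} {e : Fin n → TangentSpace (𝓡 n) x} (ho : Orthonormal ℝ e)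
    (u v : TangentSpace (𝓡 n) x) :
    ∑ i, (inner ℝ u (e i) * inner ℝ v (e i) : ℝ) = inner ℝ u v := by
  rw [← (tangentBasis ho).sum_inner_mul_inner u v]
  simp only [tangentBasis_apply, real_inner_comm]

variable [IsContMDiffRiemannianBundle (𝓡 n) ∞ (EuclideanSpace ℝ (Fin n))
      (fun x : M ↦ TangentSpace (𝓡 n) x)] [T2Space M]
  {nabla : ConnOp n M}
  {Q : ∀ x : M, Submodule ℝ (TangentSpace (𝓡 n) x →L[ℝ] TangentSpace (𝓡 n) x)}
  {X : VField n M} {μ : EndField n M}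
  (hn : 0 < n) (hQ : IsQuaternionicKahler nabla Q) (hμ : IsMomentSection nabla Q X μ)
  (hLC : IsLeviCivita nabla) (hX : SmoothVOn X univ)
include hn hQ hμ hLC

/-- The gradient of `-log |μ|`. -/
abbrev logGradient (μ : EndField n M) (X : VField n M) : VField n M :=
  fun y ↦ (-(momentNorm μ y ^ 2)⁻¹) • μ y (X y)

omit hLC in
lemma contMDiffOn_inv_momentNorm_sq :
    ContMDiffOn (𝓡 n) 𝓘(ℝ, ℝ) ∞ (fun y ↦ -(momentNorm μ y ^ 2)⁻¹) (nonzeroSet μ) :=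
  ((contMDiff_momentNorm_sq hn hQ hμ).contMDiffOn.inv₀ fun _ hx ↦
      momentNorm_sq_ne_zero hn hQ hμ.mem hx).neg

omit hLC in
lemma smoothVOn_logGradient (hX : SmoothVOn X univ) :
    SmoothVOn (logGradient μ X) (nonzeroSet μ) :=
  SmoothVOn.smul (contMDiffOn_inv_momentNorm_sq hn hQ hμ)
    ((hμ.smooth.apply hX).mono (subset_univ _))

lemma mvfderiv_inv_momentNorm_sq {x : M} (hx : x ∈ nonzeroSet μ) (z : TangentSpace (𝓡 n) x) :
    mvfderiv (𝓡 n) (fun y ↦ (momentNorm μ y ^ 2)⁻¹) x z =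
      2 * (momentNorm μ x ^ 2)⁻¹ * inner ℝ (logGradient μ X x) z := by
  have h0 := momentNorm_sq_ne_zero hn hQ hμ.mem hx
  rw [mvfderiv_comp_real (f := fun y ↦ momentNorm μ y ^ 2) (hasDerivAt_inv h0)
    ((contMDiff_momentNorm_sq hn hQ hμ).mdifferentiable (by simp) x),
    mvfderiv_momentNorm_sq hn hQ hμ hLC, real_inner_smul_left]
  field_simp

/-- Since 2α is dual to the gradient of −log|μ|, `oneForm_of_finrank_eq_four` gives the difference
tensor of the conformal change with factor |μ|⁻². -/
lemma modConn_of_eq_four (h4 : n = 4) {x : M} (hx : x ∈ nonzeroSet μ) (Y : VField n M)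
    (z : TangentSpace (𝓡 n) x) :
    modConn nabla Q μ Y x z = nabla Y x z + (inner ℝ (logGradient μ X x) z : ℝ) • Y x
      + (inner ℝ (logGradient μ X x) (Y x) : ℝ) • z
      - (inner ℝ z (Y x) : ℝ) • logGradient μ X x := by
  obtain ⟨I, J, K, h, hs⟩ := exists_triple hn hQ hμ.mem x
  have mI : I ∈ Q x := hs ▸ Submodule.subset_span (by simp)
  have mJ : J ∈ Q x := hs ▸ Submodule.subset_span (by simp)
  have mK : K ∈ Q x := hs ▸ Submodule.subset_span (by simp)
  have hα : ∀ v, momentFormL μ x v = inner ℝ ((1 / 2 : ℝ) • logGradient μ X x) v := by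
    intro v
    rw [momentFormL_apply, momentForm_apply hn hQ hμ hLC hx, real_inner_smul_left,
      real_inner_smul_left]
    ring
  have hα' : ∀ v, 2 * momentFormL μ x v = inner ℝ (logGradient μ X x) v := by
    intro v
    rw [hα, real_inner_smul_left]
    ring
  rw [modConn_apply, modTensor_eq hn h hs, h.oneForm_of_finrank_eq_four (hQ.skew x I mI)
    (hQ.skew x J mJ) (hQ.skew x K mK) (by rw [finrank_tangentSpace, h4]) hα, hα', hα']
  module

/-- The derivative of |μ|⁻² supplies the trace part 2g(b, v)g(Y, Z), with b the gradient of −log|μ|;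
the remaining terms of the difference tensor are skew in Y and Z. -/
lemma modConn_metric (h4 : n = 4) {x : M} (hx : x ∈ nonzeroSet μ) {Y Z : VField n M}
    (hY : DiffVAt Y x) (hZ : DiffVAt Z x) (v : TangentSpace (𝓡 n) x) :
    mvfderiv (𝓡 n) (fun y ↦ (momentNorm μ y ^ 2)⁻¹ * (inner ℝ (Y y) (Z y) : ℝ)) x v =
      (momentNorm μ x ^ 2)⁻¹ * (inner ℝ (modConn nabla Q μ Y x v) (Z x)
        + inner ℝ (Y x) (modConn nabla Q μ Z x v) : ℝ) := by
  have hN : MDifferentiableAt (𝓡 n) 𝓘(ℝ, ℝ) (fun y ↦ (momentNorm μ y ^ 2)⁻¹) x :=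
    (((contMDiff_momentNorm_sq hn hQ hμ).contMDiffAt.inv₀
      (momentNorm_sq_ne_zero hn hQ hμ.mem hx))).mdifferentiableAt (by simp)
  rw [mvfderiv_fun_mul hN (hY.inner hZ), _root_.add_apply, _root_.smul_apply, _root_.smul_apply,
    hLC.metric x _ _ hY hZ, mvfderiv_inv_momentNorm_sq hn hQ hμ hLC hx,
    modConn_of_eq_four hn hQ hμ hLC h4 hx, modConn_of_eq_four hn hQ hμ hLC h4 hx]
  simp only [inner_add_left, inner_sub_left, inner_add_right, inner_sub_right,
    real_inner_smul_left, real_inner_smul_right, smul_eq_mul]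
  rw [real_inner_comm v (Y x), real_inner_comm (μ x (X x)) (Y x)]
  ring

include hX

/-- The divergence of the gradient of `-log |μ|`. -/
lemma divergence_logGradient {x : M} (hx : x ∈ nonzeroSet μ) {e : Fin n → TangentSpace (𝓡 n) x}
    (ho : Orthonormal ℝ e) :
    ∑ i, (inner ℝ (nabla (logGradient μ X) x (e i)) (e i) : ℝ) =
      -(momentNorm μ x ^ 2)⁻¹ * (inner ℝ (X x) (X x)
        + ∑ i, (inner ℝ (μ x (nabla X x (e i))) (e i) : ℝ)) := by
  have h0 := momentNorm_sq_ne_zero hn hQ hμ.mem hx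
  have hN := (isOpen_nonzeroSet hn hQ hμ).mem_nhds hx
  obtain ⟨I, J, K, h, hs⟩ := exists_triple hn hQ hμ.mem x
  have mI : I ∈ Q x := hs ▸ Submodule.subset_span (by simp)
  have mJ : J ∈ Q x := hs ▸ Submodule.subset_span (by simp)
  have mK : K ∈ Q x := hs ▸ Submodule.subset_span (by simp)
  have dX := hX.diffVAt (x := x) Filter.univ_mem
  have dμX := hμ.smooth.diffVAt Filter.univ_mem dX
  have df : MDifferentiableAt (𝓡 n) 𝓘(ℝ, ℝ) (fun y ↦ -(momentNorm μ y ^ 2)⁻¹) x :=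
    ((contMDiffOn_inv_momentNorm_sq hn hQ hμ).contMDiffAt hN).mdifferentiableAt (by simp)
  have hd : ∀ z, mvfderiv (𝓡 n) (fun y ↦ -(momentNorm μ y ^ 2)⁻¹) x z =
      2 * ((momentNorm μ x ^ 2)⁻¹) ^ 2 * inner ℝ (μ x (X x)) z := by
    intro z
    rw [mvfderiv_comp_real (f := fun y ↦ momentNorm μ y ^ 2) (g := fun t ↦ -t⁻¹)
      (hasDerivAt_inv h0).neg
      ((contMDiff_momentNorm_sq hn hQ hμ).mdifferentiable (by simp) x),
      mvfderiv_momentNorm_sq hn hQ hμ hLC]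
    field_simp
  have sq : ∀ {A : TangentSpace (𝓡 n) x →L[ℝ] TangentSpace (𝓡 n) x}, A ∈ Q x →
      (∀ v, A (A v) = -v) → (inner ℝ (A (X x)) (A (X x)) : ℝ) = inner ℝ (X x) (X x) := by
    intro A hA hAA
    rw [hQ.skew x A hA, hAA, inner_neg_right, neg_neg]
  -- The derivative of μ contributes the three squares, which sum to 3|X|²; the derivative of |μ|⁻²
  -- takes off 2|X|² because |μX|² = |μ|²|X|². The coefficient 1 of |X|² results.
  have key : ∀ i, (inner ℝ (nabla (logGradient μ X) x (e i)) (e i) : ℝ) =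
      -(momentNorm μ x ^ 2)⁻¹ * (inner ℝ (I (X x)) (e i) * inner ℝ (I (X x)) (e i)
        + inner ℝ (J (X x)) (e i) * inner ℝ (J (X x)) (e i)
        + inner ℝ (K (X x)) (e i) * inner ℝ (K (X x)) (e i)
        + inner ℝ (μ x (nabla X x (e i))) (e i))
      + 2 * ((momentNorm μ x ^ 2)⁻¹) ^ 2
        * (inner ℝ (μ x (X x)) (e i) * inner ℝ (μ x (X x)) (e i)) := by
    intro i
    rw [hLC.conn.smul (mem_univ x) df dμX, hμ.deriv_eq x I mI J mJ K mK h (e i) X dX, hd]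
    simp only [_root_.add_apply, _root_.smul_apply, inner_add_left, real_inner_smul_left]
    ring
  simp only [key, Finset.sum_add_distrib, ← Finset.mul_sum, sum_inner_mul_inner_self ho,
    sq mI h.I_I, sq mJ h.J_J, sq mK h.K_K, inner_moment_moment hn hQ hμ.mem]
  field_simp
  ring

/-- For an anti-self-dual Einstein metric, the component of `∇X` along `μ` is a multiple of
`|μ|²`. -/
lemma trace_moment_nabla {c : ℝ} {x : M} (hx : x ∈ nonzeroSet μ) {e : Fin n → VField n M}
    (he : ∀ i, SmoothVOn (e i) univ) (ho : Orthonormal ℝ fun i ↦ e i x)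
    (hW : ∀ (A : EndField n M) (V : VField n M), SmoothEndOn A univ → (∀ y, A y ∈ Q y) →
      SmoothVOn V univ →
      ∑ i, (curvature nabla (e i) (fun y ↦ A y (e i y)) V x
        - (c / 3) • ((inner ℝ (A x (e i x)) (V x) : ℝ) • e i x
            - (inner ℝ (e i x) (V x) : ℝ) • A x (e i x))) = 0) :
    ∑ i, (inner ℝ (μ x (nabla X x (e i x))) (e i x) : ℝ) = -(2 * c / 3) * momentNorm μ x ^ 2 := by
  obtain ⟨J, K, h, hs⟩ := exists_adapted_triple hn hQ hμ.mem hx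
  have mJ : J ∈ Q x := hs ▸ Submodule.subset_span (by simp)
  have sJ := hQ.skew x J mJ
  obtain ⟨A, hA, hAQ, hAx⟩ := hQ.almostQuaternionic.exists_section mJ
  have hp := momentNorm_pos hn hQ hμ.mem hx
  have hμI : μ x = momentNorm μ x • momentStructure μ x := by
    rw [momentStructure, smul_smul, mul_inv_cancel₀ hp.ne', one_smul]
  set I := momentStructure μ x with hI
  let i₀ : Fin n := ⟨0, hn⟩
  let V := e i₀
  have hV : V x ≠ 0 := ho.ne_zero i₀
  -- Contracted with J, the curvature is that of constant curvature c/3, because the Weyl tensor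
  -- vanishes on Q. Both terms of the contraction equal −J V, whence −2c/3.
  have hcurv : ∀ V : VField n M, SmoothVOn V univ →
      ∑ i, curvature nabla (e i) (fun y ↦ A y (e i y)) V x = (-(2 * c / 3)) • J (V x) := by
    intro V hV
    have h1 := hW A V hA hAQ hV
    have h2 := (tangentBasis ho).sum_repr' (V x)
    have h3 := (tangentBasis ho).sum_repr' (J (V x))
    simp only [tangentBasis_apply] at h2 h3
    have h5 := congrArg J h2
    simp only [map_sum, map_smul] at h5
    have h4 : ∀ i, (inner ℝ (J (e i x)) (V x) : ℝ) • e i x =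
        -((inner ℝ (e i x) (J (V x)) : ℝ) • e i x) := by
      intro i
      rw [sJ, neg_smul]
    simp only [hAx, Finset.sum_sub_distrib, ← Finset.smul_sum, h4, Finset.sum_neg_distrib, h3,
      h5] at h1
    linear_combination (norm := module) h1
  have hsum : ∑ i, curvature nabla (e i) (fun y ↦ A y (e i y)) (fun y ↦ μ y (V y)) x =
      μ x (∑ i, curvature nabla (e i) (fun y ↦ A y (e i y)) V x)
      + ∑ i, (tau I J K (nabla X x (e i x)) (J (e i x)) (V x)
        - tau I J K (nabla X x (J (e i x))) (e i x) (V x)) := by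
    rw [map_sum, ← Finset.sum_add_distrib]
    refine Finset.sum_congr rfl fun i _ ↦ ?_
    rw [curvature_moment hn hQ hμ hLC hX h hs (he i) (hA.apply (he i)) (he i₀), hAx]
    abel
  obtain ⟨p, q, hpq⟩ := h.sum_tau sJ (tangentBasis ho) (nabla X x) (V x)
  simp only [tangentBasis_apply] at hpq
  -- The contracted curvature −(2c/3)J has commutator (4c/3)|μ|K with μ = |μ|I. Comparing the
  -- coefficients of K with `QTriple.sum_tau` gives −2 tr(I∘∇X) = (4c/3)|μ|.
  rw [hcurv _ (hμ.smooth.apply (he i₀)), hcurv V (he i₀), hpq, hμI] at hsum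
  simp only [_root_.smul_apply, map_smul, h.I_J, h.J_I] at hsum
  have h1 := h.coeff_eq_zero' hV (a := p) (b := q)
    (c := -2 * ∑ i, (inner ℝ (I (nabla X x (e i x))) (e i x) : ℝ)
      - 4 * c / 3 * momentNorm μ x) (by
    linear_combination (norm := module) -hsum)
  have h2 := h1.2.2
  rw [hμI]
  simp only [_root_.smul_apply, real_inner_smul_left, ← Finset.mul_sum]
  linear_combination (-momentNorm μ x / 2) * h2

/-- In dimension four, the modified connection is the Levi-Civita connection of a scalar-flat
metric. -/
theorem isScalarFlatFor_modConn (h4 : n = 4) (hE : IsASDEinstein nabla Q) :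
    IsScalarFlatFor (modConn nabla Q μ) (momentNorm μ) (nonzeroSet μ) := by
  refine ⟨fun x hx Y Z hY hZ v ↦ modConn_metric hn hQ hμ hLC h4 hx hY hZ v,
    fun x hx e he ho ↦ ?_⟩
  have hU := isOpen_nonzeroSet hn hQ hμ
  obtain ⟨c, hc⟩ := hE
  -- The Einstein hypothesis speaks of global fields, so the local frame is extended from its germ
  -- at x.
  choose E hEs hEe using fun i ↦ (he i).exists_global (hU.mem_nhds hx)
  have hEx : ∀ i, E i x = e i x := fun i ↦ (hEe i).self_of_nhds
  have hoE : Orthonormal ℝ fun i ↦ E i x := by simpa only [hEx] using ho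
  obtain ⟨hRic, hW⟩ := hc x E hEs hoE
  have hcurv : ∀ i j, curvature nabla (e j) (e i) (e i) x = curvature nabla (E j) (E i) (E i) x :=
    fun i j ↦ (curvature_congr hU (hLC.conn.mono isOpen_univ hU (subset_univ _)) hx (he j) (he i)
      (he i) (hEe j) (hEe i) (hEe i)).symm
  have hscal : ∑ i, ∑ j, (inner ℝ (curvature nabla (e j) (e i) (e i) x) (e j x) : ℝ) = n * c := by
    simp only [hcurv, ← hEx, hRic _ _ (hEs _) (hEs _)]
    simp only [orthonormal_iff_ite.1 hoE, if_true, mul_one, Finset.sum_const, Finset.card_univ,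
      Fintype.card_fin, nsmul_eq_mul]
  have htr := trace_moment_nabla hn hQ hμ hLC hX hx hEs hoE hW
  simp only [hEx] at htr
  have h0 := (momentNorm_pos hn hQ hμ.mem hx).ne'
  -- With n = 4 the sum is 4c − 6 div b − 6|b|², where |b|² = |X|²/|μ|² and div b = −|X|²/|μ|² +
  -- 2c/3. Everything cancels.
  rw [scalar_conformal hLC hU (smoothVOn_logGradient hn hQ hμ hX)
    (fun y hy Y z ↦ modConn_of_eq_four hn hQ hμ hLC h4 hy Y z) hx he ho, hscal,
    divergence_logGradient hn hQ hμ hLC hX hx ho, htr, real_inner_smul_left,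
    real_inner_smul_right, inner_moment_moment hn hQ hμ.mem]
  have h4' : (n : ℝ) = 4 := by exact_mod_cast h4
  rw [h4']
  field_simp
  ring

end

end QK

end

theorem mainTheorem2 (m : ℕ) (hm : 1 ≤ m)
    {M : Type*} [TopologicalSpace M] [T2Space M]
    [ChartedSpace (EuclideanSpace ℝ (Fin (4 * m))) M] [IsManifold (𝓡 (4 * m)) ∞ M]
    [RiemannianBundle (fun x : M ↦ TangentSpace (𝓡 (4 * m)) x)]
    [IsContMDiffRiemannianBundle (𝓡 (4 * m)) ∞ (EuclideanSpace ℝ (Fin (4 * m)))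
      (fun x : M ↦ TangentSpace (𝓡 (4 * m)) x)]
    -- the quaternionic Kähler structure, with Levi-Civita connection `nabla`
    (nabla : QK.ConnOp (4 * m) M) (hLC : QK.IsLeviCivita nabla)
    (Q : ∀ x : M, Submodule ℝ (TangentSpace (𝓡 (4 * m)) x →L[ℝ] TangentSpace (𝓡 (4 * m)) x))
    (hQ : QK.IsQuaternionicKahler nabla Q)
    -- the Killing field and its moment section
    (X : QK.VField (4 * m) M) (hX : QK.IsKilling X)
    (μ : QK.EndField (4 * m) M) (hμ : QK.IsMomentSection nabla Q X μ) :
    IsOpen (QK.nonzeroSet μ) ∧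
    ∃ D : QK.ConnOp (4 * m) M,
      -- `D` is a torsion-free connection on `M₀` defining the same quaternionic structure,
      QK.IsAffineConnectionOn D (QK.nonzeroSet μ) ∧
      QK.IsTorsionFreeOn D (QK.nonzeroSet μ) ∧
      QK.PreservesOn D Q (QK.nonzeroSet μ) ∧
      -- preserving the complex structure determined by `μ`, with holonomy in `U*(2m)`,
      QK.IsParallelEndOn D (QK.momentStructure μ) (QK.nonzeroSet μ) ∧
      (∀ x ∈ QK.nonzeroSet μ,
        QK.HolonomyInUStar D (QK.nonzeroSet μ) Q (QK.momentStructure μ) x) ∧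
      -- it is unique,
      (∀ D' : QK.ConnOp (4 * m) M,
        QK.IsAffineConnectionOn D' (QK.nonzeroSet μ) →
        QK.IsTorsionFreeOn D' (QK.nonzeroSet μ) →
        QK.PreservesOn D' Q (QK.nonzeroSet μ) →
        QK.IsParallelEndOn D' (QK.momentStructure μ) (QK.nonzeroSet μ) →
        ∀ x ∈ QK.nonzeroSet μ, ∀ Y : QK.VField (4 * m) M, QK.DiffVAt Y x → D' Y x = D Y x) ∧
      -- it is given by the explicit formula,
      (∀ x ∈ QK.nonzeroSet μ, ∀ I ∈ Q x, ∀ J ∈ Q x, ∀ K ∈ Q x, QK.IsQuaternionicTriple I J K →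
        ∀ Y : QK.VField (4 * m) M, QK.DiffVAt Y x → ∀ Z : TangentSpace (𝓡 (4 * m)) x,
          D Y x Z = QK.modified (QK.momentForm μ x) I J K (nabla Y x Z) (Y x) Z) ∧
      -- the almost complex structure determined by `μ` is integrable,
      (∀ x ∈ QK.nonzeroSet μ, ∀ v, QK.momentStructure μ x (QK.momentStructure μ x v) = -v) ∧
      QK.IsIntegrableOn (QK.momentStructure μ) (QK.nonzeroSet μ) ∧
      -- and for `m = 1`, if `g` is anti-self-dual Einstein, `D` is scalar-flat Kähler.
      (m = 1 → QK.IsASDEinstein nabla Q →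
        QK.IsScalarFlatFor D (QK.momentNorm μ) (QK.nonzeroSet μ)) := by
  have hn : 0 < 4 * m := by omega
  have hU := QK.isOpen_nonzeroSet hn hQ hμ
  have hD := QK.isAffineConnectionOn_modConn hn hQ hμ hLC hX.smooth
  have hT := QK.isTorsionFreeOn_modConn (μ := μ) hn hQ hLC
  have hP := QK.preservesOn_modConn (μ := μ) hn hQ
  have hI := QK.isParallelEndOn_modConn hn hQ hμ hLC
  have hsq := fun x (hx : x ∈ QK.nonzeroSet μ) v ↦ QK.momentStructure_sq hn hQ hμ.mem hx v
  refine ⟨hU, QK.modConn nabla Q μ, hD, hT, hP, hI,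
    fun x hx ↦ QK.holonomyInUStar_modConn hm hLC hQ hX.smooth hμ hx,
    fun D' hD' hT' hP' hI' x hx Y hY ↦
      QK.eq_of_preservesOn hn hQ hμ hD hT hP hI hD' hT' hP' hI' hx hY,
    fun x _ I mI J mJ K mK h Y _ Z ↦ QK.modConn_eq_modified hn hQ mI mJ mK h Y Z, hsq,
    QK.isIntegrableOn_of_parallel hU hT (QK.smoothEndOn_momentStructure hn hQ hμ) hI hsq,
    fun h1 hE ↦ QK.isScalarFlatFor_modConn hn hQ hμ hLC hX.smooth (by omega) hE⟩
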